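/- **Conventions.** Graphs are finite and simple, with labelled vertices and edges; $[m]=\{1,\dots,m\}$. An embedding is an embedding in the oriented sphere, up to orientation-preserving homeomorphism (equivalently, a rotation system of genus $0$). *Villages.* A house is a path $v_1\dots v_7$ together with a vertex $w$ (the centre of its inhabitant) joined to $v_2,v_4,v_6$. For $I\subseteq[m]$, the village $V(m,I)$ on a planet of equator $m$ consists of a wheel (the planet) with rim $s_1\dots s_{4m}$ and, for every $i\in I$, a house $H_i$ whose $v_1$ is identified with $s_{4i-3}$ and whose $v_7$ is identified with $s_{4i-1}$. In an embedding of $V(m,I)$ the house $H_i$ has truth value $1$ if its $w$ and the centre of the wheel are on different sides of the cycle $v_1\dots v_7s_{4i-2}v_1$ of $H_i$, and $0$ otherwise. The foundation of $H_i$ is $\{s_{4i-3},\dots,s_{4i}\}$. *Hybrid deletion sequences.* Let a set $A$ of edge labels, the strict ones, be given. An isomorphism of graphs is $A$-fixing if every edge that has a label in $A$ before or after applying it keeps its label (vertices and all other edges may be relabelled). $H$ is a hybrid subgraph of $G$ if there is an $A$-fixing isomorphism from a subgraph of $G$ to $H$. A hybrid deletion sequence is a sequence $(G_1,\dots,G_n)$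 such that for each $k<n$ one of $G_k,G_{k+1}$ is a hybrid subgraph of the other. A simultaneous embedding of it is a sequence of embeddings $\sigma_k$ of $G_k$ such that for each $k<n$ the embedding of the smaller of $G_k,G_{k+1}$ is, up to an $A$-fixing isomorphism, the one induced on some subgraph of the larger by the embedding of the larger. Its length is $n$ and its size is $\sum_k|E(G_k)|$. *Housing sequences.* An $(I,m)$-housing sequence is a hybrid deletion sequence of $2$-connected graphs whose first and last graphs are isomorphic to $V(m,I)$, such that the planet is one and the same subgraph of all graphs of the sequence, in each graph every vertex other than the centre of the planet has smaller degree than the centre, and in every simultaneous embedding the first and the last graph have the same embedding. Its allocation set consists of the functions $I\to\{0,1\}$ that map $i$ to the truth value of $H_i$ in $\sigma_1$, for its simultaneous embeddings $(\sigma_1,\dots,\sigma_n)$. A pair of distinct $i,j\in I$ is an arch if some graph of the sequence contains a path between the foundations of $H_i$ and $H_j$ that uses no edge of the planet and contains no vertex of the planet other than its two end-vertices. **Lemma.** For every $m\in 3\mathbb N$ and $i\in[m/3]$ there is a $(\{3i-2,3i-1,3i\},m)$-housing sequence of length $15$ and size at most $300m$ whose allocation set is $$\{f:\{3i-2,3i-1,3i\}\to\{0,1\}\mid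 f(3i-2)\vee f(3i-1)\vee f(3i)=1\}$$ and whose set of arches is $\{\{3i-2,3i-1\},\{3i-1,3i\}\}$. -/

import Mathlib

/-! ### Graphs with labelled edges

A graph is a simple `Graph α β`: vertices are labelled by `α` and edges are labelled by `β`. -/

namespace Village

/-- `f` (on vertices) and `g` (on edge labels) form a graph isomorphism from `G` to `H`. -/
structure IsIso {α β α' β' : Type*} (f : α → α') (g : β → β')
    (G : Graph α β) (H : Graph α' β') : Prop where
  bijOn_vertexSet : Set.BijOn f G.vertexSet H.vertexSet
  bijOn_edgeSet : Set.BijOn g G.edgeSet H.edgeSet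
  isLink : ∀ ⦃e x y⦄, G.IsLink e x y → H.IsLink (g e) (f x) (f y)

/-- `G` is connected (in particular nonempty). -/
def Connected {α β : Type*} (G : Graph α β) : Prop :=
  G.vertexSet.Nonempty ∧
    ∀ x ∈ G.vertexSet, ∀ y ∈ G.vertexSet, Relation.ReflTransGen G.Adj x y

/-- `G` is 2-connected: it has at least three vertices, is connected, and has no cutvertex. -/
def TwoConnected {α β : Type*} (G : Graph α β) : Prop :=
  3 ≤ G.vertexSet.encard ∧ Connected G ∧
    ∀ x ∈ G.vertexSet, Connected (G.deleteVerts {x})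

/-- The number of edges incident with `v`; used for loopless graphs only. -/
noncomputable def degree {α β : Type*} (G : Graph α β) (v : α) : ℕ :=
  (G.incidenceSet v).ncard

/-! ### Embeddings in the oriented sphere -/

/-- The darts (edges together with one of their ends) of a graph. A dart `(v, e)` stands for the
edge `e` traversed starting from `v`. -/
abbrev Dart {α β : Type*} (G : Graph α β) : Type _ := {d : α × β // G.Inc d.2 d.1}

/-- One step of the face traversal: after traversing `e` from `v` to `u`, continue at `u` with the
successor of `e` in the rotation at `u`. -/
def FaceStep {α β : Type*} (G : Graph α β) (rot : α → Equiv.Perm β) (d d' : Dart G) : Prop :=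
  G.IsLink d.1.2 d.1.1 d'.1.1 ∧ d'.1.2 = rot d'.1.1 d.1.2

/-- The faces of a rotation system: the orbits of the face traversal on the darts. -/
def Face {α β : Type*} (G : Graph α β) (rot : α → Equiv.Perm β) : Type _ :=
  Quot (FaceStep G rot)

/-- An embedding of a finite connected loopless graph in the oriented sphere (up to
orientation-preserving homeomorphism), given combinatorially by a rotation system (a cyclic
ordering of the edges at each vertex) of Euler genus zero. -/
structure Embedding {α β : Type*} (G : Graph α β) where
  rot : α → Equiv.Perm β
  isCycleOn : ∀ v ∈ G.vertexSet, (rot v).IsCycleOn (G.incidenceSet v)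
  euler : (G.vertexSet.ncard : ℤ) - G.edgeSet.ncard + Nat.card (Face G rot) = 2

/-- Two darts bound the same component of the sphere minus the subgraph with edge set `C`: a
component of the complement is a union of faces, glued along the edges outside `C` (the darts
`(u, e)` and `(v, e)` of an edge `e = uv` belong to the faces on the two sides of `e`). -/
def SameRegion {α β : Type*} {G : Graph α β} (φ : Embedding G) (C : Set β) :
    Dart G → Dart G → Prop :=
  Relation.EqvGen fun d d' =>
    FaceStep G φ.rot d d' ∨ (d.1.2 ∉ C ∧ d'.1.2 = d.1.2 ∧ G.IsLink d.1.2 d.1.1 d'.1.1)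

/-- The vertices `x` and `y`, not on the cycle with edge set `C`, are in the same one of the
disks bounded by that cycle. (All darts starting at such a vertex are in the same region.) -/
def SameSide {α β : Type*} {G : Graph α β} (φ : Embedding G) (C : Set β) (x y : α) : Prop :=
  ∃ d d' : Dart G, d.1.1 = x ∧ d'.1.1 = y ∧ SameRegion φ C d d'

/-- In the embedding induced by `φ` on the subgraph `G'`, the edge `e'` is the successor of `e`
at the vertex `v`: it is the first edge of `G'` strictly after `e` in the rotation of `φ` at `v`. -/
def InducedNext {α β : Type*} {G : Graph α β} (φ : Embedding G) (G' : Graph α β)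
    (v : α) (e e' : β) : Prop :=
  ∃ k : ℕ, 0 < k ∧ (φ.rot v ^ k) e = e' ∧ G'.Inc e' v ∧
    ∀ j, 0 < j → j < k → ¬ G'.Inc ((φ.rot v ^ j) e) v

/-! ### Hybrid deletion sequences -/

/-- An isomorphism from `G` to `H` fixing the strict edge labels `A`: strict labels are neither
changed nor newly assigned, while the vertices and the other edges are relabelled freely. -/
structure IsFixingIso {α β : Type*} (A : Set β) (f : α → α) (g : β → β)
    (G H : Graph α β) : Prop extends IsIso f g G H where
  fixes : ∀ e ∈ G.edgeSet, e ∈ A ∨ g e ∈ A → g e = e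

/-- `H` is a hybrid subgraph of `G` with respect to the strict edges `A`. -/
def HybridSubgraph {α β : Type*} (A : Set β) (H G : Graph α β) : Prop :=
  ∃ G' ≤ G, ∃ f g, IsFixingIso A f g G' H

/-- `ψ` is, up to an `A`-fixing isomorphism, the embedding induced by `φ` on some subgraph. -/
def WeaklyInduces {α β : Type*} (A : Set β) {G H : Graph α β}
    (φ : Embedding G) (ψ : Embedding H) : Prop :=
  ∃ G' ≤ G, ∃ f g, IsFixingIso A f g G' H ∧
    ∀ v e e', G'.Inc e v → G'.Inc e' v →
      (InducedNext φ G' v e e' ↔ ψ.rot (f v) (g e) = g e')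

/-- A hybrid deletion sequence of finite 2-connected graphs, with set `strict` of strict edges. -/
structure HybridDeletionSequence (α β : Type*) where
  steps : ℕ
  graph : Fin (steps + 1) → Graph α β
  strict : Set β
  vertexSet_finite : ∀ k, (graph k).vertexSet.Finite
  edgeSet_finite : ∀ k, (graph k).edgeSet.Finite
  simple : ∀ k, (graph k).Simple
  twoConnected : ∀ k, TwoConnected (graph k)
  hybrid : ∀ k : Fin steps,
    HybridSubgraph strict (graph k.castSucc) (graph k.succ) ∨
      HybridSubgraph strict (graph k.succ) (graph k.castSucc)

namespace HybridDeletionSequence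

variable {α β : Type*}

/-- The length of a sequence is its number of graphs. -/
def length (S : HybridDeletionSequence α β) : ℕ := S.steps + 1

/-- The size of a sequence is the total number of edges of its graphs. -/
noncomputable def size (S : HybridDeletionSequence α β) : ℕ :=
  ∑ k, (S.graph k).edgeSet.ncard

end HybridDeletionSequence

/-- A (hybrid) simultaneous embedding of a hybrid deletion sequence. -/
structure SimultaneousEmbedding {α β : Type*} (S : HybridDeletionSequence α β) where
  emb : ∀ k, Embedding (S.graph k)
  up : ∀ k : Fin S.steps,
    HybridSubgraph S.strict (S.graph k.castSucc) (S.graph k.succ) →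
      WeaklyInduces S.strict (emb k.succ) (emb k.castSucc)
  down : ∀ k : Fin S.steps,
    ¬ HybridSubgraph S.strict (S.graph k.castSucc) (S.graph k.succ) →
      WeaklyInduces S.strict (emb k.castSucc) (emb k.succ)

/-! ### Villages -/

/-- Labels for the vertices of villages: the centre of the wheel, the rim vertices `s_j`, the
vertices `v_k` (`2 ≤ k ≤ 6`) of the `i`-th house and the centre `w` of its inhabitant. -/
inductive VVertex where
  | centre
  | surface (j : ℕ)
  | house (i k : ℕ)
  | inhabitant (i : ℕ)

/-- Labels for the edges of villages: the spoke at `s_j`, the rim edge from `s_j` to its successor,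
the edge `v_k v_{k+1}` of the `i`-th house, and the edge from `w` to `v_k` in the `i`-th house. -/
inductive VEdge where
  | spoke (j : ℕ)
  | rim (j : ℕ)
  | wall (i k : ℕ)
  | claw (i k : ℕ)

/-- The vertex `v_k` of the `i`-th house, where `v_1` is identified with `s_{4i-3}` and `v_7` is
identified with `s_{4i-1}`. -/
def houseVertex (i k : ℕ) : VVertex :=
  if k = 1 then .surface (4 * i - 3) else if k = 7 then .surface (4 * i - 1) else .house i k

/-- The two ends of an edge of a village on a planet of equator `m`. -/
def ends (m : ℕ) : VEdge → VVertex × VVertex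
  | .spoke j => (.centre, .surface j)
  | .rim j => (.surface j, .surface (if j = 4 * m then 1 else j + 1))
  | .wall i k => (houseVertex i k, houseVertex i (k + 1))
  | .claw i k => (.inhabitant i, houseVertex i k)

/-- The vertices of the village with index set `I` on a planet of equator `m`. -/
def IsVertex (m : ℕ) (I : Set ℕ) : VVertex → Prop
  | .centre => True
  | .surface j => 1 ≤ j ∧ j ≤ 4 * m
  | .house i k => i ∈ I ∧ 2 ≤ k ∧ k ≤ 6
  | .inhabitant i => i ∈ I

/-- The edges of the village with index set `I` on a planet of equator `m`. -/
def IsEdge (m : ℕ) (I : Set ℕ) : VEdge → Prop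
  | .spoke j => 1 ≤ j ∧ j ≤ 4 * m
  | .rim j => 1 ≤ j ∧ j ≤ 4 * m
  | .wall i k => i ∈ I ∧ 1 ≤ k ∧ k ≤ 6
  | .claw i k => i ∈ I ∧ (k = 2 ∨ k = 4 ∨ k = 6)

theorem isVertex_houseVertex {m : ℕ} {I : Set ℕ} (hI : I ⊆ Set.Icc 1 m) {i k : ℕ}
    (hi : i ∈ I) (h1 : 1 ≤ k) (h7 : k ≤ 7) : IsVertex m I (houseVertex i k) := by
  have h := hI hi
  simp only [Set.mem_Icc] at h
  unfold houseVertex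
  split_ifs <;> simp only [IsVertex]
  · omega
  · omega
  · exact ⟨hi, by omega, by omega⟩

theorem isVertex_ends {m : ℕ} {I : Set ℕ} (hI : I ⊆ Set.Icc 1 m) {e : VEdge}
    (he : IsEdge m I e) : IsVertex m I (ends m e).1 ∧ IsVertex m I (ends m e).2 := by
  cases e with
  | spoke j => exact ⟨trivial, he⟩
  | rim j =>
    refine ⟨he, ?_⟩
    simp only [IsEdge] at he
    simp only [ends, IsVertex]
    split_ifs <;> omega
  | wall i k =>
    obtain ⟨hi, h1, h6⟩ := he
    exact ⟨isVertex_houseVertex hI hi h1 (by omega),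
      isVertex_houseVertex hI hi (by omega) (by omega)⟩
  | claw i k =>
    obtain ⟨hi, hk⟩ := he
    exact ⟨hi, isVertex_houseVertex hI hi (by omega) (by omega)⟩

/-- The village `V(m, I)` with index set `I ⊆ {1, …, m}` on a planet of equator `m`. -/
def village (m : ℕ) (I : Set ℕ) (hI : I ⊆ Set.Icc 1 m) : Graph VVertex VEdge where
  vertexSet := {x | IsVertex m I x}
  edgeSet := {e | IsEdge m I e}
  IsLink e x y := IsEdge m I e ∧ s(x, y) = s((ends m e).1, (ends m e).2)
  isLink_symm := fun _ _ => ⟨fun x y h => ⟨h.1, by rw [Sym2.eq_swap, h.2]⟩⟩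
  eq_or_eq_of_isLink_of_isLink := by
    rintro e x y v w ⟨-, h⟩ ⟨-, h'⟩
    have h2 := h.trans h'.symm
    rw [Sym2.eq_iff] at h2
    tauto
  edge_mem_iff_exists_isLink := fun e =>
    ⟨fun h => ⟨_, _, h, rfl⟩, fun ⟨_, _, h, _⟩ => h⟩
  left_mem_of_isLink := by
    rintro e x y ⟨he, h⟩
    have h2 := isVertex_ends hI he
    rw [Sym2.eq_iff] at h
    rcases h with ⟨rfl, -⟩ | ⟨rfl, -⟩
    · exact h2.1
    · exact h2.2

/-- The planet of equator `m`: the wheel with rim `s_1 … s_{4m}`. -/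
def planet (m : ℕ) : Graph VVertex VEdge := village m ∅ (Set.empty_subset _)

/-- The edge set of the bounding cycle of the `i`-th house: the path `v_1 … v_7` together with the
path `s_{4i-3} s_{4i-2} s_{4i-1}`. -/
def boundingCycle (i : ℕ) : Set VEdge :=
  {e | (∃ k, 1 ≤ k ∧ k ≤ 6 ∧ e = .wall i k) ∨ e = .rim (4 * i - 3) ∨ e = .rim (4 * i - 2)}

/-- The foundation `s_{4i-3}, …, s_{4i}` of the `i`-th house. -/
def foundation (i : ℕ) : Set VVertex :=
  {x | ∃ j, 4 * i - 3 ≤ j ∧ j ≤ 4 * i ∧ x = .surface j}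

/-! ### Housing sequences -/

/-- An `(I, m)`-housing sequence. The maps `startV`, `startE` and `endV`, `endE` identify `V(m, I)`
with the first and with the last graph; the planet is one and the same subgraph of all graphs. -/
structure HousingSequence (m : ℕ) (I : Set ℕ) (α β : Type*) extends
    HybridDeletionSequence α β where
  index_subset : I ⊆ Set.Icc 1 m
  startV : VVertex → α
  startE : VEdge → β
  start_isIso : IsIso startV startE (village m I index_subset) (graph 0)
  endV : VVertex → α
  endE : VEdge → β
  end_isIso : IsIso endV endE (village m I index_subset) (graph (Fin.last steps))
  endV_planet : ∀ x ∈ (planet m).vertexSet, endV x = startV x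
  endE_planet : ∀ e ∈ (planet m).edgeSet, endE e = startE e
  planet_le : ∀ k e x y, (planet m).IsLink e x y →
    (graph k).IsLink (startE e) (startV x) (startV y)
  degree_lt : ∀ k, ∀ v ∈ (graph k).vertexSet, v ≠ startV .centre →
    degree (graph k) v < degree (graph k) (startV .centre)
  /-- In every simultaneous embedding, the first and last graph have the same embedding. -/
  same_embedding : ∀ σ : SimultaneousEmbedding toHybridDeletionSequence, ∀ v e e',
    (village m I index_subset).Inc e v → (village m I index_subset).Inc e' v →
      ((σ.emb 0).rot (startV v) (startE e) = startE e' ↔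
        (σ.emb (Fin.last steps)).rot (endV v) (endE e) = endE e')

namespace HousingSequence

variable {α β : Type*} {m : ℕ} {I : Set ℕ}

/-- The inhabitant of the `i`-th house of the first graph is embedded inside its house, that is,
not on the side of the bounding cycle that contains the centre of the planet. -/
def Inside (S : HousingSequence m I α β)
    (σ : SimultaneousEmbedding S.toHybridDeletionSequence) (i : ℕ) : Prop :=
  ¬ SameSide (σ.emb 0) (S.startE '' boundingCycle i) (S.startV .centre) (S.startV (.inhabitant i))

open Classical in
/-- The allocation function of a simultaneous embedding: the truth values of the houses. -/
noncomputable def allocation (S : HousingSequence m I α β)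
    (σ : SimultaneousEmbedding S.toHybridDeletionSequence) : I → Bool :=
  fun i => decide (S.Inside σ i)

/-- The allocation set: all allocation functions of simultaneous embeddings. -/
def allocationSet (S : HousingSequence m I α β) : Set (I → Bool) :=
  Set.range S.allocation

/-- There is a path `p 0, …, p n` in some graph of the sequence from the foundation of the `i`-th
house to the foundation of the `j`-th house that uses no edge of the planet and that meets the
planet in its end-vertices only. -/
def IsArch (S : HousingSequence m I α β) (i j : ℕ) : Prop :=
  ∃ (k : Fin (S.steps + 1)) (n : ℕ) (p : ℕ → α),
    p 0 ∈ S.startV '' foundation i ∧ p n ∈ S.startV '' foundation j ∧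
    Set.InjOn p (Set.Icc 0 n) ∧
    (∀ t < n, ∃ e, e ∉ S.startE '' (planet m).edgeSet ∧
      (S.graph k).IsLink e (p t) (p (t + 1))) ∧
    ∀ t, 0 < t → t < n → p t ∉ S.startV '' (planet m).vertexSet

/-- The set of arches, as unordered pairs of distinct indices. -/
def arches (S : HousingSequence m I α β) : Set (Sym2 ℕ) :=
  {z | ∃ i ∈ I, ∃ j ∈ I, i ≠ j ∧ S.IsArch i j ∧ z = s(i, j)}

end HousingSequence

/-- `OR(K)`, in the context of an index set `I` and a set `K` of triples of elements of `I`. -/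
def OR (I : Set ℕ) (K : Set (I × I × I)) : Set (I → Bool) :=
  {f | ∀ t ∈ K, (f t.1 || f t.2.1 || f t.2.2) = true}

end Village

/-! The gadget carries truth values in the orientation of small movable graphs. A piece is a cycle
of length five, cut by its two attachment vertices into a path of length two and one of length
three. The lengths differ, so an isomorphism that respects the attachments cannot exchange the two
paths, and the cyclic order at an attachment vertex is one bit that survives deletions and
relabellings. The edges of planet and houses are strict, those of the pieces are not.

Reading a house. Two pieces are attached to the two ends of the house on the rim; one is tied to the
wall by one of its paths, the other to the inhabitant by its other path. The inhabitant's three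
edges separate the tied wall vertex from the rim on the inhabitant's side of the wall. So one piece
lies inside the house and the other outside, which is which depends on the truth value, and both
orientations equal the truth value. The next graph keeps one piece. As labels of pieces are free,
either may be kept; for a realisation the outer one is kept, because it can be attached to a
neighbouring house afterwards.

Disjunction. A piece that carries an earlier value is attached to the next house as well, next to
pieces that carry another value, and then one of them is kept. The kept piece carries the value true
only if one of the candidates does, and if one does it can be chosen. This computes first the
disjunction of the values of the houses 0 and 1, and then that with house 2. Finally the long path
of the surviving piece is joined to a further rim vertex, which is possible only in the orientation
for true. The rest of the sequence repeats the village.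

Necessity (`not_allZero`). If all houses have value zero, then every candidate at every step has the
orientation for false, against `sgn_outer_nine`. Orientations are compared with that of the planet,
so mirror images need no separate treatment. The comparisons rest on a Jordan curve theorem for
rotation systems: over the field with two elements the boundaries of sets of faces lie in the cycle
space, and genus zero forces equality of dimensions (`Embedding.exists_coloring`). Hence edges
leaving a cycle towards the same connected part avoiding it leave on the same side
(`IsCycleWalk.between_iff`). `exists_slot` finds the possible images of a piece under a step.

Sufficiency (`exists_simultaneousEmbedding`). For every triple other than all false explicit
rotations are given. By the same dimension count it is enough to exhibit sufficiently many faces, a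
finite check independent of the size of the planet; compatibility of consecutive rotations is
likewise checked by evaluation. -/

namespace Village

open Module

/-! ### Euler's inequality and the Jordan curve theorem over the field with two elements -/

section Planarity

variable {α β : Type*} {G : Graph α β}

theorem finite_dart (hV : G.vertexSet.Finite) (hE : G.edgeSet.Finite) : Finite (Dart G) := by
  have : {d : α × β | G.Inc d.2 d.1}.Finite :=
    (hV.prod hE).subset fun d hd => ⟨hd.vertex_mem, hd.edge_mem⟩
  exact this.to_subtype

/-- The vertex-edge incidence matrix over the field with two elements. -/
noncomputable def incMatrix (G : Graph α β) : Matrix G.vertexSet G.edgeSet (ZMod 2) :=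
  open Classical in fun v e => if G.Inc e v then 1 else 0

theorem incMatrix_transpose_mulVec [Fintype G.vertexSet] [G.Loopless]
    (f : G.vertexSet → ZMod 2) {e : β} {x y : α} (h : G.IsLink e x y) :
    (incMatrix G).transpose.mulVec f ⟨e, h.edge_mem⟩
      = f ⟨x, h.left_mem⟩ + f ⟨y, h.right_mem⟩ := by
  classical
  have hne : (⟨x, h.left_mem⟩ : G.vertexSet) ≠ ⟨y, h.right_mem⟩ := by
    simpa using h.ne
  simp only [Matrix.mulVec, dotProduct, Matrix.transpose_apply, incMatrix]
  rw [← Finset.sum_pair hne]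
  symm
  refine Finset.sum_subset_zero_on_sdiff (Finset.subset_univ _) ?_ ?_
  · intro v hv
    have : ¬ G.Inc e v := by
      intro hi
      have := hi.eq_or_eq_of_isLink h
      simp only [Finset.mem_sdiff, Finset.mem_univ, true_and, Finset.mem_insert,
        Finset.mem_singleton, not_or] at hv
      rcases this with h' | h'
      · exact hv.1 (Subtype.ext h')
      · exact hv.2 (Subtype.ext h')
    simp [this]
  · intro v hv
    simp only [Finset.mem_insert, Finset.mem_singleton] at hv
    rcases hv with rfl | rfl
    · simp [h.inc_left]
    · simp [h.inc_right]

theorem Connected.exists_const {K : Type*} (hG : Connected G) (f : G.vertexSet → K)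
    (h : ∀ e x y, (h : G.IsLink e x y) → f ⟨x, h.left_mem⟩ = f ⟨y, h.right_mem⟩)
    (x y : G.vertexSet) : f x = f y := by
  obtain ⟨x, hx⟩ := x
  obtain ⟨y, hy⟩ := y
  have := hG.2 x hx y hy
  induction this with
  | refl => rfl
  | tail _ hbc ih =>
    obtain ⟨e, he⟩ := hbc
    exact (ih he.left_mem).trans (h _ _ _ he)

theorem finrank_le_one_of_const {K ι : Type*} [Field K] [Finite ι] (W : Submodule K (ι → K))
    (h : ∀ f ∈ W, ∀ x y, f x = f y) : finrank K W ≤ 1 := by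
  have : W ≤ Submodule.span K {fun _ => (1 : K)} := by
    intro f hf
    rw [Submodule.mem_span_singleton]
    rcases isEmpty_or_nonempty ι with hi | ⟨⟨i⟩⟩
    · exact ⟨0, Subsingleton.elim _ _⟩
    · exact ⟨f i, by ext j; simp [h f hf i j]⟩
  exact (Submodule.finrank_mono this).trans (finrank_span_le_card _ |>.trans (by simp))

/-- A vector killed by the transpose has equal values at the ends of every edge, so it is constant
on a connected graph. The rank is therefore at least the number of vertices minus one, and
rank-nullity bounds the cycle space. -/
theorem finrank_ker_incMatrix [Fintype G.vertexSet] [Fintype G.edgeSet] [G.Loopless]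
    (hG : Connected G) :
    finrank (ZMod 2) (LinearMap.ker (incMatrix G).mulVecLin) + Fintype.card G.vertexSet
      ≤ Fintype.card G.edgeSet + 1 := by
  have h1 := (incMatrix G).mulVecLin.finrank_range_add_finrank_ker
  have h2 := (incMatrix G).transpose.mulVecLin.finrank_range_add_finrank_ker
  have h3 : finrank (ZMod 2) (LinearMap.range (incMatrix G).mulVecLin)
      = finrank (ZMod 2) (LinearMap.range (incMatrix G).transpose.mulVecLin) :=
    (Matrix.rank_transpose (incMatrix G)).symm
  have h4 : finrank (ZMod 2) (LinearMap.ker (incMatrix G).transpose.mulVecLin) ≤ 1 := by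
    apply finrank_le_one_of_const
    intro f hf
    apply hG.exists_const
    intro e x y h
    have := congrFun (LinearMap.mem_ker.1 hf) ⟨e, h.edge_mem⟩
    rw [Matrix.mulVecLin_apply, incMatrix_transpose_mulVec f h] at this
    exact CharTwo.add_eq_zero.1 this
  simp only [Module.finrank_fintype_fun_eq_card] at h1 h2
  omega

/-- The face to which a dart belongs. -/
def faceOf (rot : α → Equiv.Perm β) {e : β} {v : α} (h : G.Inc e v) : Face G rot :=
  Quot.mk _ ⟨(v, e), h⟩

variable {rot : α → Equiv.Perm β}

theorem inc_rot (hrot : ∀ v ∈ G.vertexSet, (rot v).IsCycleOn (G.incidenceSet v)) {e : β} {v : α}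
    (h : G.Inc e v) : G.Inc (rot v e) v :=
  (hrot v h.vertex_mem).1.mapsTo h

theorem faceOf_rot (hrot : ∀ v ∈ G.vertexSet, (rot v).IsCycleOn (G.incidenceSet v)) {e : β}
    {x y : α} (h : G.IsLink e x y) :
    faceOf rot (inc_rot hrot h.inc_right) = faceOf rot h.inc_left :=
  (Quot.sound ⟨h, rfl⟩).symm

theorem exists_ends (e : G.edgeSet) : ∃ p : α × α, G.IsLink e p.1 p.2 := by
  obtain ⟨x, y, h⟩ := Graph.exists_isLink_of_mem_edgeSet e.2
  exact ⟨(x, y), h⟩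

/-- The coboundary of a function on the faces. -/
noncomputable def faceDelta (G : Graph α β) (rot : α → Equiv.Perm β) :
    (Face G rot → ZMod 2) →ₗ[ZMod 2] (G.edgeSet → ZMod 2) where
  toFun χ e := χ (faceOf rot (exists_ends e).choose_spec.inc_left)
    + χ (faceOf rot (exists_ends e).choose_spec.inc_right)
  map_add' _ _ := by ext; simp only [Pi.add_apply]; ring
  map_smul' _ _ := by ext; simp only [Pi.smul_apply, smul_eq_mul, RingHom.id_apply]; ring

theorem faceDelta_apply (χ : Face G rot → ZMod 2) {e : β} {x y : α} (h : G.IsLink e x y) :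
    faceDelta G rot χ ⟨e, h.edge_mem⟩ = χ (faceOf rot h.inc_left) + χ (faceOf rot h.inc_right) := by
  have key : ∀ p : α × α, ∀ hp : G.IsLink e p.1 p.2,
      χ (faceOf rot hp.inc_left) + χ (faceOf rot hp.inc_right)
        = χ (faceOf rot h.inc_left) + χ (faceOf rot h.inc_right) := by
    rintro ⟨p1, p2⟩ hp
    rcases h.eq_and_eq_or_eq_and_eq hp with ⟨rfl, rfl⟩ | ⟨rfl, rfl⟩
    · rfl
    · exact add_comm _ _
  exact key _ (exists_ends ⟨e, h.edge_mem⟩).choose_spec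

/-- The dual of a connected graph is connected: a function on the faces with zero image does not
change across an edge, hence not around a vertex, hence nowhere. So the kernel is at most a line. -/
theorem finrank_range_faceDelta [Finite (Face G rot)] (hG : Connected G)
    (hrot : ∀ v ∈ G.vertexSet, (rot v).IsCycleOn (G.incidenceSet v)) :
    Nat.card (Face G rot) ≤ finrank (ZMod 2) (LinearMap.range (faceDelta G rot)) + 1 := by
  have := Fintype.ofFinite (Face G rot)
  have h1 := (faceDelta G rot).finrank_range_add_finrank_ker
  have h2 : finrank (ZMod 2) (LinearMap.ker (faceDelta G rot)) ≤ 1 := by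
    apply finrank_le_one_of_const
    intro χ hχ
    have hlink : ∀ {e x y} (h : G.IsLink e x y),
        χ (faceOf rot h.inc_left) = χ (faceOf rot h.inc_right) := by
      intro e x y h
      have := congrFun (LinearMap.mem_ker.1 hχ) ⟨e, h.edge_mem⟩
      rw [faceDelta_apply χ h] at this
      exact CharTwo.add_eq_zero.1 this
    have hstep : ∀ {e v} (h : G.Inc e v),
        χ (faceOf rot (inc_rot hrot h)) = χ (faceOf rot h) := by
      intro e v h
      obtain ⟨u, hu⟩ := h
      rw [show faceOf rot (inc_rot hrot ⟨u, hu⟩) = faceOf rot hu.inc_right from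
        faceOf_rot hrot hu.symm, ← hlink hu]
    have hvert : ∀ {e e' v} (h : G.Inc e v) (h' : G.Inc e' v),
        χ (faceOf rot h) = χ (faceOf rot h') := by
      intro e e' v h h'
      obtain ⟨n, hn⟩ := (hrot v h.vertex_mem).2 h h'
      have hmem : ∀ n : ℤ, G.Inc ((rot v ^ n) e) v := fun n =>
        (hrot v h.vertex_mem).1.perm_zpow n |>.mapsTo h
      have key : ∀ n : ℤ, χ (faceOf rot (hmem n)) = χ (faceOf rot h) := by
        intro n
        induction n with
        | zero => rfl
        | succ n ih =>
          rw [← ih, ← hstep (hmem n)]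
          congr 2
          rw [add_comm, zpow_add]; rfl
        | pred n ih =>
          rw [← ih, ← hstep (hmem (-n - 1))]
          congr 2
          rw [← Equiv.Perm.mul_apply, ← zpow_one_add]
          congr 2
          omega
      rw [← key n]
      congr 2
    -- The common value around a vertex is stored as an option, because a vertex without edges has
    -- no face to read it from.
    have hconst : ∃ c : ZMod 2, ∀ {e v} (h : G.Inc e v), χ (faceOf rot h) = c := by
      classical
      let f : G.vertexSet → Option (ZMod 2) := fun v =>
        if h : ∃ e, G.Inc e v then some (χ (faceOf rot h.choose_spec)) else none
      have hf : ∀ {e v} (h : G.Inc e v), f ⟨v, h.vertex_mem⟩ = some (χ (faceOf rot h)) := by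
        intro e v h
        have : ∃ e, G.Inc e v := ⟨e, h⟩
        simp only [f, this, dite_true]
        exact congrArg some (hvert _ _)
      by_cases hne : ∃ e v, G.Inc e v
      · obtain ⟨e0, v0, h0⟩ := hne
        refine ⟨χ (faceOf rot h0), fun {e v} h => ?_⟩
        have := hG.exists_const f (fun e x y h => by
          rw [hf h.inc_left, hf h.inc_right, hlink h]) ⟨v, h.vertex_mem⟩ ⟨v0, h0.vertex_mem⟩
        rw [hf h, hf h0] at this
        exact Option.some.inj this
      · exact ⟨0, fun {e v} h => absurd ⟨e, v, h⟩ hne⟩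
    obtain ⟨c, hc⟩ := hconst
    rintro ⟨⟨⟨v, e⟩, h⟩⟩ ⟨⟨⟨v', e'⟩, h'⟩⟩
    exact (hc h).trans (hc h').symm
  rw [Module.finrank_fintype_fun_eq_card] at h1
  rw [Nat.card_eq_fintype_card]
  omega

/-- At a vertex, each edge contributes the value of its own face and that of the face of its
successor. The rotation permutes the edges at the vertex, so every value is counted twice. -/
theorem range_faceDelta_le [Fintype G.edgeSet]
    (hrot : ∀ v ∈ G.vertexSet, (rot v).IsCycleOn (G.incidenceSet v)) :
    LinearMap.range (faceDelta G rot) ≤ LinearMap.ker (incMatrix G).mulVecLin := by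
  classical
  rintro _ ⟨χ, rfl⟩
  rw [LinearMap.mem_ker]
  ext ⟨v, hv⟩
  simp only [Matrix.mulVecLin_apply, Matrix.mulVec, dotProduct, incMatrix, Pi.zero_apply]
  let h : β → ZMod 2 := fun e => if h : G.Inc e v then χ (faceOf rot h) else 0
  have hS : ∀ e : G.edgeSet, (if G.Inc e v then (1 : ZMod 2) else 0) * faceDelta G rot χ e
      = h e + h (rot v e) := by
    rintro ⟨e, he⟩
    by_cases hi : G.Inc e v
    · obtain ⟨u, hu⟩ := id hi
      have h1 : h e = χ (faceOf rot hi) := by simp [h, hi]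
      have h2 : h (rot v e) = χ (faceOf rot hu.inc_right) := by
        have hir := inc_rot hrot hi
        simp only [h, hir, dite_true]
        rw [show faceOf rot hir = _ from faceOf_rot hrot hu.symm]
      rw [h1, h2, faceDelta_apply χ hu]
      simp [hi]
    · have : ¬ G.Inc (rot v e) v := by
        intro hc
        obtain ⟨e', he', hee⟩ := (hrot v hv).1.surjOn hc
        rw [(rot v).injective hee] at he'
        exact hi he'
      simp [h, hi, this]
  rw [Finset.sum_congr rfl fun e _ => hS e, Finset.sum_add_distrib]
  -- The permutation acts on all labels and need not preserve the edge set, so the sum is first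
  -- extended by zero to all labels and then reindexed.
  have hperm : ∑ e : G.edgeSet, h (rot v e) = ∑ e : G.edgeSet, h e := by
    have hz : ∀ g : β → ZMod 2, (∀ e, ¬ G.Inc e v → g e = 0) →
        ∑ e : G.edgeSet, g e = ∑ᶠ e, g e := by
      intro g hg
      rw [← finsum_eq_sum_of_fintype, finsum_set_coe_eq_finsum_mem]
      refine finsum_congr fun e => ?_
      by_cases he : e ∈ G.edgeSet
      · simp [he]
      · simp [he, hg e fun hi => he hi.edge_mem]
    rw [hz (fun e => h (rot v e)), hz h, finsum_comp_equiv (rot v)]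
    · intro e he; simp [h, he]
    · intro e hi
      have : ¬ G.Inc (rot v e) v := by
        intro hc
        obtain ⟨e', he', hee⟩ := (hrot v hv).1.surjOn hc
        rw [(rot v).injective hee] at he'
        exact hi he'
      simp [h, this]
  rw [hperm, CharTwo.add_self_eq_zero]

/-- The genus is not negative: boundaries of sets of faces span at least `F - 1` dimensions inside a
cycle space of at most `E - V + 1`. -/
theorem card_face_le [Fintype G.vertexSet] [Fintype G.edgeSet] [G.Loopless] (hG : Connected G)
    (hrot : ∀ v ∈ G.vertexSet, (rot v).IsCycleOn (G.incidenceSet v)) [Finite (Face G rot)] :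
    Nat.card (Face G rot) + Fintype.card G.vertexSet ≤ Fintype.card G.edgeSet + 2 := by
  have h1 := finrank_range_faceDelta hG hrot
  have h2 := Submodule.finrank_mono (range_faceDelta_le hrot)
  have h3 := finrank_ker_incMatrix hG
  omega

theorem finite_face (hV : G.vertexSet.Finite) (hE : G.edgeSet.Finite) : Finite (Face G rot) :=
  have := finite_dart hV hE
  inferInstanceAs (Finite (Quot _))

/-- A rotation system with sufficiently many faces is an embedding in the sphere. -/
theorem euler_of_le_card_face [G.Loopless] (hV : G.vertexSet.Finite) (hE : G.edgeSet.Finite)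
    (hG : Connected G) (hrot : ∀ v ∈ G.vertexSet, (rot v).IsCycleOn (G.incidenceSet v))
    (h : G.edgeSet.ncard + 2 ≤ Nat.card (Face G rot) + G.vertexSet.ncard) :
    (G.vertexSet.ncard : ℤ) - G.edgeSet.ncard + Nat.card (Face G rot) = 2 := by
  have := hV.fintype
  have := hE.fintype
  have := finite_face (rot := rot) hV hE
  have h1 := card_face_le hG hrot
  rw [← Nat.card_eq_fintype_card, ← Nat.card_eq_fintype_card, Nat.card_coe_set_eq,
    Nat.card_coe_set_eq] at h1
  omega

theorem incMatrix_mulVec_single [Fintype G.edgeSet] [DecidableEq G.edgeSet]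
    [DecidableEq G.vertexSet] [G.Loopless] {e : β} {x y : α} (h : G.IsLink e x y) :
    (incMatrix G).mulVec (Pi.single ⟨e, h.edge_mem⟩ 1)
      = Pi.single ⟨x, h.left_mem⟩ 1 + Pi.single ⟨y, h.right_mem⟩ 1 := by
  ext ⟨v, hv⟩
  rw [Matrix.mulVec_single_one]
  simp only [Matrix.col_apply, incMatrix, Pi.add_apply, Pi.single_apply, Subtype.mk.injEq]
  have hne := h.ne
  by_cases hvx : v = x
  · subst hvx; simp [h.inc_left, hne]
  by_cases hvy : v = y
  · subst hvy; simp [h.inc_right, hvx]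
  have : ¬ G.Inc e v := fun hi => (hi.eq_or_eq_of_isLink h).elim hvx hvy
  simp [hvx, hvy, this]

open Classical in
/-- In an embedding in the sphere every closed walk `p 0, …, p k = p 0` is (over the field with
two elements) the boundary of a set of faces. -/
theorem Embedding.exists_coloring [G.Loopless] (hV : G.vertexSet.Finite) (hE : G.edgeSet.Finite)
    (hG : Connected G) (φ : Embedding G) (p : ℕ → α) (q : ℕ → β) (k : ℕ)
    (hpq : ∀ i < k, G.IsLink (q i) (p i) (p (i + 1))) (hk : p k = p 0) :
    ∃ χ : α → β → ZMod 2, ∀ e x y, G.IsLink e x y →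
      χ x e + χ y e = ∑ i ∈ Finset.range k, (if q i = e then 1 else 0) ∧
        χ y (φ.rot y e) = χ x e := by
  have := hV.fintype
  have := hE.fintype
  have := finite_face (rot := φ.rot) hV hE
  have h1 := finrank_range_faceDelta hG φ.isCycleOn
  have h2 := range_faceDelta_le φ.isCycleOn
  have h3 := finrank_ker_incMatrix hG
  have h4 := φ.euler
  rw [← Nat.card_eq_fintype_card, ← Nat.card_eq_fintype_card, Nat.card_coe_set_eq,
    Nat.card_coe_set_eq] at h3
  -- Genus zero is exactly what makes the dimensions agree, so that every element of the cycle space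
  -- is a boundary.
  have h5 := Submodule.eq_of_le_of_finrank_le h2 (by omega)
  -- The sum of the first `j` edges of the walk has boundary `p 0 + p j`, which vanishes once the
  -- walk closes up.
  have hwalk : ∀ j ≤ k, ∃ f : G.edgeSet → ZMod 2,
      (∀ e, f e = ∑ i ∈ Finset.range j, (if q i = e then 1 else 0)) ∧
      ∀ v : G.vertexSet, (incMatrix G).mulVec f v
        = (if (v : α) = p 0 then 1 else 0) + (if (v : α) = p j then 1 else 0) := by
    intro j
    induction j with
    | zero =>
      intro _
      refine ⟨0, by simp, fun v => ?_⟩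
      rw [Matrix.mulVec_zero, CharTwo.add_self_eq_zero, Pi.zero_apply]
    | succ j ih =>
      intro hj
      obtain ⟨f, hf, hf'⟩ := ih (by omega)
      have h := hpq j (by omega)
      refine ⟨f + Pi.single ⟨q j, h.edge_mem⟩ 1, fun e => ?_, fun v => ?_⟩
      · rw [Pi.add_apply, hf, Finset.sum_range_succ, Pi.single_apply]
        congr 1
        simp [Subtype.ext_iff, eq_comm]
      · rw [Matrix.mulVec_add, Pi.add_apply, hf', incMatrix_mulVec_single h, Pi.add_apply,
          Pi.single_apply, Pi.single_apply]
        simp only [Subtype.ext_iff]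
        generalize (if (v : α) = p j then (1 : ZMod 2) else 0) = z
        rw [add_assoc, ← add_assoc z, CharTwo.add_self_eq_zero, zero_add]
  obtain ⟨f, hf, hf'⟩ := hwalk k le_rfl
  have hmem : f ∈ LinearMap.ker (incMatrix G).mulVecLin := by
    rw [LinearMap.mem_ker]
    ext v
    rw [Matrix.mulVecLin_apply, hf', hk, CharTwo.add_self_eq_zero, Pi.zero_apply]
  rw [← h5] at hmem
  obtain ⟨χ, hχ⟩ := hmem
  refine ⟨fun v e => if h : G.Inc e v then χ (faceOf φ.rot h) else 0, fun e x y h => ?_⟩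
  have hl := h.inc_left
  have hr := h.inc_right
  have hrr := inc_rot φ.isCycleOn hr
  simp only [hl, hr, hrr, dite_true]
  refine ⟨?_, by rw [show faceOf φ.rot hrr = _ from faceOf_rot φ.isCycleOn h]⟩
  rw [← faceDelta_apply χ h, hχ, hf]

end Planarity

end Village

namespace Village

/-! ### Cyclic orders, their betweenness relation and induced orders -/

section CyclicOrder

variable {β γ : Type*} {r : Equiv.Perm β} {a b c e : β} {S : Set β}

/-- In the cyclic order given by the permutation `r`, the element `b` comes strictly after `a` and
strictly before `c`. -/
def Between (r : Equiv.Perm β) (a b c : β) : Prop :=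
  ∃ j k, 0 < j ∧ j < k ∧ (r ^ j) a = b ∧ (r ^ k) a = c ∧ ∀ i, 0 < i → i ≤ k → (r ^ i) a ≠ a

theorem pow_apply_inj_of_ne {k i j : ℕ} (h : ∀ i, 0 < i → i ≤ k → (r ^ i) a ≠ a)
    (hi : i ≤ k) (hj : j ≤ k) (hij : (r ^ i) a = (r ^ j) a) : i = j := by
  wlog hle : i ≤ j generalizing i j
  · exact (this hj hi hij.symm (by omega)).symm
  by_contra hne
  apply h (j - i) (by omega) (by omega)
  apply (r ^ i).injective
  rw [← Equiv.Perm.mul_apply, ← pow_add, hij]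
  congr 2
  omega

/-- The exclusion of an earlier return to `a` in `Between` limits the iteration to one turn, in
which the positions of `b` and `c` are unique. -/
theorem Between.asymm (h : Between r a b c) : ¬ Between r a c b := by
  rintro ⟨j', k', hj', hjk', hb', hc', h'⟩
  obtain ⟨j, k, hj, hjk, hb, hc, h⟩ := h
  rcases le_total k k' with hk | hk
  · have h1 := pow_apply_inj_of_ne h' (by omega) le_rfl (hb.trans hc'.symm)
    omega
  · have h1 := pow_apply_inj_of_ne h (by omega) le_rfl (hb'.trans hc.symm)
    have h2 := pow_apply_inj_of_ne h (by omega) hk (hb.trans hc'.symm)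
    omega

theorem Between.ne (h : Between r a b c) : a ≠ b ∧ a ≠ c ∧ b ≠ c := by
  obtain ⟨j, k, hj, hjk, rfl, rfl, h⟩ := h
  refine ⟨(h j hj hjk.le).symm, (h k (by omega) le_rfl).symm, fun hbc => ?_⟩
  have := pow_apply_inj_of_ne h hjk.le le_rfl hbc
  omega

theorem exists_first_return (hr : r.IsCycleOn S) (hS : S.Finite) (ha : a ∈ S) :
    ∃ N, 0 < N ∧ (r ^ N) a = a ∧ (∀ i, 0 < i → i < N → (r ^ i) a ≠ a) ∧
      ∀ b ∈ S, ∃ i < N, (r ^ i) a = b := by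
  classical
  lift S to Finset β using hS
  have hcard : 0 < S.card := Finset.card_pos.2 ⟨a, ha⟩
  refine ⟨S.card, hcard, hr.pow_card_apply ha, fun i hi hiN h => ?_, fun b hb => ?_⟩
  · have := (hr.pow_apply_eq ha).1 h
    exact absurd (Nat.le_of_dvd hi this) (by omega)
  · obtain ⟨i, hi, h⟩ := hr.exists_pow_eq ha hb
    exact ⟨i, hi, h⟩

theorem between_or_between (hr : r.IsCycleOn S) (hS : S.Finite) (ha : a ∈ S) (hb : b ∈ S)
    (hc : c ∈ S) (hab : a ≠ b) (hac : a ≠ c) (hbc : b ≠ c) : Between r a b c ∨ Between r a c b := by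
  obtain ⟨N, hN, hN1, hN2, hN3⟩ := exists_first_return hr hS ha
  obtain ⟨i, hi, rfl⟩ := hN3 b hb
  obtain ⟨j, hj, rfl⟩ := hN3 c hc
  have hi0 : i ≠ 0 := by rintro rfl; exact hab rfl
  have hj0 : j ≠ 0 := by rintro rfl; exact hac rfl
  rcases lt_trichotomy i j with h | rfl | h
  · exact .inl ⟨i, j, by omega, h, rfl, rfl, fun l h1 h2 => hN2 l h1 (by omega)⟩
  · exact absurd rfl hbc
  · exact .inr ⟨j, i, by omega, h, rfl, rfl, fun l h1 h2 => hN2 l h1 (by omega)⟩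

theorem not_between_iff (hr : r.IsCycleOn S) (hS : S.Finite) (ha : a ∈ S) (hb : b ∈ S)
    (hc : c ∈ S) (hab : a ≠ b) (hac : a ≠ c) (hbc : b ≠ c) :
    ¬ Between r a b c ↔ Between r a c b :=
  ⟨fun h => (between_or_between hr hS ha hb hc hab hac hbc).resolve_left h, fun h h' => h'.asymm h⟩

theorem Between.rotate (hr : r.IsCycleOn S) (hS : S.Finite) (ha : a ∈ S) (h : Between r a b c) :
    Between r b c a := by
  obtain ⟨N, hN, hN1, hN2, hN3⟩ := exists_first_return hr hS ha
  obtain ⟨j, k, hj, hjk, rfl, rfl, h⟩ := h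
  have hkN : k < N := by
    by_contra hk
    exact h N hN (by omega) hN1
  refine ⟨k - j, N - j, by omega, by omega, ?_, ?_, fun i hi hiN hc => ?_⟩
  · rw [← Equiv.Perm.mul_apply, ← pow_add]; congr 2; omega
  · rw [← Equiv.Perm.mul_apply, ← pow_add]
    conv_rhs => rw [← hN1]
    congr 2; omega
  · refine hN2 i hi (by omega) ((r ^ j).injective ?_)
    rw [← hc, ← Equiv.Perm.mul_apply, ← Equiv.Perm.mul_apply, ← pow_add, ← pow_add, add_comm]

theorem between_rotate_iff (hr : r.IsCycleOn S) (hS : S.Finite) (ha : a ∈ S) (hb : b ∈ S)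
    (hc : c ∈ S) : Between r a b c ↔ Between r b c a :=
  ⟨.rotate hr hS ha, fun h => (h.rotate hr hS hb).rotate hr hS hc⟩

/-- A colouring of the elements of a cycle that changes exactly after `a` and after `c`. -/
theorem between_iff_color (hr : r.IsCycleOn S) (hS : S.Finite) (ha : a ∈ S)
    (hc : c ∈ S) (he : e ∈ S) (hac : a ≠ c) (hea : e ≠ a) (hec : e ≠ c) (χ f : β → ZMod 2)
    (hχ : ∀ x ∈ S, χ (r x) = χ x + f x) (hfa : f a = 1) (hfc : f c = 1)
    (hf : ∀ x ∈ S, x ≠ a → x ≠ c → f x = 0) : Between r a e c ↔ χ e = χ c := by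
  have hmem : ∀ i : ℕ, (r ^ i) a ∈ S := fun i => (hr.1.perm_pow i).mapsTo ha
  have hsucc : ∀ i : ℕ, χ ((r ^ (i + 1)) a) = χ ((r ^ i) a) + f ((r ^ i) a) := by
    intro i
    rw [pow_succ', Equiv.Perm.mul_apply, hχ _ (hmem i)]
  have h1 : ∀ k : ℕ, (∀ i, 0 < i → i < k → (r ^ i) a ≠ a ∧ (r ^ i) a ≠ c) →
      ∀ i, 0 < i → i ≤ k → χ ((r ^ i) a) = χ a + 1 := by
    intro k hk i
    induction i with
    | zero => intro h; omega
    | succ i ih =>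
      intro _ hik
      rcases Nat.eq_zero_or_pos i with rfl | hi
      · rw [hsucc, pow_zero, Equiv.Perm.one_apply, hfa]
      · rw [hsucc, hf _ (hmem i) (hk i hi (by omega)).1 (hk i hi (by omega)).2, add_zero,
          ih hi (by omega)]
  constructor
  · rintro ⟨j, k, hj, hjk, rfl, rfl, h⟩
    have h2 := h1 k fun i hi hik => ⟨h i hi hik.le, fun hik' => by
      have := pow_apply_inj_of_ne h hik.le le_rfl hik'
      omega⟩
    rw [h2 j hj hjk.le, h2 k (by omega) le_rfl]
  -- In the other cyclic order `c` is met before `e`; the colour then changes back after `c`, and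
  -- `e` has the colour of `a` rather than that of `c`.
  · contrapose
    rw [not_between_iff hr hS ha he hc hea.symm hac hec]
    rintro ⟨j, k, hj, hjk, hjc, rfl, h⟩
    have hne : ∀ i, 0 < i → i < j → (r ^ i) a ≠ a ∧ (r ^ i) a ≠ c := fun i hi hij =>
      ⟨h i hi (by omega), fun hic => by
        have := pow_apply_inj_of_ne h (by omega) (by omega) (hic.trans hjc.symm)
        omega⟩
    have h2 : χ c = χ a + 1 := by rw [← hjc]; exact h1 j hne j hj le_rfl
    have h3 : ∀ i, j < i → i ≤ k → χ ((r ^ i) a) = χ a := by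
      intro i
      induction i with
      | zero => intro h; omega
      | succ i ih =>
        intro hji hik
        rcases Nat.lt_or_ge j i with hlt | hge
        · rw [hsucc, hf _ (hmem i) (h i (by omega) (by omega)), add_zero, ih hlt (by omega)]
          intro hic
          have := pow_apply_inj_of_ne h (by omega) (by omega) (hic.trans hjc.symm)
          omega
        · obtain rfl : i = j := by omega
          rw [hsucc, hjc, hfc, h2, add_assoc, CharTwo.add_self_eq_zero, add_zero]
    rw [h3 k hjk le_rfl, h2]
    simp

/-- Strong induction on the exponent: a jump of `r` to the first return to `S'` is one step of `r'`.
The last clause traces every intermediate iterate of `r'` to an iterate of `r` within the same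
range, which is needed to exclude early returns. -/
theorem exists_pow_induced {S' : Set β} {r' : Equiv.Perm γ} {g : β → γ}
    (h : ∀ x ∈ S', ∀ y ∈ S', (∃ k : ℕ, 0 < k ∧ (r ^ k) x = y ∧
      ∀ j, 0 < j → j < k → (r ^ j) x ∉ S') → r' (g x) = g y) (m : ℕ) :
    ∀ x ∈ S', 0 < m → (r ^ m) x ∈ S' → ∃ t, 0 < t ∧ (r' ^ t) (g x) = g ((r ^ m) x) ∧
      ∀ u, 0 < u → u ≤ t → ∃ l, 0 < l ∧ l ≤ m ∧ (r ^ l) x ∈ S' ∧ (r' ^ u) (g x) = g ((r ^ l) x) := by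
  classical
  induction m using Nat.strong_induction_on with
  | _ m ih =>
    intro x hx hm hxm
    have hex : ∃ l, 0 < l ∧ (r ^ l) x ∈ S' := ⟨m, hm, hxm⟩
    obtain ⟨hl0, hlS⟩ := Nat.find_spec hex
    have hlm : Nat.find hex ≤ m := Nat.find_le ⟨hm, hxm⟩
    have hlmin : ∀ j, 0 < j → j < Nat.find hex → (r ^ j) x ∉ S' := fun j hj hjl hjS =>
      Nat.find_min hex hjl ⟨hj, hjS⟩
    generalize Nat.find hex = l at hl0 hlS hlm hlmin
    have hstep := h x hx _ hlS ⟨l, hl0, rfl, hlmin⟩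
    rcases hlm.eq_or_lt with rfl | hlt
    · refine ⟨1, one_pos, by simpa using hstep, fun u hu hu1 => ?_⟩
      obtain rfl : u = 1 := by omega
      exact ⟨l, hl0, le_rfl, hlS, by simpa using hstep⟩
    · have hadd : ∀ i : ℕ, (r ^ i) ((r ^ l) x) = (r ^ (i + l)) x := fun i => by
        rw [pow_add, Equiv.Perm.mul_apply]
      have hml : m - l + l = m := by omega
      obtain ⟨t, ht, ht1, ht2⟩ := ih (m - l) (by omega) _ hlS (by omega) (by rwa [hadd, hml])
      have hadd' : ∀ u : ℕ, (r' ^ (u + 1)) (g x) = (r' ^ u) (g ((r ^ l) x)) := fun u => by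
        rw [pow_succ, Equiv.Perm.mul_apply, hstep]
      refine ⟨t + 1, by omega, by rw [hadd', ht1, hadd, hml], fun u hu hut => ?_⟩
      obtain ⟨u, rfl⟩ : ∃ u', u = u' + 1 := ⟨u - 1, by omega⟩
      rcases Nat.eq_zero_or_pos u with rfl | hu0
      · exact ⟨l, hl0, hlm, hlS, by simpa using hstep⟩
      · obtain ⟨l', h1, h2, h3, h4⟩ := ht2 u hu0 (by omega)
        exact ⟨l' + l, by omega, by omega, by rwa [← hadd], by rw [hadd', h4, hadd]⟩

/-- A premature return of `r'` to `g a` would, as `g` is injective on `S'`, come from a premature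
return of `r` to `a`. -/
theorem Between.induced {S' : Set β} {r' : Equiv.Perm γ} {g : β → γ} (hg : Set.InjOn g S')
    (h : ∀ x ∈ S', ∀ y ∈ S', (∃ k : ℕ, 0 < k ∧ (r ^ k) x = y ∧
      ∀ j, 0 < j → j < k → (r ^ j) x ∉ S') → r' (g x) = g y)
    (ha : a ∈ S') (hb : b ∈ S') (hc : c ∈ S') (habc : Between r a b c) :
    Between r' (g a) (g b) (g c) := by
  obtain ⟨j, k, hj, hjk, rfl, rfl, hne⟩ := habc
  have hk : k = k - j + j := by omega
  have hadd : ∀ i : ℕ, (r ^ i) ((r ^ j) a) = (r ^ (i + j)) a := fun i => by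
    rw [pow_add, Equiv.Perm.mul_apply]
  obtain ⟨t, ht, ht1, ht2⟩ := exists_pow_induced h j a ha hj hb
  obtain ⟨t', ht', ht1', ht2'⟩ := exists_pow_induced h (k - j) _ hb (by omega)
    (by rwa [hadd, ← hk])
  have hadd' : ∀ i : ℕ, (r' ^ (i + t)) (g a) = (r' ^ i) (g ((r ^ j) a)) := fun i => by
    rw [pow_add, Equiv.Perm.mul_apply, ht1]
  refine ⟨t, t' + t, ht, by omega, ht1, by rw [hadd', ht1', hadd, ← hk], fun u hu hut hua => ?_⟩
  rcases le_or_gt u t with hle | hgt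
  · obtain ⟨l, h1, h2, h3, h4⟩ := ht2 u hu hle
    exact hne l h1 (by omega) (hg h3 ha (h4.symm.trans hua))
  · obtain ⟨l, h1, h2, h3, h4⟩ := ht2' (u - t) (by omega) (by omega)
    rw [hadd] at h3 h4
    rw [← hadd', show u - t + t = u by omega] at h4
    exact hne (l + j) (by omega) (by omega) (hg h3 ha (h4.symm.trans hua))

end CyclicOrder

/-! ### The two sides of a cycle in a spherical embedding -/

section Cycle

variable {α β : Type*} {G : Graph α β} {p : ℕ → α} {q : ℕ → β} {k : ℕ}

/-- The (periodic) sequences `p` of vertices and `q` of edges form a cycle of length `k`. -/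
structure IsCycleWalk (G : Graph α β) (p : ℕ → α) (q : ℕ → β) (k : ℕ) : Prop where
  two_le : 2 ≤ k
  link : ∀ i, G.IsLink (q i) (p i) (p (i + 1))
  vertex_iff : ∀ i j, p i = p j ↔ i % k = j % k
  edge_iff : ∀ i j, q i = q j ↔ i % k = j % k

theorem IsCycleWalk.eq_or_eq (hC : IsCycleWalk G p q k) {i j : ℕ}
    (h : G.Inc (q j) (p (i + 1))) : q j = q i ∨ q j = q (i + 1) := by
  rcases h.eq_or_eq_of_isLink (hC.link j) with h | h
  · right
    rw [hC.vertex_iff] at h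
    rw [hC.edge_iff, h]
  · left
    rw [hC.vertex_iff] at h
    rw [hC.edge_iff]
    exact (Nat.ModEq.add_right_cancel' 1 h).symm

theorem IsCycleWalk.ne (hC : IsCycleWalk G p q k) (i : ℕ) : q i ≠ q (i + 1) := by
  intro h
  rw [hC.edge_iff] at h
  have h2 : (0 : ℕ) ≡ 1 [MOD k] := Nat.ModEq.add_left_cancel' i h
  have := hC.two_le
  rw [Nat.ModEq, Nat.mod_eq_of_lt (by omega), Nat.mod_eq_of_lt (by omega)] at h2
  omega

/-- The two sides of a cycle in an embedding in the sphere, as a colouring of the darts. -/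
theorem IsCycleWalk.exists_sides [G.Loopless] (hV : G.vertexSet.Finite) (hE : G.edgeSet.Finite)
    (hG : Connected G) (φ : Embedding G) (hC : IsCycleWalk G p q k) :
    ∃ (χ : α → β → ZMod 2) (s : ZMod 2),
      (∀ i e, G.Inc e (p (i + 1)) → (∀ j, q j ≠ e) →
        (Between (φ.rot (p (i + 1))) (q i) e (q (i + 1)) ↔ χ (p (i + 1)) e = s)) ∧
      (∀ e x y, G.IsLink e x y → (∀ j, q j ≠ e) → χ x e = χ y e) ∧
      (∀ e x y, G.IsLink e x y → χ y (φ.rot y e) = χ x e) ∧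
      ∀ v e e', G.Inc e v → G.Inc e' v → (∀ i, p i ≠ v) → χ v e = χ v e' := by
  classical
  have hk := hC.two_le
  obtain ⟨χ, hχ⟩ := φ.exists_coloring hV hE hG p q k (fun i _ => hC.link i)
    ((hC.vertex_iff _ _).2 (by simp))
  -- `f` is the indicator of the cycle, and the colour of the faces met in turning around a vertex
  -- jumps exactly after an edge of the cycle.
  set f : β → ZMod 2 := fun e => ∑ i ∈ Finset.range k, (if q i = e then 1 else 0) with hf
  have hf1 : ∀ i, f (q i) = 1 := by
    intro i
    have : ∀ j ∈ Finset.range k, (if q j = q i then (1 : ZMod 2) else 0)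
        = if j = i % k then 1 else 0 := by
      intro j hj
      rw [Finset.mem_range] at hj
      simp only [hC.edge_iff, Nat.mod_eq_of_lt hj]
    rw [hf]
    simp only
    rw [Finset.sum_congr rfl this, Finset.sum_ite_eq']
    simp [Nat.mod_lt i (by omega : k > 0)]
  have hf0 : ∀ e, (∀ j, q j ≠ e) → f e = 0 := by
    intro e he
    rw [hf]
    exact Finset.sum_eq_zero fun j _ => by simp [he j]
  have hrot : ∀ e v, G.Inc e v → χ v (φ.rot v e) = χ v e + f e := by
    rintro e v ⟨u, hu⟩
    rw [(hχ e u v hu.symm).2, show f e = χ u e + χ v e from (hχ e u v hu.symm).1.symm,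
      add_comm (χ u e), ← add_assoc, CharTwo.add_self_eq_zero, zero_add]
  -- Turning at `p (i + 1)` from `q i` to `q (i + 1)` meets no other edge of the cycle, so one
  -- colour is carried along one side of the whole cycle.
  have hout : ∀ i, χ (p (i + 1)) (q (i + 1)) = χ (p i) (q i) := by
    intro i
    have h1 := (hχ _ _ _ (hC.link i)).1
    have h2 := hrot _ _ (hC.link i).inc_right
    have h3 := (hχ _ _ _ (hC.link i)).2
    have hS : (G.incidenceSet (p (i + 1))).Finite :=
      hE.subset (G.incidenceSet_subset_edgeSet _)
    have hcyc := φ.isCycleOn _ (hC.link i).right_mem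
    have ha : q i ∈ G.incidenceSet (p (i + 1)) := (hC.link i).inc_right
    have hb : q (i + 1) ∈ G.incidenceSet (p (i + 1)) := (hC.link (i + 1)).inc_left
    obtain ⟨N, hN, hN1, hN2, hN3⟩ := exists_first_return hcyc hS ha
    obtain ⟨t, ht, htq⟩ := hN3 _ hb
    have hmem : ∀ i', (φ.rot (p (i + 1)) ^ i') (q i) ∈ G.incidenceSet (p (i + 1)) :=
      fun i' => (hcyc.1.perm_pow i').mapsTo ha
    have key : ∀ u, 0 < u → u ≤ t → χ (p (i + 1)) ((φ.rot (p (i + 1)) ^ u) (q i)) = χ (p i) (q i) := by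
      intro u
      induction u with
      | zero => intro h; omega
      | succ u ih =>
        intro _ hut
        rw [pow_succ', Equiv.Perm.mul_apply]
        rcases Nat.eq_zero_or_pos u with rfl | hu
        · exact h3
        · rw [hrot _ _ (hmem u), hf0, add_zero, ih hu (by omega)]
          intro j hj
          have hinc : G.Inc (q j) (p (i + 1)) := hj ▸ hmem u
          rcases hC.eq_or_eq hinc with h | h
          · exact hN2 u hu (by omega) (by rw [← hj, h])
          · have := pow_apply_inj_of_ne (k := t) (fun i hi hit => hN2 i hi (by omega))
              (by omega) le_rfl (hj.symm.trans (h.trans htq.symm))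
            omega
    rw [← htq]
    refine key t ?_ le_rfl
    rcases Nat.eq_zero_or_pos t with rfl | h
    · exact absurd htq (hC.ne i)
    · exact h
  have hout' : ∀ i, χ (p i) (q i) = χ (p 0) (q 0) := by
    intro i
    induction i with
    | zero => rfl
    | succ i ih => rw [hout, ih]
  refine ⟨χ, χ (p 0) (q 0), fun i e he hne => ?_, fun e x y h hne => ?_,
    fun e x y h => (hχ e x y h).2, fun v e e' he he' hv => ?_⟩
  · rw [← hout' (i + 1)]
    have hS : (G.incidenceSet (p (i + 1))).Finite :=
      hE.subset (G.incidenceSet_subset_edgeSet _)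
    refine between_iff_color (φ.isCycleOn _ he.vertex_mem) hS (hC.link i).inc_right
      (hC.link (i + 1)).inc_left he (hC.ne i) (hne i).symm (hne (i + 1)).symm (χ (p (i + 1))) f
      (fun x hx => hrot x _ hx) (hf1 _) (hf1 _) fun x hx h1 h2 => hf0 x fun j hj => ?_
    subst hj
    rcases hC.eq_or_eq hx with h | h
    · exact h1 h
    · exact h2 h
  · have := (hχ e x y h).1
    rw [show (∑ i ∈ Finset.range k, (if q i = e then (1 : ZMod 2) else 0)) = 0 from hf0 e hne] at this
    exact CharTwo.add_eq_zero.1 this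
  · have hS : (G.incidenceSet v).Finite := hE.subset (G.incidenceSet_subset_edgeSet _)
    have hcyc := φ.isCycleOn _ he.vertex_mem
    obtain ⟨N, -, -, -, hN⟩ := exists_first_return hcyc hS he
    obtain ⟨t, -, rfl⟩ := hN e' he'
    have hmem : ∀ i', (φ.rot v ^ i') e ∈ G.incidenceSet v :=
      fun i' => (hcyc.1.perm_pow i').mapsTo he
    clear he'
    induction t with
    | zero => rfl
    | succ t ih =>
      rw [pow_succ', Equiv.Perm.mul_apply, hrot _ _ (hmem t), hf0, add_zero, ih]
      intro j hj
      have hinc : G.Inc (q j) v := hj ▸ hmem t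
      rcases hinc.eq_or_eq_of_isLink (hC.link j) with h | h
      · exact hv _ h.symm
      · exact hv _ h.symm

/-- A walk from `x`, given by its successive edges and vertices, whose inner vertices avoid `P`. -/
def AvoidingWalk (G : Graph α β) (P : Set α) : α → List (β × α) → Prop
  | _, [] => True
  | x, (e, y) :: l => G.IsLink e x y ∧ (l = [] ∨ y ∉ P) ∧ AvoidingWalk G P y l

/-- The cyclic order of the edges at a vertex of a cycle determines the cyclic order at every other
vertex of it that is joined to it by a path avoiding the cycle. -/
theorem IsCycleWalk.between_iff [G.Loopless] (hV : G.vertexSet.Finite) (hE : G.edgeSet.Finite)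
    (hG : Connected G) (φ : Embedding G) (hC : IsCycleWalk G p q k) {i j : ℕ} {e e' : β}
    {l : List (β × α)} {y : α} (hl : AvoidingWalk G (Set.range p) (p (i + 1)) ((e, y) :: l))
    (hq : ∀ f ∈ (e, y) :: l, ∀ t, q t ≠ f.1)
    (he' : ((e, y) :: l).getLast (by simp) = (e', p (j + 1))) :
    Between (φ.rot (p (i + 1))) (q i) e (q (i + 1)) ↔
      Between (φ.rot (p (j + 1))) (q j) e' (q (j + 1)) := by
  obtain ⟨χ, s, h1, h2, -, h4⟩ := hC.exists_sides hV hE hG φ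
  -- The colour is constant along the walk: it does not change across an edge off the cycle, nor
  -- around a vertex off the cycle.
  have key : ∀ (l : List (β × α)) (x : α) (e : β) (y : α),
      AvoidingWalk G (Set.range p) x ((e, y) :: l) → (∀ f ∈ (e, y) :: l, ∀ t, q t ≠ f.1) →
      ((e, y) :: l).getLast (by simp) = (e', p (j + 1)) →
      χ x e = χ (p (j + 1)) e' ∧ G.Inc e' (p (j + 1)) := by
    intro l
    induction l with
    | nil =>
      rintro x e y ⟨h, -⟩ hq hl
      simp only [List.getLast_singleton, Prod.mk.injEq] at hl
      obtain ⟨rfl, rfl⟩ := hl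
      exact ⟨h2 _ _ _ h (hq (e, p (j + 1)) (by simp)), h.inc_right⟩
    | cons d l ih =>
      obtain ⟨f, z⟩ := d
      rintro x e y ⟨h, hy, hw⟩ hq hl
      have ih := ih y f z hw (fun g hg => hq g (List.mem_cons_of_mem _ hg))
        (by rwa [List.getLast_cons (by simp)] at hl)
      refine ⟨?_, ih.2⟩
      rw [h2 _ _ _ h (hq (e, y) (by simp)), ← ih.1]
      simp only [reduceCtorEq, false_or, Set.mem_range, not_exists] at hy
      exact h4 _ _ _ h.inc_right hw.1.inc_left hy
  obtain ⟨h5, h6⟩ := key l _ e y hl hq he'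
  rw [h1 i e hl.1.inc_left (hq (e, y) (by simp)), h5, h1 j e' h6]
  have : (e', p (j + 1)) ∈ (e, y) :: l := he' ▸ List.getLast_mem _
  exact hq _ this

/-- If two edges leave a cycle on the same side then their other ends are on the same side. -/
theorem IsCycleWalk.sameSide_of_between (hE : G.edgeSet.Finite) (φ : Embedding G)
    (hC : IsCycleWalk G p q k) {i j : ℕ} {e e' : β} {x y : α}
    (hx : G.IsLink e (p (i + 1)) x) (hy : G.IsLink e' (p (j + 1)) y)
    (he : Between (φ.rot (p (i + 1))) (q i) e (q (i + 1)))
    (he' : Between (φ.rot (p (j + 1))) (q j) e' (q (j + 1))) (hij : i ≤ j) :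
    SameSide φ (Set.range q) x y := by
  -- As long as the rotation starting at `q i` does not meet the cycle, each edge met may be crossed
  -- from the face on its one side to the face on its other side, within one region.
  have hstep : ∀ i t e, (φ.rot (p (i + 1)) ^ t) (q i) = e → 0 < t →
      (∀ u, 0 < u → u < t → (φ.rot (p (i + 1)) ^ u) (q i) ≠ q i ∧
        (φ.rot (p (i + 1)) ^ u) (q i) ≠ q (i + 1)) →
      ∀ h : G.Inc e (p (i + 1)), SameRegion φ (Set.range q) ⟨(p i, q i), (hC.link i).inc_left⟩
        ⟨(p (i + 1), e), h⟩ := by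
    intro i t
    induction t with
    | zero => intro _ _ h; omega
    | succ t ih =>
      rintro e rfl - hu h
      rcases Nat.eq_zero_or_pos t with rfl | ht
      · exact .rel _ _ (.inl ⟨hC.link i, by simp⟩)
      · have hcyc := φ.isCycleOn _ (hC.link i).right_mem
        have hm : G.Inc ((φ.rot (p (i + 1)) ^ t) (q i)) (p (i + 1)) :=
          (hcyc.1.perm_pow t).mapsTo (hC.link i).inc_right
        refine (ih _ rfl ht (fun u h1 h2 => hu u h1 (by omega)) hm).trans _ _ _ ?_
        obtain ⟨z, hz⟩ := id hm
        have hpow : (φ.rot (p (i + 1)) ^ (t + 1)) (q i)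
            = φ.rot (p (i + 1)) ((φ.rot (p (i + 1)) ^ t) (q i)) := by
          rw [pow_succ', Equiv.Perm.mul_apply]
        refine .trans _ ⟨(z, (φ.rot (p (i + 1)) ^ t) (q i)), hz.inc_right⟩ _
          (.rel _ _ (.inr ⟨?_, rfl, hz⟩)) (.rel _ _ (.inl ⟨hz.symm, hpow⟩))
        rintro ⟨j, hj⟩
        have hj : q j = (φ.rot (p (i + 1)) ^ t) (q i) := hj
        rcases hC.eq_or_eq (hj ▸ hm) with h | h
        · exact (hu t ht (by omega)).1 (hj.symm.trans h)
        · exact (hu t ht (by omega)).2 (hj.symm.trans h)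
  have hout : ∀ i, SameRegion φ (Set.range q) ⟨(p i, q i), (hC.link i).inc_left⟩
      ⟨(p (i + 1), q (i + 1)), (hC.link (i + 1)).inc_left⟩ := by
    intro i
    have hcyc := φ.isCycleOn _ (hC.link i).right_mem
    obtain ⟨N, hN, hN1, hN2, hN3⟩ := exists_first_return hcyc
      (hE.subset (G.incidenceSet_subset_edgeSet _)) (hC.link i).inc_right
    obtain ⟨t, ht, htq⟩ := hN3 _ (hC.link (i + 1)).inc_left
    refine hstep i t _ htq ?_ (fun u h1 h2 => ⟨hN2 u h1 (by omega), fun h3 => ?_⟩) _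
    · rcases Nat.eq_zero_or_pos t with rfl | h
      · exact absurd htq (hC.ne i)
      · exact h
    · have := pow_apply_inj_of_ne (k := t) (fun i hi hit => hN2 i hi (by omega))
        (by omega) le_rfl (h3.trans htq.symm)
      omega
  have hbet : ∀ i e (h : G.Inc e (p (i + 1))),
      Between (φ.rot (p (i + 1))) (q i) e (q (i + 1)) →
      SameRegion φ (Set.range q) ⟨(p i, q i), (hC.link i).inc_left⟩ ⟨(p (i + 1), e), h⟩ ∧
        e ∉ Set.range q := by
    rintro i e h ⟨u, v, hu, huv, rfl, h2, h3⟩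
    refine ⟨hstep i u _ rfl hu (fun w h4 h5 => ⟨h3 w h4 (by omega), fun h6 => ?_⟩) h, ?_⟩
    · have := pow_apply_inj_of_ne h3 (by omega) le_rfl (h6.trans h2.symm)
      omega
    · rintro ⟨j, hj⟩
      rcases hC.eq_or_eq (hj ▸ h) with h' | h'
      · exact h3 u hu (by omega) (hj.symm.trans h')
      · have := pow_apply_inj_of_ne h3 (by omega) le_rfl ((hj.symm.trans h').trans h2.symm)
        omega
  have hchain : ∀ j, i ≤ j → SameRegion φ (Set.range q) ⟨(p i, q i), (hC.link i).inc_left⟩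
      ⟨(p j, q j), (hC.link j).inc_left⟩ := by
    intro j hj
    induction j, hj using Nat.le_induction with
    | base => exact .refl _
    | succ j _ ih => exact ih.trans _ _ _ (hout j)
  obtain ⟨h1, h2⟩ := hbet i e hx.inc_left he
  obtain ⟨h3, h4⟩ := hbet j e' hy.inc_left he'
  refine ⟨⟨(x, e), hx.inc_right⟩, ⟨(y, e'), hy.inc_right⟩, rfl, rfl, ?_⟩
  have h5 : SameRegion φ (Set.range q) ⟨(x, e), hx.inc_right⟩ ⟨(p (i + 1), e), hx.inc_left⟩ :=
    .rel _ _ (.inr ⟨h2, rfl, hx.symm⟩)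
  have h6 : SameRegion φ (Set.range q) ⟨(p (j + 1), e'), hy.inc_left⟩ ⟨(y, e'), hy.inc_right⟩ :=
    .rel _ _ (.inr ⟨h4, rfl, hy⟩)
  exact (h5.trans _ _ _ (h1.symm _ _)).trans _ _ _
    ((hchain j hij).trans _ _ _ (h3.trans _ _ _ h6))

/-- Two edges that leave a cycle for vertices on the same side leave it on the same side. -/
theorem IsCycleWalk.between_iff_of_sameSide [G.Loopless] (hV : G.vertexSet.Finite)
    (hE : G.edgeSet.Finite) (hG : Connected G) (φ : Embedding G) (hC : IsCycleWalk G p q k)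
    {i j : ℕ} {e e' : β} {x y : α}
    (hx : G.IsLink e (p (i + 1)) x) (hy : G.IsLink e' (p (j + 1)) y)
    (hxp : ∀ t, p t ≠ x) (hyp : ∀ t, p t ≠ y) (h : SameSide φ (Set.range q) x y) :
    Between (φ.rot (p (i + 1))) (q i) e (q (i + 1)) ↔
      Between (φ.rot (p (j + 1))) (q j) e' (q (j + 1)) := by
  obtain ⟨χ, s, h1, h2, h3, h4⟩ := hC.exists_sides hV hE hG φ
  have hoff : ∀ {e x y}, G.IsLink e x y → (∀ t, p t ≠ y) → ∀ t, q t ≠ e := by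
    rintro _ x y hl hy t rfl
    rcases hl.right_eq_or_eq (hC.link t) with h | h
    · exact hy _ h.symm
    · exact hy _ h.symm
  obtain ⟨⟨⟨x', f⟩, hf⟩, ⟨⟨y', f'⟩, hf'⟩, rfl, rfl, hr⟩ := h
  -- Neither of the two moves that generate a region crosses the cycle, so both preserve the colour.
  have key : ∀ d d' : Dart G, SameRegion φ (Set.range q) d d' → χ d.1.1 d.1.2 = χ d'.1.1 d'.1.2 := by
    intro d d' hd
    induction hd with
    | rel d d' hd =>
      rcases hd with ⟨hl, hr⟩ | ⟨hq, he, hl⟩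
      · rw [hr, h3 _ _ _ hl]
      · rw [he]
        exact h2 _ _ _ hl fun t ht => hq ⟨t, ht⟩
    | refl => rfl
    | symm _ _ _ ih => exact ih.symm
    | trans _ _ _ _ _ ih1 ih2 => exact ih1.trans ih2
  rw [h1 i e hx.inc_left (hoff hx hxp), h1 j e' hy.inc_left (hoff hy hyp),
    h2 _ _ _ hx (hoff hx hxp), h2 _ _ _ hy (hoff hy hyp), h4 _ _ _ hx.inc_right hf hxp,
    h4 _ _ _ hy.inc_right hf' hyp]
  have : χ x' f = χ y' f' := key _ _ hr
  rw [this]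

end Cycle

end Village

namespace Village

/-! ### Ears and 2-connectivity -/

section TwoConnected

variable {α β : Type*} {G H : Graph α β}

theorem Connected.extend (hH : Connected H) (hle : H ≤ G)
    (h : ∀ v ∈ G.vertexSet, ∃ u ∈ H.vertexSet, Relation.ReflTransGen G.Adj v u) : Connected G := by
  have hsymm : Std.Symm G.Adj := inferInstance
  refine ⟨hH.1.mono hle.vertexSet_mono, fun x hx y hy => ?_⟩
  obtain ⟨u, hu, hxu⟩ := h x hx
  obtain ⟨v, hv, hyv⟩ := h y hy
  have huv : Relation.ReflTransGen G.Adj u v :=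
    Relation.ReflTransGen.mono (fun a b (hab : H.Adj a b) => hab.mono hle) u v (hH.2 u hu v hv)
  exact (hxu.trans huv).trans (Std.Symm.symm (r := Relation.ReflTransGen G.Adj) _ _ hyv)

theorem reflTransGen_of_links {q : ℕ → β} {p : ℕ → α} {i j : ℕ} (hij : i ≤ j)
    (h : ∀ l, i ≤ l → l < j → G.IsLink (q l) (p l) (p (l + 1))) :
    Relation.ReflTransGen G.Adj (p i) (p j) := by
  induction j, hij using Nat.le_induction with
  | base => exact .refl
  | succ j hj ih => exact (ih fun l h1 h2 => h l h1 (by omega)).tail ⟨q j, h j hj (by omega)⟩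

/-- Adding an ear to a 2-connected graph. -/
theorem TwoConnected.ear (hH : TwoConnected H) (hle : H ≤ G) {p : ℕ → α} {q : ℕ → β} {k : ℕ}
    (hp : Set.InjOn p (Set.Iic k)) (h0 : p 0 ∈ H.vertexSet) (hk : p k ∈ H.vertexSet)
    (hl : ∀ i < k, G.IsLink (q i) (p i) (p (i + 1)))
    (hV : ∀ v ∈ G.vertexSet, v ∈ H.vertexSet ∨ ∃ i ≤ k, v = p i) : TwoConnected G := by
  refine ⟨hH.1.trans (Set.encard_le_encard hle.vertexSet_mono), hH.2.1.extend hle ?_, fun x hx => ?_⟩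
  · intro v hv
    rcases hV v hv with h | ⟨i, hi, rfl⟩
    · exact ⟨v, h, .refl⟩
    · exact ⟨p k, hk, reflTransGen_of_links hi fun l _ h => hl l h⟩
  -- After the deletion of `x`, a vertex of the ear still reaches `H` in the direction away from
  -- `x`: forwards if `x` precedes it on the ear, and backwards otherwise.
  · have key : ∀ i ≤ k, p i ≠ x → ∃ u ∈ H.vertexSet, u ≠ x ∧
        Relation.ReflTransGen (G.deleteVerts {x}).Adj (p i) u := by
      intro i hi hix
      by_cases hj : ∃ j < i, p j = x
      · obtain ⟨j, hj, rfl⟩ := hj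
        have hne : ∀ l, i ≤ l → l ≤ k → p l ≠ p j := fun l h1 h2 h3 => by
          have := hp (Set.mem_Iic.2 h2) (Set.mem_Iic.2 (by omega)) h3
          omega
        refine ⟨p k, hk, hne k hi le_rfl, reflTransGen_of_links (q := q) hi fun l h1 h2 => ?_⟩
        exact (Graph.deleteVerts_isLink _ _).2 ⟨hl l h2, hne l h1 h2.le, hne _ (by omega) h2⟩
      · push Not at hj
        have hne : ∀ l ≤ i, p l ≠ x := fun l h1 => by
          rcases h1.eq_or_lt with rfl | h
          · exact hix
          · exact hj l h
        refine ⟨p 0, h0, hne 0 (by omega), ?_⟩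
        have h := reflTransGen_of_links (G := G.deleteVerts {x}) (q := q) (p := p) (Nat.zero_le i)
          fun l _ h2 => (Graph.deleteVerts_isLink _ _).2
            ⟨hl l (by omega), hne l h2.le, hne _ h2⟩
        exact Std.Symm.symm (r := Relation.ReflTransGen (G.deleteVerts {x}).Adj) _ _ h
    by_cases hxH : x ∈ H.vertexSet
    · refine (hH.2.2 x hxH).extend (G := G.deleteVerts {x}) ⟨?_, ?_⟩ ?_
      · rw [Graph.vertexSet_deleteVerts, Graph.vertexSet_deleteVerts]
        exact Set.sdiff_subset_sdiff_left hle.vertexSet_mono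
      · intro e a b hab
        rw [Graph.deleteVerts_isLink] at hab ⊢
        exact ⟨hab.1.mono hle, hab.2⟩
      · intro v hv
        rw [Graph.vertexSet_deleteVerts] at hv ⊢
        rcases hV v hv.1 with h | ⟨i, hi, rfl⟩
        · exact ⟨v, ⟨h, hv.2⟩, .refl⟩
        · obtain ⟨u, hu, hux, h⟩ := key i hi hv.2
          exact ⟨u, ⟨hu, hux⟩, h⟩
    · refine hH.2.1.extend (G := G.deleteVerts {x}) ⟨?_, ?_⟩ ?_
      · rw [Graph.vertexSet_deleteVerts]
        exact fun v hv => ⟨hle.vertexSet_mono hv, fun h => hxH (h ▸ hv)⟩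
      · intro e a b hab
        rw [Graph.deleteVerts_isLink]
        exact ⟨hab.mono hle, fun h => hxH (h ▸ hab.left_mem), fun h => hxH (h ▸ hab.right_mem)⟩
      · intro v hv
        rw [Graph.vertexSet_deleteVerts] at hv
        rcases hV v hv.1 with h | ⟨i, hi, rfl⟩
        · exact ⟨v, h, .refl⟩
        · obtain ⟨u, hu, -, h⟩ := key i hi hv.2
          exact ⟨u, hu, h⟩

end TwoConnected

namespace Gadget

/-! ### The graphs of the sequence

All graphs are obtained from the planet by adding edges in the outer face. The centre of the planet
is `99`, its rim is `100, …, 99 + n`, and its edges are `100 + 2 * k` (on the rim) and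
`101 + 2 * k` (the spokes). The `t`-th house has the vertices `10 * t + 2, …, 10 * t + 7` and the
edges `10 * t + 1, …, 10 * t + 9`. There are moreover three pieces, copies of a cycle of length
five; the `t`-th of them has the vertices `40 + 10 * t, …, 44 + 10 * t` and the edges
`40 + 20 * t, …, 44 + 20 * t`; further edges attach the pieces to the rim and to the houses. -/

/-- The ends of the edges outside the planet. -/
def outerEnds (e : ℕ) : ℕ × ℕ :=
  if e < 40 then
    let b := e / 10 * 10
    let s := 100 + 4 * (e / 10)
    match e % 10 with
    | 1 => (s, b + 2)
    | 2 => (b + 2, b + 3)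
    | 3 => (b + 3, b + 4)
    | 4 => (b + 4, b + 5)
    | 5 => (b + 5, b + 6)
    | 6 => (b + 6, s + 2)
    | 7 => (b + 7, b + 2)
    | 8 => (b + 7, b + 4)
    | _ => (b + 7, b + 6)
  else
    let b := 40 + (e - 40) / 20 * 10
    match (e - 40) % 20 with
    -- The two paths from `b` to `b + 2` have lengths two and three, so they cannot be exchanged by
    -- an isomorphism that keeps the attachments.
    | 0 => (b, b + 1)
    | 1 => (b + 1, b + 2)
    | 2 => (b, b + 3)
    | 3 => (b + 3, b + 4)
    | 4 => (b + 4, b + 2)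
    -- The attachments to the three houses. In the middle one the ends are interchanged, so that a
    -- piece attached to two neighbouring houses has its four edges nested rather than crossing.
    | 5 => (b, 100)
    | 6 => (b + 2, 102)
    | 7 => (b, 106)
    | 8 => (b + 2, 104)
    | 9 => (b, 108)
    | 10 => (b + 2, 110)
    | 11 => (b + 3, 3)
    | 12 => (b + 1, 7)
    | 13 => (b + 1, 15)
    | 14 => (b + 3, 17)
    | 15 => (b + 3, 23)
    | 16 => (b + 1, 27)
    | _ => (b + 3, 107)

/-- The ends of the edges of a graph on a planet with rim of length `n`. -/
def gEnds (n e : ℕ) : ℕ × ℕ :=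
  if e < 100 then outerEnds e
  else if e % 2 = 0 then (100 + (e - 100) / 2, 100 + ((e - 100) / 2 + 1) % n)
  else (99, 100 + (e - 100) / 2)

/-- The planet with rim of length `n`, together with the outer edges in `L`. -/
def gr (n : ℕ) (L : List ℕ) : Graph ℕ ℕ where
  vertexSet := {x | x = 99 ∨ (100 ≤ x ∧ x < 100 + n) ∨
    ∃ e ∈ L, x = (gEnds n e).1 ∨ x = (gEnds n e).2}
  edgeSet := {e | e ∈ L ∨ (100 ≤ e ∧ e < 100 + 2 * n)}
  IsLink e x y := (e ∈ L ∨ (100 ≤ e ∧ e < 100 + 2 * n)) ∧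
    s(x, y) = s((gEnds n e).1, (gEnds n e).2)
  isLink_symm := fun _ _ => ⟨fun x y h => ⟨h.1, by rw [Sym2.eq_swap, h.2]⟩⟩
  eq_or_eq_of_isLink_of_isLink := by
    rintro e x y v w ⟨-, h⟩ ⟨-, h'⟩
    have h2 := h.trans h'.symm
    rw [Sym2.eq_iff] at h2
    tauto
  edge_mem_iff_exists_isLink := fun e =>
    ⟨fun h => ⟨_, _, h, rfl⟩, fun ⟨_, _, h, _⟩ => h⟩
  left_mem_of_isLink := by
    rintro e x y ⟨he, h⟩
    rw [Sym2.eq_iff] at h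
    rcases he with he | ⟨h1, h2⟩
    · exact .inr (.inr ⟨e, he, by tauto⟩)
    · have hn : 0 < n := by omega
      have hm := Nat.mod_lt ((e - 100) / 2 + 1) hn
      simp only [gEnds, if_neg (show ¬ e < 100 by omega)] at h
      simp only [Set.mem_ofPred_eq]
      split_ifs at h <;> simp only at h <;> omega

variable {n : ℕ} {L : List ℕ}

theorem gr_isLink {e x y : ℕ} : (gr n L).IsLink e x y ↔
    (e ∈ L ∨ (100 ≤ e ∧ e < 100 + 2 * n)) ∧ s(x, y) = s((gEnds n e).1, (gEnds n e).2) := Iff.rfl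

theorem mem_edgeSet_gr {e : ℕ} : e ∈ (gr n L).edgeSet ↔ e ∈ L ∨ (100 ≤ e ∧ e < 100 + 2 * n) :=
  Iff.rfl

theorem mem_vertexSet_gr {x : ℕ} : x ∈ (gr n L).vertexSet ↔ x = 99 ∨ (100 ≤ x ∧ x < 100 + n) ∨
    ∃ e ∈ L, x = (gEnds n e).1 ∨ x = (gEnds n e).2 := Iff.rfl

theorem gr_inc {e x : ℕ} : (gr n L).Inc e x ↔
    (e ∈ L ∨ (100 ≤ e ∧ e < 100 + 2 * n)) ∧ (x = (gEnds n e).1 ∨ x = (gEnds n e).2) := by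
  simp only [Graph.Inc, gr_isLink, Sym2.eq_iff]
  constructor
  · rintro ⟨y, h1, h2⟩
    exact ⟨h1, by tauto⟩
  · rintro ⟨h1, rfl | rfl⟩
    · exact ⟨_, h1, .inl ⟨rfl, rfl⟩⟩
    · exact ⟨_, h1, .inr ⟨rfl, rfl⟩⟩

theorem gr_link {e : ℕ} (h : e ∈ L ∨ (100 ≤ e ∧ e < 100 + 2 * n)) :
    (gr n L).IsLink e (gEnds n e).1 (gEnds n e).2 := ⟨h, rfl⟩

theorem gr_rim {k : ℕ} (h : k < n) :
    (gr n L).IsLink (100 + 2 * k) (100 + k) (100 + (k + 1) % n) := by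
  have := gr_link (n := n) (L := L) (e := 100 + 2 * k) (.inr ⟨by omega, by omega⟩)
  simpa [gEnds] using this

theorem gr_spoke {k : ℕ} (h : k < n) : (gr n L).IsLink (101 + 2 * k) 99 (100 + k) := by
  have := gr_link (n := n) (L := L) (e := 101 + 2 * k) (.inr ⟨by omega, by omega⟩)
  have h1 : ¬ 101 + 2 * k < 100 := by omega
  have h2 : ¬ (101 + 2 * k) % 2 = 0 := by omega
  have h3 : (101 + 2 * k - 100) / 2 = k := by omega
  simpa only [gEnds, h1, h2, h3, if_false] using this

theorem gr_mono {L' : List ℕ} (h : ∀ e ∈ L', e ∈ L) : gr n L' ≤ gr n L := by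
  refine ⟨?_, ?_⟩
  · rintro x (hx | hx | ⟨e, he, hx⟩)
    · exact .inl hx
    · exact .inr (.inl hx)
    · exact .inr (.inr ⟨e, h e he, hx⟩)
  · rintro e x y ⟨he, hx⟩
    exact ⟨he.imp_left (h e), hx⟩

theorem finite_edgeSet_gr : (gr n L).edgeSet.Finite :=
  (L.finite_toSet.union (Set.finite_Ico 100 (100 + 2 * n))).subset fun _ h => h

theorem finite_vertexSet_gr : (gr n L).vertexSet.Finite := by
  refine ((Set.finite_singleton 99).union ((Set.finite_Ico 100 (100 + n)).union
    ((L.finite_toSet.image fun e => (gEnds n e).1).union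
      (L.finite_toSet.image fun e => (gEnds n e).2)))).subset ?_
  rintro x (hx | hx | ⟨e, he, hx | hx⟩)
  · exact .inl hx
  · exact .inr (.inl hx)
  · exact .inr (.inr (.inl ⟨e, he, hx.symm⟩))
  · exact .inr (.inr (.inr ⟨e, he, hx.symm⟩))

theorem gEnds_of_lt {e : ℕ} (h : e < 100) : gEnds n e = outerEnds e := if_pos h

/-- The edges in `L` are distinct from those of the planet, are not parallel, and have an end
outside the planet. -/
def Proper (L : List ℕ) : Prop :=
  (∀ e ∈ L, e < 100 ∧ (outerEnds e).1 < 99 ∧ (outerEnds e).1 ≠ (outerEnds e).2 ∧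
    ((outerEnds e).2 < 99 ∨ 100 ≤ (outerEnds e).2 ∧ (outerEnds e).2 < 112) ∨
    e < 100 ∧ 100 ≤ (outerEnds e).1 ∧ (outerEnds e).1 < 112 ∧ (outerEnds e).2 < 99) ∧
  ∀ e ∈ L, ∀ f ∈ L, e ≠ f → outerEnds e ≠ outerEnds f ∧
    outerEnds e ≠ ((outerEnds f).2, (outerEnds f).1)

instance : Decidable (Proper L) := by unfold Proper; infer_instance

theorem Proper.lt (h : Proper L) {e : ℕ} (he : e ∈ L) : e < 100 := by
  rcases h.1 e he with h | h <;> exact h.1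

theorem simple_gr (hn : 3 ≤ n) (h : Proper L) : (gr n L).Simple where
  not_isLoopAt := by
    rintro e x ⟨he, hx⟩
    have hne : (gEnds n e).1 = (gEnds n e).2 := by
      rw [Sym2.eq_iff] at hx
      rcases hx with ⟨h1, h2⟩ | ⟨h1, h2⟩
      · exact h1.symm.trans h2
      · exact h2.symm.trans h1
    rcases he with he | ⟨h1, h2⟩
    · rw [gEnds_of_lt (h.lt he)] at hne
      rcases h.1 e he with h | h <;> omega
    · simp only [gEnds, if_neg (show ¬ e < 100 by omega)] at hne
      split_ifs at hne
      · simp only at hne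
        rcases Nat.lt_or_ge ((e - 100) / 2 + 1) n with hlt | hge
        · rw [Nat.mod_eq_of_lt hlt] at hne; omega
        · rw [show (e - 100) / 2 + 1 = n by omega, Nat.mod_self] at hne; omega
      · simp only at hne; omega
  eq_of_isLink := by
    rintro e f x y ⟨he, hx⟩ ⟨hf, hx'⟩
    have hs := hx.symm.trans hx'
    rw [Sym2.eq_iff] at hs
    have key : ∀ e, e ∈ L → ∀ f, (100 ≤ f ∧ f < 100 + 2 * n) →
        ((gEnds n e).1 = (gEnds n f).1 ∧ (gEnds n e).2 = (gEnds n f).2 ∨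
        (gEnds n e).1 = (gEnds n f).2 ∧ (gEnds n e).2 = (gEnds n f).1) → False := by
      intro e he f hf hs
      rw [gEnds_of_lt (h.lt he)] at hs
      simp only [gEnds, if_neg (show ¬ f < 100 by omega)] at hs
      split_ifs at hs <;> simp only at hs <;> rcases h.1 e he with h | h <;> omega
    rcases he with he | he <;> rcases hf with hf | hf
    · by_contra hne
      obtain ⟨h1, h2⟩ := h.2 e he f hf hne
      rw [gEnds_of_lt (h.lt he), gEnds_of_lt (h.lt hf)] at hs
      rcases hs with hs | hs
      · exact h1 (Prod.ext hs.1 hs.2)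
      · exact h2 (Prod.ext hs.1 hs.2)
    · exact (key e he f hf hs).elim
    · exact (key f hf e he (by tauto)).elim
    · have hmod : ∀ a, a < n → ((a + 1) % n = a + 1 ∧ a + 1 < n) ∨ ((a + 1) % n = 0 ∧ a + 1 = n) := by
        intro a ha
        rcases Nat.lt_or_ge (a + 1) n with hlt | hge
        · exact .inl ⟨Nat.mod_eq_of_lt hlt, hlt⟩
        · right
          have : a + 1 = n := by omega
          rw [this]; exact ⟨Nat.mod_self n, rfl⟩
      have h1 := hmod ((e - 100) / 2) (by omega)
      have h2 := hmod ((f - 100) / 2) (by omega)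
      simp only [gEnds, if_neg (show ¬ e < 100 by omega), if_neg (show ¬ f < 100 by omega)] at hs
      split_ifs at hs <;> simp only at hs <;> omega

theorem mem_vertexSet_planet_iff {x : ℕ} :
    x ∈ (gr n []).vertexSet ↔ x = 99 ∨ (100 ≤ x ∧ x < 100 + n) := by
  simp [mem_vertexSet_gr]

/-- The planet is 2-connected. -/
theorem twoConnected_planet (hn : 3 ≤ n) : TwoConnected (gr n []) := by
  have hcon : ∀ X : Set ℕ, 99 ∉ X → Connected ((gr n []).deleteVerts X) := by
    intro X hX
    have hs : ∀ x, x ∈ ((gr n []).deleteVerts X).vertexSet →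
        Relation.ReflTransGen ((gr n []).deleteVerts X).Adj x 99 := by
      intro x hx
      rw [Graph.vertexSet_deleteVerts] at hx
      rcases mem_vertexSet_planet_iff.1 hx.1 with rfl | h
      · exact .refl
      · obtain ⟨k, rfl⟩ := Nat.exists_eq_add_of_le h.1
        exact .single ⟨101 + 2 * k, (Graph.deleteVerts_isLink _ _).2
          ⟨(gr_spoke (by omega)).symm, hx.2, hX⟩⟩
    refine ⟨⟨99, ?_⟩, fun x hx y hy => (hs x hx).trans ?_⟩
    · rw [Graph.vertexSet_deleteVerts]
      exact ⟨.inl rfl, hX⟩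
    · exact Std.Symm.symm (r := Relation.ReflTransGen ((gr n []).deleteVerts X).Adj) _ _ (hs y hy)
  refine ⟨?_, ?_, fun x hx => ?_⟩
  · have : ({99, 100, 101} : Set ℕ) ⊆ (gr n []).vertexSet := by
      rintro x (rfl | rfl | rfl)
      · exact .inl rfl
      · exact .inr (.inl ⟨by omega, by omega⟩)
      · exact .inr (.inl ⟨by omega, by omega⟩)
    refine le_trans ?_ (Set.encard_le_encard this)
    rw [Set.encard_insert_of_notMem (by simp), Set.encard_pair (by simp)]
    norm_num
  · have := hcon ∅ (by simp)
    rwa [Graph.deleteVerts_empty] at this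
  · by_cases hx99 : x = 99
    · subst hx99
      have hs : ∀ x, x ∈ ((gr n []).deleteVerts {99}).vertexSet →
          Relation.ReflTransGen ((gr n []).deleteVerts {99}).Adj 100 x := by
        intro x hx
        rw [Graph.vertexSet_deleteVerts] at hx
        rcases mem_vertexSet_planet_iff.1 hx.1 with rfl | h
        · exact absurd rfl hx.2
        · obtain ⟨k, rfl⟩ := Nat.exists_eq_add_of_le h.1
          refine reflTransGen_of_links (p := fun l => 100 + l) (q := fun l => 100 + 2 * l)
            (Nat.zero_le k) fun l _ hl => ?_
          have := gr_rim (n := n) (L := []) (k := l) (by omega)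
          rw [Nat.mod_eq_of_lt (by omega)] at this
          refine (Graph.deleteVerts_isLink _ _).2 ⟨this, ?_, ?_⟩ <;>
            simp only [Set.mem_singleton_iff] <;> omega
      refine ⟨⟨100, ?_⟩, fun x hx y hy => .trans ?_ (hs y hy)⟩
      · rw [Graph.vertexSet_deleteVerts]
        exact ⟨.inr (.inl ⟨by omega, by omega⟩), by simp⟩
      · exact Std.Symm.symm (r := Relation.ReflTransGen ((gr n []).deleteVerts {99}).Adj) _ _ (hs x hx)
    · exact hcon {x} (by simpa using Ne.symm hx99)

/-- The ends of the first edges of the planet, and of the other edges. -/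
def litEnds (e : ℕ) : ℕ × ℕ :=
  if e < 100 then outerEnds e
  else if e % 2 = 0 then (100 + (e - 100) / 2, 101 + (e - 100) / 2)
  else (99, 100 + (e - 100) / 2)

/-- `e` is an edge with ends `x` and `y` of the graph with outer edges `L`. -/
def LitLink (L : List ℕ) (e x y : ℕ) : Prop :=
  (e ∈ L ∨ 100 ≤ e ∧ e < 124 ∧ e ≠ 122) ∧ (litEnds e = (x, y) ∨ litEnds e = (y, x))

instance {e x y : ℕ} : Decidable (LitLink L e x y) := by unfold LitLink; infer_instance

/-- The rim edge 122 is left out because its second end is 100 if `n = 12` and 112 otherwise; the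
other ends do not depend on `n`. -/
theorem gEnds_eq_litEnds (hn : 12 ≤ n) {e : ℕ} (h : e < 100 ∨ 100 ≤ e ∧ e < 124 ∧ e ≠ 122) :
    gEnds n e = litEnds e := by
  unfold gEnds litEnds
  split_ifs with h1 h2
  · rfl
  · rw [Nat.mod_eq_of_lt (by omega)]
    congr 1; omega
  · rfl

theorem LitLink.isLink {e x y : ℕ} (hn : 12 ≤ n) (hL : Proper L) (h : LitLink L e x y) :
    (gr n L).IsLink e x y := by
  obtain ⟨h1, h2⟩ := h
  have h3 : gEnds n e = litEnds e := gEnds_eq_litEnds hn (h1.imp_left hL.lt)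
  refine ⟨h1.imp_right fun h => ⟨h.1, by omega⟩, ?_⟩
  rw [h3]
  rcases h2 with h2 | h2 <;> rw [h2]
  exact Sym2.eq_swap

/-- The vertices that are neither the centre nor among the first vertices of the rim, and the first
vertices of the rim. -/
def LitVertex (L : List ℕ) (x : ℕ) : Prop :=
  (100 ≤ x ∧ x < 112) ∨ ∃ e ∈ L, x = (outerEnds e).1 ∨ x = (outerEnds e).2

instance {x : ℕ} : Decidable (LitVertex L x) := by unfold LitVertex; infer_instance

theorem LitVertex.mem {x : ℕ} (hn : 12 ≤ n) (hL : Proper L) (h : LitVertex L x) :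
    x ∈ (gr n L).vertexSet := by
  rcases h with h | ⟨e, he, h⟩
  · exact .inr (.inl ⟨h.1, by omega⟩)
  · exact .inr (.inr ⟨e, he, by rwa [gEnds_of_lt (hL.lt he)]⟩)

/-- A list of ears, each given by its vertices and its edges, to be added successively to the graph
with outer edges `L`. -/
def EarsOK : List ℕ → List (List ℕ × List ℕ) → Prop
  | _, [] => True
  | L, (vs, es) :: l => vs.Nodup ∧ vs.length = es.length + 1 ∧ LitVertex L (vs.getD 0 0) ∧
      LitVertex L (vs.getD es.length 0) ∧ Proper (L ++ es) ∧
      (∀ i < es.length, LitLink (L ++ es) (es.getD i 0) (vs.getD i 0) (vs.getD (i + 1) 0)) ∧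
      EarsOK (L ++ es) l

instance decidableEarsOK : ∀ (L : List ℕ) (l : List (List ℕ × List ℕ)), Decidable (EarsOK L l)
  | _, [] => isTrue trivial
  | L, (vs, es) :: l => by
    have := decidableEarsOK (L ++ es) l
    unfold EarsOK
    infer_instance

/-- The ear conditions do not mention `n`, so a single evaluation per graph proves 2-connectivity on
all planets. -/
theorem twoConnected_of_earsOK (hn : 12 ≤ n) (l : List (List ℕ × List ℕ)) :
    ∀ L, Proper L → TwoConnected (gr n L) → EarsOK L l →
      TwoConnected (gr n (L ++ l.flatMap (·.2))) := by
  induction l with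
  | nil => intro L _ h _; simpa using h
  | cons d l ih =>
    obtain ⟨vs, es⟩ := d
    rintro L hL h ⟨h1, h2, h3, h4, h5, h6, h7⟩
    have hmono : gr n L ≤ gr n (L ++ es) := gr_mono fun e he => List.mem_append_left _ he
    have hlink := fun i hi => (h6 i hi).isLink hn h5
    have := ih (L ++ es) h5 (h.ear hmono (p := fun i => vs.getD i 0) (q := fun i => es.getD i 0)
      (k := es.length) ?_ (h3.mem hn hL) (h4.mem hn hL) hlink ?_) h7
    · simpa [List.append_assoc] using this
    · intro i hi j hj hij
      simp only [Set.mem_Iic] at hi hj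
      simp only at hij
      rw [List.getD_eq_getElem _ _ (by omega), List.getD_eq_getElem _ _ (by omega)] at hij
      exact (h1.getElem_inj_iff).1 hij
    · rintro v (hv | hv | ⟨e, he, hv⟩)
      · exact .inl (.inl hv)
      · exact .inl (.inr (.inl hv))
      · rcases List.mem_append.1 he with he | he
        · exact .inl (.inr (.inr ⟨e, he, hv⟩))
        · right
          obtain ⟨i, hi, rfl⟩ := List.getElem_of_mem he
          have hl := hlink i hi
          rw [List.getD_eq_getElem _ _ hi] at hl
          have h8 := (gr_link (n := n) (L := L ++ es) (e := es[i])
            (.inl (List.mem_append_right _ he))).eq_and_eq_or_eq_and_eq hl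
          rcases hv with rfl | rfl <;> rcases h8 with h8 | h8
          · exact ⟨i, hi.le, h8.1⟩
          · exact ⟨i + 1, hi, h8.1⟩
          · exact ⟨i + 1, hi, h8.2⟩
          · exact ⟨i, hi.le, h8.2⟩

end Gadget
end Village

namespace Village

namespace Gadget

/-! ### The outer edges of the graphs of the sequence -/

/-- Ears that build the three houses. -/
def houseEars : List (List ℕ × List ℕ) := [0, 1, 2].flatMap fun t =>
  [([100 + 4 * t, 10 * t + 2, 10 * t + 3, 10 * t + 4, 10 * t + 5, 10 * t + 6, 102 + 4 * t],
      [10 * t + 1, 10 * t + 2, 10 * t + 3, 10 * t + 4, 10 * t + 5, 10 * t + 6]),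
    ([10 * t + 2, 10 * t + 7, 10 * t + 6], [10 * t + 7, 10 * t + 9]),
    ([10 * t + 7, 10 * t + 4], [10 * t + 8])]

/-- The ear that consists of a single edge. -/
def edgeEar (e : ℕ) : List ℕ × List ℕ := ([(outerEnds e).1, (outerEnds e).2], [e])

/-- Ears that build the `t`-th piece, attached to the rim at one of the three positions `1`, `2`
and `3`. -/
def pieceEars (t a : ℕ) : List (List ℕ × List ℕ) :=
  let v := 40 + 10 * t
  let b := 40 + 20 * t
  [([(outerEnds (b + 2 * a + 3)).2, v, v + 1, v + 2, (outerEnds (b + 2 * a + 4)).2],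
      [b + 2 * a + 3, b, b + 1, b + 2 * a + 4]),
    ([v, v + 3, v + 4, v + 2], [b + 2, b + 3, b + 4])]

/-- Ears that build the `k`-th graph of the sequence on the planet. -/
def ears (k : ℕ) : List (List ℕ × List ℕ) := houseEars ++
  match k with
  -- The house 0 is read: piece 0 is tied to the wall by its long path and piece 1 to the inhabitant
  -- by its short path, so that both get the same orientation.
  | 1 => pieceEars 0 1 ++ pieceEars 1 1 ++ [edgeEar 51, edgeEar 72]
  | 2 => pieceEars 0 1
  -- Piece 0, with the value of house 0, is attached to house 1 as well; pieces 1 and 2 read house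
  -- 1. One of the three is kept in the next graph.
  | 3 => pieceEars 0 1 ++ [edgeEar 47, edgeEar 48] ++ pieceEars 1 2 ++ pieceEars 2 2 ++
      [edgeEar 73, edgeEar 94]
  | 4 => pieceEars 0 2
  | 5 => pieceEars 0 2 ++ pieceEars 1 3 ++ pieceEars 2 3 ++ [edgeEar 75, edgeEar 96]
  | 6 => pieceEars 0 2 ++ pieceEars 1 3
  -- Piece 1, with the value of house 2, is brought to house 1, where it competes with piece 0.
  | 7 => pieceEars 0 2 ++ pieceEars 1 3 ++ [edgeEar 67, edgeEar 68]
  | 8 => pieceEars 0 2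
  -- The final test: the long path of the surviving piece must reach the rim vertex 107.
  | 9 => pieceEars 0 2 ++ [edgeEar 57]
  | _ => []

/-- The edges outside the planet of the `k`-th graph of the sequence. -/
def outer (k : ℕ) : List ℕ := (ears k).flatMap (·.2)

theorem outer_eq {k : ℕ} (hk : 10 ≤ k) : outer k = outer 0 := by
  unfold outer ears
  match k, hk with
  | k + 10, _ => rfl

/-- A property of the graphs of the sequence need only be checked for the first eleven. -/
theorem forall_outer {P : List ℕ → Prop} (h : ∀ k < 11, P (outer k)) (k : ℕ) : P (outer k) := by
  rcases Nat.lt_or_ge k 11 with hk | hk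
  · exact h k hk
  · rw [outer_eq (by omega)]
    exact h 0 (by omega)

theorem proper_outer (k : ℕ) : Proper (outer k) :=
  forall_outer (P := Proper) (by decide +kernel) k

theorem earsOK (k : ℕ) : EarsOK [] (ears k) := by
  have h : ∀ k < 11, EarsOK [] (ears k) := by decide +kernel
  rcases Nat.lt_or_ge k 11 with hk | hk
  · exact h k hk
  · have : ears k = ears 0 := by
      unfold ears
      match k, hk with
      | k + 11, _ => rfl
    rw [this]
    exact h 0 (by omega)

theorem twoConnected_gr {n : ℕ} (hn : 12 ≤ n) (k : ℕ) : TwoConnected (gr n (outer k)) :=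
  twoConnected_of_earsOK hn (ears k) [] (by decide) (twoConnected_planet (by omega)) (earsOK k)

/-! ### Rotations -/

/-- The choices that determine the rotations of the embeddings below: on which side of each house
the inhabitant is, which of the pieces are reflected, and how the edges at the rim vertices
`100 + 4 * t` and `102 + 4 * t` are ordered. -/
structure Config where
  inside : ℕ → Bool
  flip : ℕ → Bool
  low : ℕ → Bool
  cross : Bool

/-- The reverse of a list if `b` is true, and the list itself otherwise. -/
def flipList (b : Bool) (l : List ℕ) : List ℕ := bif b then l.reverse else l

/-- The cyclic order at `v` of all edges outside the planet. -/
def outerRot (c : Config) (v : ℕ) : List ℕ :=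
  bif Nat.blt v 40 then
    let b := v / 10 * 10
    let x := c.inside (v / 10)
    match v % 10 with
    | 2 => flipList x [b + 1, b + 7, b + 2]
    | 3 => flipList x [b + 2, b + 3, 51, 75]
    | 4 => flipList x [b + 3, b + 8, b + 4]
    | 5 => flipList x [b + 4, b + 5, 73]
    | 6 => flipList x [b + 5, b + 9, b + 6]
    | _ => flipList x [b + 9, b + 8, b + 7, 72, 94, 96]
  else bif Nat.blt v 100 then
    let t := (v - 40) / 10
    let b := 40 + t * 20
    let y := c.flip t
    match v % 10 with
    | 0 => [b + 5, b + 9, b + 7] ++ flipList y [b, b + 2]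
    | 1 => flipList y [b, b + 12, b + 13, b + 16, b + 1]
    | 2 => [b + 8, b + 6, b + 10] ++ flipList y [b + 4, b + 1]
    | 3 => flipList y [b + 2, b + 3, b + 11, b + 14, b + 15, b + 17]
    | _ => [b + 3, b + 4]
  else
    match v - 100 with
    | 0 => flipList (c.low 0) [45, 1, 65]
    | 2 => flipList (c.low 0) [66, 6, 46]
    | 4 => bif c.cross then [68, 48, 11] else 48 :: flipList (c.low 1) [68, 11, 88]
    | 6 => bif c.cross then [16, 47, 67] else flipList (c.low 1) [87, 16, 67] ++ [47]
    | 7 => [57]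
    | 8 => flipList (c.low 2) [69, 21, 89]
    | 10 => flipList (c.low 2) [90, 26, 70]
    | _ => []

/-- A triple of truth values. -/
def tri (a b c : Bool) (t : ℕ) : Bool :=
  match t with
  | 0 => a
  | 1 => b
  | _ => c

/-- The choices for the embedding of the `k`-th graph in which the houses have the truth values
`a`, `b` and `c`. -/
def config (k : ℕ) (a b c : Bool) : Config where
  inside := tri a b c
  flip := match k with
    | 1 => fun _ => !a
    | 2 => fun _ => !a
    | 3 => tri (!a) (!b) (!b)
    | 4 => fun _ => !(a || b)
    | 5 => tri (!(a || b)) (!c) (!c)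
    | 6 => tri (!(a || b)) (!c) (!c)
    | 7 => tri (!(a || b)) (!c) (!c)
    | _ => fun _ => !(a || b || c)
  low := match k with
    | 1 => fun _ => !a
    | 3 => tri false (!b) false
    | 5 => fun _ => !c
    | _ => fun _ => false
  -- In graph 7 the piece that comes over from house 2 passes outside of piece 0.
  cross := Nat.beq k 7

/-- The set of elements of a list of numbers, as the number with these binary digits. -/
def mask (l : List ℕ) : ℕ := l.foldr (fun a r => Nat.lor (Nat.shiftLeft 1 a) r) 0

theorem testBit_mask {l : List ℕ} {e : ℕ} : (mask l).testBit e = true ↔ e ∈ l := by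
  induction l with
  | nil => simp [mask]
  | cons a l ih =>
    have : (mask (a :: l)).testBit e = ((2 ^ a).testBit e || (mask l).testBit e) := by
      rw [← Nat.testBit_or, ← Nat.one_shiftLeft]; rfl
    rw [this, Bool.or_eq_true, ih, Nat.testBit_two_pow, decide_eq_true_eq, List.mem_cons, eq_comm]

/-- The cyclic order at `v` of the edges in `L`. -/
def rotAt (L : List ℕ) (c : Config) (v : ℕ) : List ℕ :=
  (outerRot c v).filter fun e => (mask L).testBit e &&
    (Nat.beq (outerEnds e).1 v || Nat.beq (outerEnds e).2 v)

/-- The element that follows `e` in the list `a :: l`, and `0` if there is none. -/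
def after (e : ℕ) : ℕ → List ℕ → ℕ
  | _, [] => 0
  | a, b :: l => bif Nat.beq a e then b else after e b l

/-- The end of `e` different from `v`. -/
def otherEnd (e v : ℕ) : ℕ :=
  bif Nat.beq (litEnds e).1 v then (litEnds e).2 else (litEnds e).1

/-- The successor of `e` in the rotation at the vertex `u`. -/
def nextEdge (L : List ℕ) (c : Config) (u e : ℕ) : ℕ :=
  bif Nat.ble 100 u then after e (2 * u - 102) (rotAt L c u ++ [2 * u - 100])
  else after e 1000 (rotAt L c u ++ (rotAt L c u).take 1)

/-- The value of `f` at `n`; the kernel evaluates `n` first. -/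
def force {γ : Type} (n : ℕ) (f : ℕ → γ) : γ :=
  match n with
  | 0 => f 0
  | n + 1 => f (n + 1)

/-- The successor of a dart on its face, where a dart `(v, e)` is encoded as `256 * v + e`. -/
def nextDart (L : List ℕ) (c : Config) (d : ℕ) : ℕ :=
  force d fun d => force (otherEnd (d % 256) (d / 256)) fun u => 256 * u + nextEdge L c u (d % 256)

/-- The codes of a face, from the dart with code `d` on. -/
def trace (L : List ℕ) (c : Config) (d₀ : ℕ) : ℕ → ℕ → List ℕ
  | 0, _ => []
  | f + 1, d => bif Nat.beq d d₀ then [] else d :: force (nextDart L c d) (trace L c d₀ f)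

/-- The codes of darts on the outer side of the planet. -/
def outerDarts (L : List ℕ) : List ℕ :=
  (L.flatMap fun e => [256 * (outerEnds e).1 + e, 256 * (outerEnds e).2 + e]) ++
    (List.range 11).map fun j => 256 * (100 + j) + (100 + 2 * j)

/-- Whether `e` is an element of `l`. -/
def memB (e : ℕ) (l : List ℕ) : Bool := l.any (Nat.beq e)

/-- The faces on the outer side of the planet, with the exception of the face at the edges of the
rim that are not close to the houses. -/
def outerFaces (L : List ℕ) (c : Config) : List (List ℕ) :=
  (outerDarts L).foldl (fun acc d => bif memB d acc.flatten then acc else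
    let f := d :: force (nextDart L c d) (trace L c d 40)
    bif Nat.beq (nextDart L c (f.getLastD 0)) d then f :: acc else acc) []

/-- Whether `d'` is the successor of `d` on its face. -/
def stepB (L : List ℕ) (c : Config) (d d' : ℕ) : Bool :=
  force d fun d => force d' fun d' =>
    Nat.beq (otherEnd (d % 256) (d / 256)) (d' / 256) &&
      force (d' / 256) fun u => Nat.beq (nextEdge L c u (d % 256)) (d' % 256)

/-- Whether `p :: l` is a sequence of successors that leads back to `a`. -/
def closedB (L : List ℕ) (c : Config) (a : ℕ) : ℕ → List ℕ → Bool
  | p, [] => stepB L c p a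
  | p, b :: l => stepB L c p b && closedB L c a b l

/-- Whether a list has no repetitions. -/
def nodupB : List ℕ → Bool
  | [] => true
  | a :: l => !memB a l && nodupB l

/-- The vertices outside the planet. -/
def outerVerts (L : List ℕ) : List ℕ :=
  ((L.flatMap fun e => [(outerEnds e).1, (outerEnds e).2]).filter fun v => Nat.blt v 99).dedup

/-- Whether `d` is the code of a dart on the outer side of the planet. -/
def dartB (L : List ℕ) (d : ℕ) : Bool := force d fun d =>
  ((mask L).testBit (d % 256) || Nat.blt 99 (d % 256) && Nat.blt (d % 256) 122 &&
      Nat.beq (d % 256 % 2) 0 && Nat.beq (d / 256) (100 + (d % 256 - 100) / 2)) &&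
    (Nat.beq (litEnds (d % 256)).1 (d / 256) || Nat.beq (litEnds (d % 256)).2 (d / 256))

/-- Whether `l` is a face on the outer side of the planet. -/
def faceB (L : List ℕ) (c : Config) : List ℕ → Bool
  | [] => false
  | a :: l => closedB L c a a l && (a :: l).all (dartB L)

/-- Whether the lists of edges at the vertices are correct. -/
def rotB (L : List ℕ) (c : Config) : Bool :=
  (List.range 112).all (fun v => nodupB (outerRot c v)) &&
    L.all fun e => memB e (outerRot c (outerEnds e).1) && memB e (outerRot c (outerEnds e).2)

/-- Whether the rotations define an embedding in the sphere. -/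
def planarB (L : List ℕ) (c : Config) : Bool :=
  rotB L c &&
    Nat.ble L.length ((outerFaces L c).length + (outerVerts L).length) &&
    nodupB (outerFaces L c).flatten && (outerFaces L c).all (faceB L c)

theorem force_eq {γ : Type} (n : ℕ) (f : ℕ → γ) : force n f = f n := by cases n <;> rfl

/-- The all-false triple is excluded in graph 9 only: there the surviving piece would have the wrong
orientation for its edge to 107. -/
theorem planarB_outer : ∀ k < 11, ∀ a b c : Bool, (a || b || c || !Nat.beq k 9) = true →
    planarB (outer k) (config k a b c) = true := by
  decide +kernel

end Gadget
end Village

namespace Village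

/-! ### Counting the faces of a rotation system from below -/

section Faces

variable {α β : Type*} {G : Graph α β} {rot : α → Equiv.Perm β}

/-- A set of darts that is closed under successors and predecessors is a union of faces. -/
theorem FaceStep.mem_iff {T : Set (α × β)}
    (h₁ : ∀ d ∈ T, ∃ d' ∈ T, G.IsLink d.2 d.1 d'.1 ∧ rot d'.1 d.2 = d'.2)
    (h₂ : ∀ d' ∈ T, ∃ d ∈ T, G.IsLink d.2 d.1 d'.1 ∧ rot d'.1 d.2 = d'.2)
    {d d' : Dart G} (h : FaceStep G rot d d') : d.1 ∈ T ↔ d'.1 ∈ T := by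
  obtain ⟨hl, hr⟩ := h
  constructor
  · intro hd
    obtain ⟨x, hx, hl', hr'⟩ := h₁ _ hd
    have h1 := hl.right_unique hl'
    have : d'.1 = x := Prod.ext h1 (by rw [hr, ← hr', h1])
    rwa [this]
  · intro hd
    obtain ⟨x, hx, hl', hr'⟩ := h₂ _ hd
    have h1 : x.2 = d.1.2 := (rot d'.1.1).injective (hr'.trans hr)
    rw [h1] at hl'
    have : x = d.1 := Prod.ext (hl'.left_unique hl) h1
    rwa [← this]

/-- Disjoint nonempty unions of faces, and a dart in none of them. -/
theorem card_add_one_le_card_face {ι : Type*} [Finite ι] [Finite (Face G rot)]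
    (T : ι → Set (α × β)) (hdisj : ∀ i j d, d ∈ T i → d ∈ T j → i = j)
    (hne : ∀ i, ∃ d : Dart G, d.1 ∈ T i)
    (hstep : ∀ i (d d' : Dart G), FaceStep G rot d d' → (d.1 ∈ T i ↔ d'.1 ∈ T i))
    (d₀ : Dart G) (h₀ : ∀ i, d₀.1 ∉ T i) : Nat.card ι + 1 ≤ Nat.card (Face G rot) := by
  classical
  let lab : Dart G → Option ι := fun d => if h : ∃ i, d.1 ∈ T i then some h.choose else none
  have hlab : ∀ i (d : Dart G), d.1 ∈ T i → lab d = some i := by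
    intro i d hd
    have h : ∃ i, d.1 ∈ T i := ⟨i, hd⟩
    simp only [lab, dif_pos h]
    exact congrArg some (hdisj _ _ _ h.choose_spec hd)
  have hlab' : ∀ d : Dart G, (∀ i, d.1 ∉ T i) → lab d = none := fun d hd =>
    dif_neg fun ⟨i, hi⟩ => hd i hi
  rw [← Finite.card_option]
  refine Nat.card_le_card_of_surjective (Quot.lift lab ?_ : Face G rot → Option ι) ?_
  · intro d d' h
    by_cases hd : ∃ i, d.1 ∈ T i
    · obtain ⟨i, hi⟩ := hd
      rw [hlab i d hi, hlab i d' ((hstep i d d' h).1 hi)]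
    · push Not at hd
      rw [hlab' d hd, hlab' d' fun i hi => hd i ((hstep i d d' h).2 hi)]
  · rintro (_ | i)
    · exact ⟨Quot.mk _ d₀, hlab' d₀ h₀⟩
    · obtain ⟨d, hd⟩ := hne i
      exact ⟨Quot.mk _ d, hlab i d hd⟩

end Faces

namespace Gadget

variable {n : ℕ} {L : List ℕ} {c : Config}

/-- Appending the first element closes the list up, so that cyclic succession becomes adjacency, the
step from the last element to the first included. -/
theorem formPerm_of_append {R l₁ l₂ : List ℕ} {e e' : ℕ} (h : R.Nodup)
    (hs : R ++ R.take 1 = l₁ ++ e :: e' :: l₂) : R.formPerm e = e' := by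
  have hlen := congrArg List.length hs
  simp only [List.length_append, List.length_cons, List.length_take] at hlen
  have hi : l₁.length < R.length := by omega
  have h1 : (R ++ R.take 1)[l₁.length]? = some e := by rw [hs]; simp
  have h2 : (R ++ R.take 1)[l₁.length + 1]? = some e' := by rw [hs]; simp
  rw [List.getElem?_append_left hi, List.getElem?_eq_getElem hi, Option.some_inj] at h1
  rw [← h1, List.formPerm_apply_getElem _ h]
  rcases Nat.lt_or_ge (l₁.length + 1) R.length with h3 | h3
  · rw [List.getElem?_append_left h3, List.getElem?_eq_getElem h3, Option.some_inj] at h2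
    simp only [Nat.mod_eq_of_lt h3, h2]
  · have h4 : l₁.length + 1 = R.length := by omega
    simp only [h4, Nat.mod_self]
    rw [h4, List.getElem?_append_right le_rfl, Nat.sub_self, List.getElem?_take_of_lt one_pos,
      List.getElem?_eq_getElem (by omega), Option.some_inj] at h2
    exact h2

/-- The value 0 of `after` signals that no successor was found, whence the hypothesis on `e'`. -/
theorem after_spec {e e' : ℕ} (he' : e' ≠ 0) {l : List ℕ} :
    ∀ {a : ℕ}, after e a l = e' → ∃ l₁ l₂, a :: l = l₁ ++ e :: e' :: l₂ := by
  induction l with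
  | nil => intro a h; exact absurd h.symm he'
  | cons b l ih =>
    intro a h
    unfold after at h
    cases hae : Nat.beq a e with
    | true =>
      rw [hae, cond_true] at h
      exact ⟨[], l, by rw [Nat.eq_of_beq_eq_true hae, h]; rfl⟩
    | false =>
      rw [hae, cond_false] at h
      obtain ⟨l₁, l₂, h⟩ := ih h
      exact ⟨a :: l₁, l₂, by rw [h]; rfl⟩

theorem memB_iff {e : ℕ} {l : List ℕ} : memB e l = true ↔ e ∈ l := by
  simp [memB, List.any_eq_true]

theorem nodupB_iff {l : List ℕ} : nodupB l = true ↔ l.Nodup := by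
  induction l with
  | nil => simp [nodupB]
  | cons a l ih =>
    rw [nodupB, Bool.and_eq_true, ih, Bool.not_eq_true', ← Bool.not_eq_true, memB_iff,
      List.nodup_cons]

/-- The cyclic order of all edges at `v`. -/
def rotList (n : ℕ) (L : List ℕ) (c : Config) (v : ℕ) : List ℕ :=
  if v = 99 then (List.range n).map fun k => 101 + 2 * k
  else if 100 ≤ v ∧ v < 100 + n then
    (2 * v - 100) :: (2 * v - 99) :: (100 + 2 * ((v - 100 + n - 1) % n)) :: rotAt L c v
  else rotAt L c v

/-- The rotation system given by `rotList`. -/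
def gRot (n : ℕ) (L : List ℕ) (c : Config) (v : ℕ) : Equiv.Perm ℕ := (rotList n L c v).formPerm

theorem outerRot_eq_nil {v : ℕ} (hv : 112 ≤ v) : outerRot c v = [] := by
  obtain ⟨k, rfl⟩ := Nat.exists_eq_add_of_le hv
  have h1 : Nat.blt (112 + k) 40 = false := by
    rw [← Bool.not_eq_true, Nat.blt_eq]; omega
  have h2 : Nat.blt (112 + k) 100 = false := by
    rw [← Bool.not_eq_true, Nat.blt_eq]; omega
  rw [outerRot, h1, h2, cond_false, cond_false, show 112 + k - 100 = k + 12 by omega]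
  rfl

theorem mem_rotAt {e v : ℕ} : e ∈ rotAt L c v ↔
    e ∈ outerRot c v ∧ e ∈ L ∧ (v = (outerEnds e).1 ∨ v = (outerEnds e).2) := by
  simp only [rotAt, List.mem_filter, Bool.and_eq_true, testBit_mask, Bool.or_eq_true, Nat.beq_eq]
  rw [eq_comm (a := v), eq_comm (a := v)]

theorem nodup_outerRot (h : rotB L c = true) (v : ℕ) : (outerRot c v).Nodup := by
  rcases Nat.lt_or_ge v 112 with hv | hv
  · simp only [rotB, Bool.and_eq_true, List.all_eq_true, List.mem_range, nodupB_iff] at h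
    exact h.1 v hv
  · rw [outerRot_eq_nil hv]
    exact List.nodup_nil

theorem mem_rotAt_iff (h : rotB L c = true) {e v : ℕ} : e ∈ rotAt L c v ↔
    e ∈ L ∧ (v = (outerEnds e).1 ∨ v = (outerEnds e).2) := by
  rw [mem_rotAt, and_iff_right_iff_imp]
  simp only [rotB, Bool.and_eq_true, List.all_eq_true, memB_iff] at h
  rintro ⟨h1, rfl | rfl⟩
  · exact (h.2 e h1).1
  · exact (h.2 e h1).2

theorem nodup_rotList (hn : 12 ≤ n) (hL : Proper L) (h : rotB L c = true) (v : ℕ) :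
    (rotList n L c v).Nodup := by
  have h1 : (rotAt L c v).Nodup := (nodup_outerRot h v).filter _
  unfold rotList
  split_ifs with h2 h3
  · exact List.nodup_range.map fun a b hab => by omega
  · have hlt : ∀ e ∈ rotAt L c v, e < 100 := fun e he => hL.lt (mem_rotAt.1 he).2.1
    have hm : (v - 100 + n - 1) % n ≠ v - 100 := by
      rcases Nat.eq_zero_or_pos (v - 100) with h0 | h0
      · rw [h0, Nat.zero_add, Nat.mod_eq_of_lt (by omega)]; omega
      · rw [show v - 100 + n - 1 = v - 100 - 1 + n by omega, Nat.add_mod_right,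
          Nat.mod_eq_of_lt (by omega)]
        omega
    simp only [List.nodup_cons, List.mem_cons, not_or]
    refine ⟨⟨by omega, by omega, fun h => ?_⟩, ⟨by omega, fun h => ?_⟩, fun h => ?_, h1⟩
    · have := hlt _ h; omega
    · have := hlt _ h; omega
    · have := hlt _ h; omega
  · exact h1

theorem mem_rotList (hL : Proper L) (h : rotB L c = true) {v : ℕ}
    (hv : v ∈ (gr n L).vertexSet) {e : ℕ} : e ∈ rotList n L c v ↔ (gr n L).Inc e v := by
  rw [gr_inc]
  have hends : ∀ e ∈ L, e < 100 ∧ (outerEnds e).1 ≠ 99 ∧ (outerEnds e).2 ≠ 99 := fun e he => by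
    rcases hL.1 e he with h | h <;> omega
  have hpl : ∀ e, 100 ≤ e → gEnds n e = if e % 2 = 0
      then (100 + (e - 100) / 2, 100 + ((e - 100) / 2 + 1) % n) else (99, 100 + (e - 100) / 2) :=
    fun e he => if_neg (by omega)
  unfold rotList
  split_ifs with h2 h3
  · subst h2
    simp only [List.mem_map, List.mem_range]
    constructor
    · rintro ⟨k, hk, rfl⟩
      refine ⟨.inr ⟨by omega, by omega⟩, .inl ?_⟩
      rw [hpl _ (by omega), if_neg (by omega)]
    · rintro ⟨h3 | h3, h4⟩
      · rw [gEnds_of_lt (hends e h3).1] at h4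
        have := hends e h3
        omega
      · rw [hpl _ h3.1] at h4
        split_ifs at h4 <;> simp only at h4
        · omega
        · exact ⟨(e - 100) / 2, by omega, by omega⟩
  · simp only [List.mem_cons, mem_rotAt_iff h]
    constructor
    · rintro (rfl | rfl | rfl | ⟨h4, h5⟩)
      · refine ⟨.inr ⟨by omega, by omega⟩, .inl ?_⟩
        rw [hpl _ (by omega), if_pos (by omega)]
        simp only; omega
      · refine ⟨.inr ⟨by omega, by omega⟩, .inr ?_⟩
        rw [hpl _ (by omega), if_neg (by omega)]
        simp only; omega
      · have := Nat.mod_lt (v - 100 + n - 1) (show n > 0 by omega)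
        refine ⟨.inr ⟨by omega, by omega⟩, .inr ?_⟩
        rw [hpl _ (by omega), if_pos (by omega),
          show (100 + 2 * ((v - 100 + n - 1) % n) - 100) / 2 = (v - 100 + n - 1) % n by omega,
          Nat.mod_add_mod, show v - 100 + n - 1 + 1 = v - 100 + n by omega, Nat.add_mod_right,
          Nat.mod_eq_of_lt (a := v - 100) (by omega)]
        simp only; omega
      · rw [gEnds_of_lt (hends e h4).1]
        exact ⟨.inl h4, h5⟩
    · rintro ⟨h4 | h4, h5⟩
      · rw [gEnds_of_lt (hends e h4).1] at h5
        exact .inr (.inr (.inr ⟨h4, h5⟩))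
      · rw [hpl _ h4.1] at h5
        split_ifs at h5 with h6 <;> simp only at h5
        · rcases h5 with h5 | h5
          · left; omega
          · right; right; left
            rw [h5, show 100 + ((e - 100) / 2 + 1) % n - 100 + n - 1
              = ((e - 100) / 2 + 1) % n + (n - 1) by omega, Nat.mod_add_mod,
              show (e - 100) / 2 + 1 + (n - 1) = (e - 100) / 2 + n by omega, Nat.add_mod_right,
              Nat.mod_eq_of_lt (by omega)]
            omega
        · right; left; omega
  · rw [mem_rotAt_iff h]
    constructor
    · rintro ⟨h4, h5⟩
      rw [gEnds_of_lt (hends e h4).1]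
      exact ⟨.inl h4, h5⟩
    · rintro ⟨h4 | h4, h5⟩
      · rw [gEnds_of_lt (hends e h4).1] at h5
        exact ⟨h4, h5⟩
      · have := Nat.mod_lt ((e - 100) / 2 + 1) (show n > 0 by omega)
        rw [hpl _ h4.1] at h5
        split_ifs at h5 <;> simp only at h5 <;> omega

theorem isCycleOn_gRot (hn : 12 ≤ n) (hL : Proper L) (h : rotB L c = true) {v : ℕ}
    (hv : v ∈ (gr n L).vertexSet) : (gRot n L c v).IsCycleOn ((gr n L).incidenceSet v) := by
  have : (gr n L).incidenceSet v = {a | a ∈ rotList n L c v} := by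
    ext e
    exact (mem_rotList hL h hv).symm
  rw [this]
  exact (nodup_rotList hn hL h v).isCycleOn_formPerm

/-! ### The faces -/

theorem gRot_rim (hn : 12 ≤ n) (hL : Proper L) (h : rotB L c = true) {k : ℕ} (hk : k < n) :
    gRot n L c (100 + k) (100 + 2 * k) = 101 + 2 * k ∧
    gRot n L c (100 + k) (101 + 2 * k) = 100 + 2 * ((k + n - 1) % n) := by
  have h1 := nodup_rotList hn hL h (100 + k)
  have h2 : rotList n L c (100 + k) =
      (100 + 2 * k) :: (101 + 2 * k) :: (100 + 2 * ((k + n - 1) % n)) :: rotAt L c (100 + k) := by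
    rw [rotList, if_neg (by omega), if_pos (by omega)]
    congr 1
    · omega
    congr 1
    · omega
    · rw [Nat.add_sub_cancel_left]
  rw [gRot]
  refine ⟨formPerm_of_append h1 (l₁ := [])
    (l₂ := (100 + 2 * ((k + n - 1) % n)) :: (rotAt L c (100 + k) ++ [100 + 2 * k])) ?_,
    formPerm_of_append h1 (l₁ := [100 + 2 * k]) (l₂ := rotAt L c (100 + k) ++ [100 + 2 * k]) ?_⟩
  · rw [h2]; rfl
  · rw [h2]; rfl

theorem gRot_centre {k : ℕ} (hk : k < n) :
    gRot n L c 99 (101 + 2 * k) = 101 + 2 * ((k + 1) % n) := by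
  have h1 : (List.map (fun k => 101 + 2 * k) (List.range n)).Nodup :=
    List.nodup_range.map fun a b hab => by omega
  rw [gRot, rotList, if_pos rfl]
  have h2 := List.formPerm_apply_getElem _ h1 k (by simpa using hk)
  simpa using h2

/-- The triangle between the `k`-th edge of the rim and the centre. -/
def triangle (n k : ℕ) : Set (ℕ × ℕ) :=
  {(99, 101 + 2 * ((k + 1) % n)), (100 + (k + 1) % n, 100 + 2 * k), (100 + k, 101 + 2 * k)}

/-- The face runs outwards on the spoke at `k + 1`, backwards on the rim edge and inwards on the
spoke at `k`; the rotation at the centre leads back to the start. -/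
theorem exists_triangle_eq (hn : 12 ≤ n) (hL : Proper L) (h : rotB L c = true) {k : ℕ}
    (hk : k < n) {P : ℕ × ℕ → ℕ × ℕ → Prop}
    (hP : ∀ d d', (gr n L).IsLink d.2 d.1 d'.1 ∧ gRot n L c d'.1 d.2 = d'.2 → P d d') :
    (∀ d ∈ triangle n k, ∃ d' ∈ triangle n k, P d d') ∧
      ∀ d' ∈ triangle n k, ∃ d ∈ triangle n k, P d d' := by
  have hm := Nat.mod_lt (k + 1) (show n > 0 by omega)
  have h1 : P (99, 101 + 2 * ((k + 1) % n)) (100 + (k + 1) % n, 100 + 2 * k) := by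
    refine hP _ _ ⟨gr_spoke hm, ?_⟩
    rw [(gRot_rim hn hL h hm).2]
    congr 2
    rw [Nat.add_sub_assoc (by omega), Nat.mod_add_mod, show k + 1 + (n - 1) = k + n by omega,
      Nat.add_mod_right, Nat.mod_eq_of_lt hk]
  have h2 : P (100 + (k + 1) % n, 100 + 2 * k) (100 + k, 101 + 2 * k) :=
    hP _ _ ⟨(gr_rim hk).symm, (gRot_rim hn hL h hk).1⟩
  have h3 : P (100 + k, 101 + 2 * k) (99, 101 + 2 * ((k + 1) % n)) :=
    hP _ _ ⟨(gr_spoke hk).symm, gRot_centre hk⟩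
  have m1 : ((99, 101 + 2 * ((k + 1) % n)) : ℕ × ℕ) ∈ triangle n k := .inl rfl
  have m2 : ((100 + (k + 1) % n, 100 + 2 * k) : ℕ × ℕ) ∈ triangle n k := .inr (.inl rfl)
  have m3 : ((100 + k, 101 + 2 * k) : ℕ × ℕ) ∈ triangle n k := .inr (.inr rfl)
  constructor
  · rintro d (rfl | rfl | rfl)
    exacts [⟨_, m2, h1⟩, ⟨_, m3, h2⟩, ⟨_, m1, h3⟩]
  · rintro d (rfl | rfl | rfl)
    exacts [⟨_, m3, h3⟩, ⟨_, m1, h1⟩, ⟨_, m2, h2⟩]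

/-- The darts with codes in a list. -/
def decode (l : List ℕ) : Set (ℕ × ℕ) := {d | d.2 < 256 ∧ 256 * d.1 + d.2 ∈ l}

theorem mem_decode {l : List ℕ} {d : ℕ} (h : d ∈ l) : (d / 256, d % 256) ∈ decode l :=
  ⟨Nat.mod_lt _ (by omega), by rwa [Nat.div_add_mod]⟩

/-- The starting dart `p` and the dart `a` to which the walk returns are kept apart, because the
induction advances `p` only; for a face they coincide. -/
theorem closedB_spec {a : ℕ} {l : List ℕ} : ∀ {p : ℕ}, closedB L c a p l = true →
    (∀ d ∈ p :: l, ∃ d' ∈ a :: l, stepB L c d d' = true) ∧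
      ∀ d' ∈ a :: l, ∃ d ∈ p :: l, stepB L c d d' = true := by
  induction l with
  | nil =>
    intro p h
    simpa [closedB] using h
  | cons b l ih =>
    intro p h
    rw [closedB, Bool.and_eq_true] at h
    obtain ⟨h1, h2⟩ := ih h.2
    constructor
    · intro d hd
      rcases List.mem_cons.1 hd with rfl | hd
      · exact ⟨b, by simp, h.1⟩
      · obtain ⟨d', hd', hs⟩ := h1 d hd
        exact ⟨d', by simp only [List.mem_cons] at hd' ⊢; tauto, hs⟩
    · intro d' hd'
      rcases List.mem_cons.1 hd' with rfl | hd'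
      · obtain ⟨d, hd, hs⟩ := h2 d' (by simp)
        exact ⟨d, List.mem_cons_of_mem _ hd, hs⟩
      · rcases List.mem_cons.1 hd' with rfl | hd'
        · exact ⟨p, by simp, h.1⟩
        · obtain ⟨d, hd, hs⟩ := h2 d' (List.mem_cons_of_mem _ hd')
          exact ⟨d, List.mem_cons_of_mem _ hd, hs⟩

/-- A dart on the outer side of the planet. -/
theorem dartB_spec {d : ℕ} (h : dartB L d = true) :
    (d % 256 ∈ L ∨ 100 ≤ d % 256 ∧ d % 256 < 122 ∧ d % 256 % 2 = 0 ∧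
      d / 256 = 100 + (d % 256 - 100) / 2) ∧
    (d / 256 = (litEnds (d % 256)).1 ∨ d / 256 = (litEnds (d % 256)).2) := by
  simp only [dartB, force_eq, Bool.and_eq_true, Bool.or_eq_true, testBit_mask, Nat.blt_eq,
    Nat.beq_eq] at h
  exact ⟨h.1.imp_right fun h => ⟨h.1.1.1, h.1.1.2, h.1.2, h.2⟩, h.2.imp Eq.symm Eq.symm⟩

theorem litEnds_snd_lt (hL : Proper L) {e : ℕ} (h : e ∈ L ∨ 100 ≤ e ∧ e < 122 ∧ e % 2 = 0) :
    LitLink L e (litEnds e).1 (litEnds e).2 ∧ ((litEnds e).1 ≠ 99 ∧ (litEnds e).1 < 112) ∧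
      (litEnds e).2 ≠ 99 ∧ (litEnds e).2 < 112 := by
  refine ⟨⟨h.imp_right fun h => by omega, .inl rfl⟩, ?_⟩
  rcases h with h | h
  · rw [show litEnds e = outerEnds e from if_pos (hL.lt h)]
    rcases hL.1 e h with h | h <;> omega
  · rw [show litEnds e = _ from if_neg (by omega), if_pos h.2.2]
    simp only
    omega

/-- On the outer side of a rim vertex only the stretch from the preceding rim edge through the outer
edges to the following rim edge is used. The label `2 * u - 102` of the preceding edge is wrong at
`u = 100`, where the true label depends on `n`; there it gives 98, which is excluded. -/
theorem nextEdge_spec (hn : 12 ≤ n) (hL : Proper L) (h : rotB L c = true) {u e e' : ℕ}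
    (hu : u ≠ 99) (hu' : u < 112) (he : e < 256) (he' : e' ≠ 0) (h98 : e ≠ 98)
    (hs : nextEdge L c u e = e') : gRot n L c u e = e' := by
  have hnd := nodup_rotList hn hL h u
  rw [nextEdge] at hs
  rcases Nat.lt_or_ge u 100 with h1 | h1
  · rw [show Nat.ble 100 u = false by rw [← Bool.not_eq_true, Nat.ble_eq]; omega, cond_false] at hs
    obtain ⟨l₁, l₂, h2⟩ := after_spec he' hs
    have h3 : rotList n L c u = rotAt L c u := by
      rw [rotList, if_neg hu, if_neg (by omega)]
    cases l₁ with
    -- The prefixed label 1000 is not the sought edge, since `e < 256`.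
    | nil => simp only [List.nil_append, List.cons.injEq] at h2; omega
    | cons x l₁ =>
      simp only [List.cons_append, List.cons.injEq] at h2
      exact formPerm_of_append hnd (by rw [h3]; exact h2.2)
  · rw [show Nat.ble 100 u = true by rw [Nat.ble_eq]; omega, cond_true] at hs
    obtain ⟨l₁, l₂, h2⟩ := after_spec he' hs
    have h3 : rotList n L c u = [2 * u - 100, 2 * u - 99] ++
        (100 + 2 * ((u - 100 + n - 1) % n)) :: rotAt L c u := by
      rw [rotList, if_neg hu, if_pos (by omega)]; rfl
    have h4 : rotList n L c u ++ (rotList n L c u).take 1 = [2 * u - 100, 2 * u - 99] ++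
        (100 + 2 * ((u - 100 + n - 1) % n)) :: (rotAt L c u ++ [2 * u - 100]) := by
      rw [h3]; simp
    cases l₁ with
    | nil =>
      simp only [List.nil_append, List.cons.injEq] at h2
      have h5 : 100 + 2 * ((u - 100 + n - 1) % n) = e := by
        rw [← h2.1, show u - 100 + n - 1 = u - 101 + n by omega, Nat.add_mod_right,
          Nat.mod_eq_of_lt (by omega)]
        omega
      refine formPerm_of_append hnd (l₁ := [2 * u - 100, 2 * u - 99]) (l₂ := l₂) ?_
      rw [h4, h2.2, h5]
    | cons x l₁ =>
      simp only [List.cons_append, List.cons.injEq] at h2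
      refine formPerm_of_append hnd (l₁ := [2 * u - 100, 2 * u - 99,
        100 + 2 * ((u - 100 + n - 1) % n)] ++ l₁) (l₂ := l₂) ?_
      rw [h4, h2.2]
      simp

theorem stepB_spec (hn : 12 ≤ n) (hL : Proper L) (h0 : ∀ e ∈ L, e ≠ 0 ∧ e ≠ 98)
    (h : rotB L c = true) {d d' : ℕ} (hd : dartB L d = true)
    (hd' : dartB L d' = true) (hs : stepB L c d d' = true) :
    (gr n L).IsLink (d % 256) (d / 256) (d' / 256) ∧
      gRot n L c (d' / 256) (d % 256) = d' % 256 := by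
  obtain ⟨h1, h2⟩ := dartB_spec hd
  obtain ⟨h1', -⟩ := dartB_spec hd'
  have h3 := litEnds_snd_lt hL (h1.imp_right fun h => ⟨h.1, h.2.1, h.2.2.1⟩)
  simp only [stepB, force_eq, Bool.and_eq_true, Nat.beq_eq] at hs
  have h4 : LitLink L (d % 256) (d / 256) (d' / 256) ∧ d' / 256 ≠ 99 ∧ d' / 256 < 112 := by
    rw [← hs.1]
    unfold otherEnd
    cases h5 : Nat.beq (litEnds (d % 256)).1 (d / 256) with
    | true =>
      rw [cond_true, ← Nat.eq_of_beq_eq_true h5]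
      exact ⟨h3.1, h3.2.2⟩
    | false =>
      rw [cond_false]
      have := Nat.ne_of_beq_eq_false h5
      rw [show d / 256 = (litEnds (d % 256)).2 by omega]
      exact ⟨⟨h3.1.1, .inr rfl⟩, h3.2.1⟩
  refine ⟨h4.1.isLink hn hL, nextEdge_spec hn hL h h4.2.1 h4.2.2 (by omega) ?_ ?_ hs.2⟩
  · rcases h1' with h | h
    · exact (h0 _ h).1
    · omega
  · rcases h1 with h | h
    · exact (h0 _ h).2
    · omega

theorem card_vertexSet_gr (hL : Proper L) :
    n + 1 + (outerVerts L).length ≤ (gr n L).vertexSet.ncard := by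
  classical
  have hlt : ∀ v ∈ outerVerts L, v < 99 := fun v hv => by
    simp only [outerVerts, List.mem_dedup, List.mem_filter, Nat.blt_eq] at hv
    exact hv.2
  have h : ((Finset.Ico 99 (100 + n) ∪ (outerVerts L).toFinset : Finset ℕ) : Set ℕ) ⊆
      (gr n L).vertexSet := by
    intro v hv
    simp only [Finset.coe_union, Finset.coe_Ico, List.coe_toFinset, Set.mem_union, Set.mem_Ico,
      Set.mem_ofPred_eq] at hv
    rcases hv with hv | hv
    · rcases hv.1.eq_or_lt with h | h
      · exact .inl h.symm
      · exact .inr (.inl ⟨h, hv.2⟩)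
    · simp only [outerVerts, List.mem_dedup, List.mem_filter, List.mem_flatMap, List.mem_cons,
        List.not_mem_nil, or_false] at hv
      obtain ⟨⟨e, he, h⟩, -⟩ := hv
      exact .inr (.inr ⟨e, he, by rwa [gEnds_of_lt (hL.lt he)]⟩)
  have hnd : (outerVerts L).Nodup := List.nodup_dedup _
  have := Set.ncard_le_ncard h finite_vertexSet_gr
  rw [Set.ncard_coe_finset, Finset.card_union_of_disjoint, Nat.card_Ico,
    List.card_toFinset, hnd.dedup] at this
  · omega
  · rw [Finset.disjoint_left]
    intro v hv hv'
    have := hlt v (by simpa using hv')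
    rw [Finset.mem_Ico] at hv
    omega

theorem card_edgeSet_gr : (gr n L).edgeSet.ncard ≤ 2 * n + L.length := by
  classical
  have h : (gr n L).edgeSet ⊆ ((L.toFinset ∪ Finset.Ico 100 (100 + 2 * n) : Finset ℕ) : Set ℕ) := by
    intro e he
    simpa [mem_edgeSet_gr] using he
  have := Set.ncard_le_ncard h (Finset.finite_toSet _)
  rw [Set.ncard_coe_finset] at this
  have h1 := Finset.card_union_le L.toFinset (Finset.Ico 100 (100 + 2 * n))
  have h2 := List.toFinset_card_le L
  rw [Nat.card_Ico] at h1
  omega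

/-- There are `n` triangles at the centre, the traced outer faces, and at least one more face, that
of the dart from 111 along the edge 122. Against at most `2 * n` plus `L.length` edges and at least
`n + 1` plus the outer vertices, this meets Euler's bound, and no face has to be shown complete
beyond these. -/
theorem euler_gRot (hn : 12 ≤ n) (hL : Proper L) (h0 : ∀ e ∈ L, e ≠ 0 ∧ e ≠ 98)
    (hG : Connected (gr n L)) (h : planarB L c = true) :
    ((gr n L).vertexSet.ncard : ℤ) - (gr n L).edgeSet.ncard +
      Nat.card (Face (gr n L) (gRot n L c)) = 2 := by
  have hsimple := simple_gr (n := n) (by omega) hL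
  simp only [planarB, Bool.and_eq_true, Nat.ble_eq, nodupB_iff, List.all_eq_true] at h
  obtain ⟨⟨⟨hr, hcard⟩, hnodup⟩, hface⟩ := h
  have hfin : Finite (Face (gr n L) (gRot n L c)) := finite_face finite_vertexSet_gr finite_edgeSet_gr
  refine euler_of_le_card_face finite_vertexSet_gr finite_edgeSet_gr hG
    (fun v hv => isCycleOn_gRot hn hL hr hv) ?_
  have hV := card_vertexSet_gr (n := n) hL
  have hE := card_edgeSet_gr (n := n) (L := L)
  generalize outerFaces L c = F at *
  have hdart : ∀ i : Fin F.length, ∀ d ∈ F[i], dartB L d = true := by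
    intro i d hd
    have := hface F[i] (List.getElem_mem _)
    revert this hd
    generalize F[i] = l
    cases l with
    | nil => simp
    | cons a l =>
      intro hd h
      simp only [faceB, Bool.and_eq_true, List.all_eq_true] at h
      exact h.2 d hd
  have hdart' : ∀ i : Fin F.length, ∀ d ∈ decode F[i], d.1 ≠ 99 ∧ (d.2 < 100 ∨
      d.2 < 122 ∧ d.2 % 2 = 0 ∧ d.1 = 100 + (d.2 - 100) / 2) := by
    rintro i ⟨v, e⟩ ⟨h1, h2⟩
    obtain ⟨h3, h4⟩ := dartB_spec (hdart i _ h2)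
    simp only at h1 h2 h3 h4 ⊢
    rw [show (256 * v + e) / 256 = v by omega, show (256 * v + e) % 256 = e by omega] at h3 h4
    have h5 := litEnds_snd_lt hL (h3.imp_right fun h => ⟨h.1, h.2.1, h.2.2.1⟩)
    refine ⟨by omega, ?_⟩
    rcases h3 with h3 | h3
    · exact .inl (hL.lt h3)
    · exact .inr ⟨by omega, by omega, by omega⟩
  have key := card_add_one_le_card_face (G := gr n L) (rot := gRot n L c) (ι := Fin n ⊕ Fin F.length)
    (Sum.elim (fun k => triangle n k) fun i => decode F[i]) ?_ ?_ ?_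
    ⟨(111, 122), gr_inc.2 ⟨.inr ⟨by omega, by omega⟩, .inl (by simp [gEnds])⟩⟩ ?_
  · rw [Nat.card_sum, Nat.card_fin, Nat.card_fin] at key
    omega
  · have htri : ∀ k : Fin n, ∀ d ∈ triangle n k, d.1 = 99 ∨ d.2 = 101 + 2 * k ∨
        d.2 = 100 + 2 * k ∧ d.1 = 100 + (k + 1) % n := by
      rintro k d (rfl | rfl | rfl)
      · exact .inl rfl
      · exact .inr (.inr ⟨rfl, rfl⟩)
      · exact .inr (.inl rfl)
    have hmod : ∀ k : Fin n, ((k + 1 : ℕ) % n = k + 1 ∧ (k + 1 : ℕ) < n) ∨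
        ((k + 1 : ℕ) % n = 0 ∧ (k + 1 : ℕ) = n) := by
      intro k
      rcases Nat.lt_or_ge (k + 1) n with h | h
      · exact .inl ⟨Nat.mod_eq_of_lt h, h⟩
      · have : (k + 1 : ℕ) = n := by omega
        exact .inr ⟨by rw [this, Nat.mod_self], this⟩
    -- Darts of a triangle start at the centre, use a spoke, or traverse a rim edge backwards,
    -- whereas traced faces avoid the centre and its spokes and traverse rim edges forwards only.
    have hcross : ∀ (k : Fin n) (i : Fin F.length), ∀ d ∈ triangle n k, d ∉ decode F[i] := by
      intro k i d h1 h2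
      have h3 := hdart' i d h2
      have h4 := htri k d h1
      have h5 := hmod k
      omega
    rintro (k | i) (k' | i') d hd hd'
    · have h1 := hmod k
      have h2 := hmod k'
      have : (k : ℕ) = k' := by
        obtain ⟨v, e⟩ := d
        simp only [Sum.elim_inl, triangle, Set.mem_insert_iff, Set.mem_singleton_iff,
          Prod.mk.injEq] at hd hd'
        omega
      exact congrArg _ (Fin.ext this)
    · exact (hcross k i' d hd hd').elim
    · exact (hcross k' i d hd' hd).elim
    · rw [List.nodup_flatten] at hnodup
      by_contra hne
      have hne : (i : ℕ) ≠ i' := fun h => hne (congrArg _ (Fin.ext h))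
      have h2 := List.pairwise_iff_getElem.1 hnodup.2
      rcases lt_or_gt_of_ne hne with h | h
      · exact List.disjoint_left.1 (h2 i i' i.2 i'.2 h) hd.2 hd'.2
      · exact List.disjoint_left.1 (h2 i' i i'.2 i.2 h) hd'.2 hd.2
  · rintro (k | i)
    · exact ⟨⟨(100 + k, 101 + 2 * k), (gr_spoke k.2).inc_right⟩, .inr (.inr rfl)⟩
    · have h1 := hface F[i] (List.getElem_mem _)
      have h2 := hdart i
      simp only [Sum.elim_inr]
      generalize F[i] = l at *
      cases l with
      | nil => simp [faceB] at h1
      | cons a l =>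
        obtain ⟨h3, h4⟩ := dartB_spec (h2 a (by simp))
        have h5 := (litEnds_snd_lt hL (h3.imp_right fun h => ⟨h.1, h.2.1, h.2.2.1⟩)).1.isLink hn hL
        refine ⟨⟨(a / 256, a % 256), ?_⟩, mem_decode (by simp)⟩
        rcases h4 with h4 | h4
        · exact h4 ▸ h5.inc_left
        · exact h4 ▸ h5.inc_right
  · rintro (k | i) d d' hs
    · obtain ⟨h1, h2⟩ := exists_triangle_eq hn hL hr k.2 (fun _ _ h => h)
      exact hs.mem_iff h1 h2
    · simp only [Sum.elim_inr]
      have h1 := hface F[i] (List.getElem_mem _)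
      have h2 := hdart i
      generalize F[i] = l at *
      cases l with
      | nil => simp [faceB] at h1
      | cons a l =>
        simp only [faceB, Bool.and_eq_true] at h1
        obtain ⟨h3, h4⟩ := closedB_spec h1.1
        refine hs.mem_iff ?_ ?_
        · rintro ⟨v, e⟩ ⟨h5, h6⟩
          simp only at h5 h6
          obtain ⟨d', hd', h7⟩ := h3 _ h6
          have h8 := stepB_spec hn hL h0 hr (h2 _ h6) (h2 _ hd') h7
          rw [show (256 * v + e) / 256 = v by omega, show (256 * v + e) % 256 = e by omega] at h8
          exact ⟨_, mem_decode hd', h8⟩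
        · rintro ⟨v, e⟩ ⟨h5, h6⟩
          simp only at h5 h6
          obtain ⟨d', hd', h7⟩ := h4 _ h6
          have h8 := stepB_spec hn hL h0 hr (h2 _ hd') (h2 _ h6) h7
          rw [show (256 * v + e) / 256 = v by omega, show (256 * v + e) % 256 = e by omega] at h8
          exact ⟨_, mem_decode hd', h8⟩
  · rintro (k | i) hd
    · simp only [Sum.elim_inl, triangle, Set.mem_insert_iff, Set.mem_singleton_iff,
        Prod.mk.injEq] at hd
      rcases hd with hd | ⟨h1, h2⟩ | hd
      · omega
      · rw [show (k : ℕ) + 1 = 12 by omega] at h1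
        rcases hn.eq_or_lt with h | h
        · rw [← h] at h1; omega
        · rw [Nat.mod_eq_of_lt h] at h1; omega
      · omega
    · have := (hdart' i _ hd).2
      simp only at this
      omega

/-- The embedding with the choices `c` of the graph with outer edges `L`. -/
def embedding (hn : 12 ≤ n) (hL : Proper L) (h0 : ∀ e ∈ L, e ≠ 0 ∧ e ≠ 98)
    (hG : Connected (gr n L)) (h : planarB L c = true) : Embedding (gr n L) where
  rot := gRot n L c
  isCycleOn _ hv := isCycleOn_gRot hn hL (by
    simp only [planarB, Bool.and_eq_true] at h
    exact h.1.1.1) hv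
  euler := euler_gRot hn hL h0 hG h

end Gadget
end Village

namespace Village

/-! ### Cyclic orders of sublists as first returns -/

section FormPerm

variable {α : Type*} [DecidableEq α]

theorem formPerm_map {β : Type*} [DecidableEq β] {l : List α} {g : α → β} (h : (l.map g).Nodup)
    {x : α} (hx : x ∈ l) : (l.map g).formPerm (g x) = g (l.formPerm x) := by
  have hl : l.Nodup := h.of_map
  obtain ⟨i, hi, rfl⟩ := List.getElem_of_mem hx
  have h1 := List.formPerm_apply_getElem (l.map g) h i (by simpa using hi)
  rw [List.formPerm_apply_getElem l hl i hi]
  simpa using h1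

/-- The cyclic order of a sublist is given by first returns. -/
theorem exists_pow_formPerm_filter {l : List α} (hl : l.Nodup) (p : α → Bool) {e : α} (he : e ∈ l)
    (hp : p e = true) : ∃ k, 0 < k ∧ p ((l.formPerm ^ k) e) = true ∧
      (∀ j, 0 < j → j < k → ¬ p ((l.formPerm ^ j) e) = true) ∧
      (l.formPerm ^ k) e = (l.filter p).formPerm e := by
  obtain ⟨A, B, rfl⟩ := List.append_of_mem he
  have h1 : (A ++ e :: B) ~r (e :: (B ++ A)) := List.isRotated_append
  have h2 : ((A ++ e :: B).filter p) ~r ((e :: (B ++ A)).filter p) := by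
    rw [List.filter_append, ← List.cons_append, List.filter_append]
    exact List.isRotated_append
  rw [List.formPerm_eq_of_isRotated hl h1, List.formPerm_eq_of_isRotated (hl.filter _) h2]
  have hl' : (e :: (B ++ A)).Nodup := h1.nodup_iff.1 hl
  generalize B ++ A = T at hl'
  rw [List.filter_cons_of_pos hp]
  have hget : ∀ k (hk : k < T.length), (List.formPerm (e :: T) ^ (k + 1)) e = T[k] := by
    intro k hk
    rw [List.formPerm_pow_apply_head _ _ hl']
    simp only [List.length_cons, Nat.mod_eq_of_lt (show k + 1 < T.length + 1 by omega),
      List.getElem_cons_succ]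
  cases hT : T.filter p with
  | nil =>
    rw [List.filter_eq_nil_iff] at hT
    have h3 : (List.formPerm (e :: T) ^ (T.length + 1)) e = e := by
      rw [List.formPerm_pow_apply_head _ _ hl']
      simp
    refine ⟨T.length + 1, by omega, by rwa [h3], fun j hj hjT => ?_, by rw [h3]; simp⟩
    obtain ⟨j, rfl⟩ := Nat.exists_eq_add_of_le' hj
    rw [hget j (by omega)]
    exact hT _ (List.getElem_mem _)
  | cons x T' =>
    obtain ⟨T₁, T₂, rfl, h3, h4, -⟩ := List.filter_eq_cons_iff.1 hT
    have h5 : (e :: x :: T').Nodup := by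
      rw [← hT, ← List.filter_cons_of_pos hp]
      exact hl'.filter _
    have h6 := hget T₁.length (by simp)
    rw [List.getElem_append_right le_rfl] at h6
    simp only [Nat.sub_self, List.getElem_cons_zero] at h6
    refine ⟨T₁.length + 1, by omega, by rwa [h6], fun j hj hjT => ?_,
      by rw [h6, List.formPerm_apply_head _ _ _ h5]⟩
    obtain ⟨j, rfl⟩ := Nat.exists_eq_add_of_le' hj
    rw [hget j (by simp; omega), List.getElem_append_left (by omega)]
    exact h3 _ (List.getElem_mem _)

end FormPerm

namespace Gadget

variable {n : ℕ}

/-! ### The steps of the sequence -/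

/-- The strict edges: those of the planet and of the houses. -/
def strict : Set ℕ := {e | e < 40 ∨ 100 ≤ e}

/-- The map that exchanges the vertices of two pieces. -/
def swapV (s t v : ℕ) : ℕ :=
  if v / 10 = 4 + s then 10 * (4 + t) + v % 10
  else if v / 10 = 4 + t then 10 * (4 + s) + v % 10 else v

/-- The map that exchanges the edges of two pieces. -/
def swapE (s t e : ℕ) : ℕ :=
  if e / 20 = 2 + s then 20 * (2 + t) + e % 20
  else if e / 20 = 2 + t then 20 * (2 + s) + e % 20 else e

theorem swapV_swapV (s t v : ℕ) : swapV s t (swapV s t v) = v := by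
  unfold swapV
  split_ifs <;> omega

theorem swapE_swapE (s t e : ℕ) : swapE s t (swapE s t e) = e := by
  unfold swapE
  split_ifs <;> omega

theorem swapV_of_le {s t v : ℕ} (hs : s < 3) (ht : t < 3) (hv : 70 ≤ v) : swapV s t v = v := by
  unfold swapV
  split_ifs <;> omega

theorem swapE_of_strict {s t e : ℕ} (hs : s < 3) (ht : t < 3) (he : e ∈ strict) :
    swapE s t e = e := by
  simp only [strict, Set.mem_ofPred_eq] at he
  unfold swapE
  split_ifs <;> omega

theorem swapE_mem_strict {s t e : ℕ} (hs : s < 3) (ht : t < 3) :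
    swapE s t e ∈ strict ↔ e ∈ strict := by
  simp only [strict, Set.mem_ofPred_eq]
  unfold swapE
  split_ifs <;> omega

/-- Whether the edges of a list become those of another list when two pieces are exchanged. -/
def subgraphB (Lg Lh : List ℕ) (s t : ℕ) : Bool :=
  Nat.blt s 3 && Nat.blt t 3 && Lh.all fun e => (mask Lg).testBit (swapE s t e) &&
    (Nat.beq (outerEnds (swapE s t e)).1 (swapV s t (outerEnds e).1) &&
      Nat.beq (outerEnds (swapE s t e)).2 (swapV s t (outerEnds e).2))

/-- Whether two lists are equal. -/
def eqB : List ℕ → List ℕ → Bool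
  | [], [] => true
  | a :: l, b :: l' => Nat.beq a b && eqB l l'
  | _, _ => false

theorem eqB_iff : ∀ {l l' : List ℕ}, eqB l l' = true ↔ l = l'
  | [], [] => by simp [eqB]
  | [], _ :: _ => by simp [eqB]
  | _ :: _, [] => by simp [eqB]
  | a :: l, b :: l' => by simp [eqB, eqB_iff]

/-- The cyclic order at `v` that is induced on a subgraph, with the new names of its edges. -/
def inducedRot (Lg Lh : List ℕ) (c : Config) (s t v : ℕ) : List ℕ :=
  ((rotAt Lg c v).filter fun e => (mask Lh).testBit (swapE s t e)).map (swapE s t)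

/-- Whether an embedding induces another one on a subgraph. -/
def inducesB (Lg Lh : List ℕ) (cg ch : Config) (s t : ℕ) : Bool :=
  (List.range 12).all (fun k => eqB (inducedRot Lg Lh cg s t (100 + k)) (rotAt Lh ch (100 + k))) &&
    (List.range 99).all fun v => (List.range 7).any fun r =>
      eqB ((inducedRot Lg Lh cg s t v).rotate r) (rotAt Lh ch (swapV s t v))

/-- Whether the step from the `k`-th graph to the next one adds edges. -/
def isUp (k : ℕ) : Bool := match k with
  | 1 | 3 | 5 | 7 | 9 => false
  | _ => true

/-- The number of the smaller one of the `k`-th and the next graph. -/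
def small (k : ℕ) : ℕ := bif isUp k then k else k + 1

/-- The number of the larger one of the `k`-th and the next graph. -/
def large (k : ℕ) : ℕ := bif isUp k then k + 1 else k

/-- The pieces to be exchanged between the `k`-th and the next graph. -/
def slots (k : ℕ) (a b c : Bool) : ℕ × ℕ := match k with
  | 1 => (0, bif a then 0 else 1)
  | 3 => (0, bif b then 1 else 0)
  | 5 => (1, bif c then 1 else 2)
  | 7 => (0, bif c then 1 else 0)
  | _ => (0, 0)

/-- The exchange of two pieces expresses the free choice of the copy that is kept. -/
theorem subgraphB_outer : ∀ k < 10, ∀ a b c : Bool, (a || b || c) = true →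
    subgraphB (outer (large k)) (outer (small k)) (slots k a b c).1 (slots k a b c).2 = true := by
  decide +kernel

/-- The rotations match because of the choice in `slots`: when house 0 or house 2 has been read, the
piece lying outside of the house is kept, and in a disjunction the newly compared piece is kept if
its value is true, and piece 0 otherwise. -/
theorem inducesB_outer : ∀ k < 10, ∀ a b c : Bool, (a || b || c) = true →
    inducesB (outer (large k)) (outer (small k)) (config (large k) a b c) (config (small k) a b c)
      (slots k a b c).1 (slots k a b c).2 = true := by
  decide +kernel

end Gadget
end Village

/-! ### Verification that explicit rotations induce each other -/

namespace Village

/-- Both sides of the required equivalence determine `e'` from `e`, the second because `g` is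
injective on the edges, so agreement on one successor of each edge suffices. -/
theorem weaklyInduces_of_exists {α β : Type*} {A : Set β} {G G' H : Graph α β} {φ : Embedding G}
    {ψ : Embedding H} (hG' : G' ≤ G) {f : α → α} {g : β → β} (hfg : IsFixingIso A f g G' H)
    (h : ∀ v e, G'.Inc e v → ∃ e', InducedNext φ G' v e e' ∧ ψ.rot (f v) (g e) = g e') :
    WeaklyInduces A φ ψ := by
  refine ⟨G', hG', f, g, hfg, fun v e e' he he' => ?_⟩
  obtain ⟨x, ⟨k, hk, rfl, hkx, hkj⟩, hx⟩ := h v e he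
  constructor
  · rintro ⟨j, hj, rfl, hjx, hjj⟩
    have : j = k := by
      rcases lt_trichotomy j k with h | h | h
      · exact absurd hjx (hkj j hj h)
      · exact h
      · exact absurd hkx (hjj k hk h)
    rw [hx, this]
  · intro h
    have : (φ.rot v ^ k) e = e' :=
      hfg.bijOn_edgeSet.injOn hkx.edge_mem he'.edge_mem (hx.symm.trans h)
    exact this ▸ ⟨k, hk, rfl, hkx, hkj⟩

/-- Counting edges decides the direction of a step, on which the conditions of a simultaneous
embedding branch. -/
theorem HybridSubgraph.ncard_le {α β : Type*} {A : Set β} {H G : Graph α β}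
    (h : HybridSubgraph A H G) (hG : G.edgeSet.Finite) : H.edgeSet.ncard ≤ G.edgeSet.ncard := by
  obtain ⟨G', hle, f, g, hfg⟩ := h
  rw [← hfg.bijOn_edgeSet.image_eq, hfg.bijOn_edgeSet.injOn.ncard_image]
  exact Set.ncard_le_ncard hle.edgeSet_mono hG

theorem weaklyInduces_of_rot_eq {α β : Type*} {A : Set β} {G : Graph α β} {φ ψ : Embedding G}
    (h : φ.rot = ψ.rot) : WeaklyInduces A φ ψ := by
  refine weaklyInduces_of_exists le_rfl (f := id) (g := id)
    ⟨⟨Set.bijOn_id _, Set.bijOn_id _, fun _ _ _ h => h⟩, fun _ _ _ => rfl⟩ fun v e he => ?_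
  refine ⟨φ.rot v e, ⟨1, one_pos, by simp, ?_, fun j hj hj1 => by omega⟩, by rw [h]; rfl⟩
  exact (φ.isCycleOn v he.vertex_mem).1.mapsTo he

namespace Gadget

variable {n : ℕ} {Lg Lh : List ℕ} {s t : ℕ}

theorem mem_map_swapE {e : ℕ} : e ∈ Lh.map (swapE s t) ↔ swapE s t e ∈ Lh := by
  rw [List.mem_map]
  constructor
  · rintro ⟨x, hx, rfl⟩
    rwa [swapE_swapE]
  · intro h
    exact ⟨_, h, swapE_swapE _ _ _⟩

theorem subgraphB_spec (h : subgraphB Lg Lh s t = true) : s < 3 ∧ t < 3 ∧ ∀ e ∈ Lh,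
    swapE s t e ∈ Lg ∧ (outerEnds (swapE s t e)).1 = swapV s t (outerEnds e).1 ∧
      (outerEnds (swapE s t e)).2 = swapV s t (outerEnds e).2 := by
  simpa [subgraphB, Nat.blt_eq, List.all_eq_true, testBit_mask, and_assoc] using h

/-- The exchange is an involution that moves only vertices and edges of pieces, hence no strict
edge; the subgraph is the image of the smaller graph under it. -/
theorem isFixingIso_swap (hg : Proper Lg) (hh : Proper Lh)
    (h : subgraphB Lg Lh s t = true) : gr n (Lh.map (swapE s t)) ≤ gr n Lg ∧
    IsFixingIso strict (swapV s t) (swapE s t) (gr n (Lh.map (swapE s t))) (gr n Lh) := by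
  obtain ⟨hs, ht, hL⟩ := subgraphB_spec h
  have hsub : ∀ e ∈ Lh.map (swapE s t), e ∈ Lg := by
    intro e he
    obtain ⟨x, hx, rfl⟩ := List.mem_map.1 he
    exact (hL x hx).1
  have hpl : ∀ {e}, 100 ≤ e → swapE s t e = e := fun he => swapE_of_strict hs ht (.inr he)
  have hplV : ∀ {v}, 70 ≤ v → swapV s t v = v := fun hv => swapV_of_le hs ht hv
  have hends : ∀ e ∈ Lh.map (swapE s t), gEnds n (swapE s t e) =
      (swapV s t (gEnds n e).1, swapV s t (gEnds n e).2) := by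
    intro e he
    obtain ⟨x, hx, rfl⟩ := List.mem_map.1 he
    rw [swapE_swapE, gEnds_of_lt (hh.lt hx), gEnds_of_lt (hg.lt (hL x hx).1), (hL x hx).2.1,
      (hL x hx).2.2, swapV_swapV, swapV_swapV]
  have hlink : ∀ ⦃e x y⦄, (gr n (Lh.map (swapE s t))).IsLink e x y →
      (gr n Lh).IsLink (swapE s t e) (swapV s t x) (swapV s t y) := by
    rintro e x y ⟨he, hxy⟩
    rcases he with he | he
    · refine ⟨.inl (mem_map_swapE.1 he), ?_⟩
      rw [hends e he]
      rw [Sym2.eq_iff] at hxy ⊢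
      rcases hxy with ⟨rfl, rfl⟩ | ⟨rfl, rfl⟩
      · exact .inl ⟨rfl, rfl⟩
      · exact .inr ⟨rfl, rfl⟩
    · have h70 : 70 ≤ (gEnds n e).1 ∧ 70 ≤ (gEnds n e).2 := by
        rw [gEnds, if_neg (by omega)]
        split_ifs <;> exact ⟨by simp only; omega, by simp only; omega⟩
      rw [hpl he.1]
      refine ⟨.inr he, ?_⟩
      rw [Sym2.eq_iff] at hxy ⊢
      rcases hxy with ⟨rfl, rfl⟩ | ⟨rfl, rfl⟩
      · exact .inl ⟨hplV h70.1, hplV h70.2⟩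
      · exact .inr ⟨hplV h70.2, hplV h70.1⟩
  refine ⟨gr_mono hsub, ⟨⟨⟨?_, ?_, ?_⟩, ⟨?_, ?_, ?_⟩, hlink⟩, ?_⟩⟩
  · rintro v (rfl | hv | ⟨e, he, hv⟩)
    · exact .inl (hplV (by omega))
    · rw [hplV (by omega)]
      exact .inr (.inl hv)
    · have := hlink (gr_link (.inl he))
      rcases hv with rfl | rfl
      · exact this.left_mem
      · exact this.right_mem
  · intro x _ y _ hxy
    rw [← swapV_swapV s t x, hxy, swapV_swapV]
  · rintro v (rfl | hv | ⟨e, he, hv⟩)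
    · exact ⟨99, .inl rfl, hplV (by omega)⟩
    · exact ⟨v, .inr (.inl hv), hplV (by omega)⟩
    · have h1 := hends (swapE s t e) (mem_map_swapE.2 (by rwa [swapE_swapE]))
      rw [swapE_swapE] at h1
      rw [h1] at hv
      have h2 : swapE s t e ∈ Lh.map (swapE s t) := mem_map_swapE.2 (by rwa [swapE_swapE])
      rcases hv with rfl | rfl
      · exact ⟨_, (gr_link (.inl h2)).left_mem, rfl⟩
      · exact ⟨_, (gr_link (.inl h2)).right_mem, rfl⟩
  · rintro e (he | he)
    · exact .inl (mem_map_swapE.1 he)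
    · rw [hpl he.1]
      exact .inr he
  · intro x _ y _ hxy
    rw [← swapE_swapE s t x, hxy, swapE_swapE]
  · rintro e (he | he)
    · exact ⟨swapE s t e, .inl (mem_map_swapE.2 (by rwa [swapE_swapE])), swapE_swapE _ _ _⟩
    · exact ⟨e, .inr he, hpl he.1⟩
  · rintro e - (he | he)
    · exact swapE_of_strict hs ht he
    · exact swapE_of_strict hs ht ((swapE_mem_strict hs ht).1 he)

theorem rotAt_eq_nil {L : List ℕ} {c : Config} {v : ℕ} (hv : 112 ≤ v) : rotAt L c v = [] := by
  rw [rotAt, outerRot_eq_nil hv]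
  rfl

/-- At the rim the outer orders agree as lists, since the edges of the planet are put in front of
them; at the vertices of houses and pieces agreement up to rotation is enough. -/
theorem isRotated_of_inducesB (hg : Proper Lg) {cg ch : Config}
    (hs : s < 3) (ht : t < 3) (h : inducesB Lg Lh cg ch s t = true) (v : ℕ) :
    (((rotList n Lg cg v).filter fun e => decide (e ∈ Lh.map (swapE s t) ∨ 100 ≤ e)).map
      (swapE s t)) ~r rotList n Lh ch (swapV s t v) := by
  have hpl : ∀ {e}, 100 ≤ e → swapE s t e = e := fun he => swapE_of_strict hs ht (.inr he)
  have hplV : ∀ {v}, 70 ≤ v → swapV s t v = v := fun hv => swapV_of_le hs ht hv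
  have h1 : (((rotAt Lg cg v).filter fun e => decide (e ∈ Lh.map (swapE s t) ∨ 100 ≤ e)).map
      (swapE s t)) = inducedRot Lg Lh cg s t v := by
    unfold inducedRot
    congr 1
    refine List.filter_congr fun e he => ?_
    have := hg.lt (mem_rotAt.1 he).2.1
    rw [Bool.eq_iff_iff, decide_eq_true_eq, testBit_mask, mem_map_swapE]
    exact or_iff_left (by omega)
  simp only [inducesB, Bool.and_eq_true, List.all_eq_true, List.any_eq_true, List.mem_range,
    eqB_iff] at h
  have h112 : 112 ≤ v → inducedRot Lg Lh cg s t v = rotAt Lh ch v := fun hv => by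
    rw [inducedRot, rotAt_eq_nil hv, rotAt_eq_nil hv]
    rfl
  rcases Nat.lt_trichotomy v 99 with hv | rfl | hv
  · have hv' : swapV s t v < 99 := by
      unfold swapV
      split_ifs <;> omega
    obtain ⟨r, -, hr⟩ := h.2 v hv
    rw [rotList, if_neg (by omega), if_neg (by omega), h1, rotList, if_neg (by omega),
      if_neg (by omega), ← hr]
    exact ⟨r, rfl⟩
  · rw [hplV (by omega), rotList, if_pos rfl, rotList, if_pos rfl, List.filter_eq_self.2]
    · have : List.map (swapE s t) (List.map (fun k => 101 + 2 * k) (List.range n)) =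
          List.map (fun k => 101 + 2 * k) (List.range n) := by
        rw [List.map_map]
        exact List.map_congr_left fun k _ => hpl (show 100 ≤ 101 + 2 * k by omega)
      rw [this]
    · intro e he
      obtain ⟨k, -, rfl⟩ := List.mem_map.1 he
      exact decide_eq_true (.inr (by omega))
  · have h2 : inducedRot Lg Lh cg s t v = rotAt Lh ch v := by
      rcases Nat.lt_or_ge v 112 with h3 | h3
      · have := h.1 (v - 100) (by omega)
        rwa [show 100 + (v - 100) = v by omega] at this
      · exact h112 h3
    rw [hplV (by omega)]
    unfold rotList
    simp only [if_neg (show ¬ v = 99 by omega)]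
    split_ifs with h3
    · have h4 : ∀ {x l}, 100 ≤ x → (List.filter (fun e => decide (e ∈ Lh.map (swapE s t) ∨ 100 ≤ e))
          (x :: l)).map (swapE s t) = x :: (List.filter (fun e =>
            decide (e ∈ Lh.map (swapE s t) ∨ 100 ≤ e)) l).map (swapE s t) := by
        intro x l hx
        rw [List.filter_cons_of_pos (by simpa using .inr hx), List.map_cons, hpl hx]
      rw [h4 (by omega), h4 (by omega), h4 (by omega), h1, h2]
    · rw [h1, h2]

theorem weaklyInduces_of_inducesB (hn : 12 ≤ n) (hg : Proper Lg) (hh : Proper Lh)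
    {cg ch : Config} (hrg : rotB Lg cg = true) (hsub : subgraphB Lg Lh s t = true)
    (h : inducesB Lg Lh cg ch s t = true) {φ : Embedding (gr n Lg)} {ψ : Embedding (gr n Lh)}
    (hφ : φ.rot = gRot n Lg cg) (hψ : ψ.rot = gRot n Lh ch) : WeaklyInduces strict φ ψ := by
  obtain ⟨hle, hfg⟩ := isFixingIso_swap (n := n) hg hh hsub
  obtain ⟨hs, ht, -⟩ := subgraphB_spec hsub
  refine weaklyInduces_of_exists hle hfg fun v e he => ?_
  have he' : e ∈ rotList n Lg cg v :=
    (mem_rotList hg hrg (hle.vertexSet_mono he.vertex_mem)).2 (he.mono hle)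
  have hnd := nodup_rotList hn hg hrg v
  have hdec : ∀ x, (decide (x ∈ Lh.map (swapE s t) ∨ 100 ≤ x) = true) ↔
      x ∈ Lh.map (swapE s t) ∨ 100 ≤ x := fun x => decide_eq_true_iff
  have hinc : ∀ x, (gr n Lg).Inc x v → ((gr n (Lh.map (swapE s t))).Inc x v ↔
      x ∈ Lh.map (swapE s t) ∨ 100 ≤ x) := by
    intro x hx
    rw [gr_inc] at hx ⊢
    constructor
    · rintro ⟨h | h, -⟩
      · exact .inl h
      · exact .inr h.1
    · intro h
      refine ⟨h.imp_right fun h => ⟨h, ?_⟩, hx.2⟩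
      rcases hx.1 with h' | h'
      · have := hg.lt h'
        omega
      · exact h'.2
  have hpow : ∀ k, (gr n Lg).Inc ((φ.rot v ^ k) e) v := fun k =>
    ((φ.isCycleOn v (hle.vertexSet_mono he.vertex_mem)).1.perm_pow k).mapsTo (he.mono hle)
  obtain ⟨k, hk, h1, h2, h3⟩ := exists_pow_formPerm_filter hnd
    (fun x => decide (x ∈ Lh.map (swapE s t) ∨ 100 ≤ x)) he'
    ((hdec _).2 ((hinc e (he.mono hle)).1 he))
  have hrot : (rotList n Lg cg v).formPerm = φ.rot v := by rw [hφ]; rfl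
  rw [hrot] at h1 h2 h3
  refine ⟨_, ⟨k, hk, rfl, (hinc _ (hpow k)).2 ((hdec _).1 h1), fun j hj hjk hjx =>
    h2 j hj hjk ((hdec _).2 ((hinc _ (hpow j)).1 hjx))⟩, ?_⟩
  have hR := isRotated_of_inducesB (n := n) hg hs ht h v
  have hnd' : ((((rotList n Lg cg v).filter fun e =>
      decide (e ∈ Lh.map (swapE s t) ∨ 100 ≤ e)).map (swapE s t))).Nodup :=
    (hnd.filter _).map fun x y hxy => by rw [← swapE_swapE s t x, hxy, swapE_swapE]
  rw [hψ, gRot, ← List.formPerm_eq_of_isRotated hnd' hR, formPerm_map hnd', h3]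
  exact List.mem_filter.2 ⟨he', (hdec _).2 ((hinc e (he.mono hle)).1 he)⟩

/-! ### The sequence -/

theorem edges_ne (k : ℕ) : ∀ e ∈ outer k, e ≠ 0 ∧ e ≠ 98 :=
  forall_outer (P := fun L => ∀ e ∈ L, e ≠ 0 ∧ e ≠ 98) (by decide +kernel) k

theorem nodup_outer (k : ℕ) : (outer k).Nodup :=
  forall_outer (P := List.Nodup) (by decide +kernel) k

theorem ncard_edgeSet_gr {L : List ℕ} (hL : Proper L) (hnd : L.Nodup) :
    (gr n L).edgeSet.ncard = 2 * n + L.length := by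
  have h : (gr n L).edgeSet = ((L.toFinset ∪ Finset.Ico 100 (100 + 2 * n) : Finset ℕ) : Set ℕ) := by
    ext e
    simp [mem_edgeSet_gr]
  rw [h, Set.ncard_coe_finset, Finset.card_union_of_disjoint, Nat.card_Ico,
    List.toFinset_card_of_nodup hnd]
  · omega
  · rw [Finset.disjoint_left]
    intro e he he'
    have := hL.lt (List.mem_toFinset.1 he)
    rw [Finset.mem_Ico] at he'
    omega

theorem hybridSubgraph_small_large {k : ℕ} (hk : k < 10) :
    HybridSubgraph strict (gr n (outer (small k))) (gr n (outer (large k))) := by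
  obtain ⟨h1, h2⟩ := isFixingIso_swap (n := n) (proper_outer _) (proper_outer _)
    (subgraphB_outer k hk true true true rfl)
  exact ⟨_, h1, _, _, h2⟩

theorem not_hybridSubgraph {k : ℕ} (hk : k < 10) (h : isUp k = false) :
    ¬ HybridSubgraph strict (gr n (outer k)) (gr n (outer (k + 1))) := by
  intro h1
  have h2 := h1.ncard_le finite_edgeSet_gr
  rw [ncard_edgeSet_gr (proper_outer _) (nodup_outer _),
    ncard_edgeSet_gr (proper_outer _) (nodup_outer _)] at h2
  have : ∀ k < 10, isUp k = false → (outer (k + 1)).length < (outer k).length := by decide +kernel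
  have := this k hk h
  omega

/-- The hybrid deletion sequence, on a planet with rim of length `n`. -/
def sequence (hn : 12 ≤ n) : HybridDeletionSequence ℕ ℕ where
  -- Ten genuine steps, after which the village is repeated to reach fifteen graphs.
  steps := 14
  graph k := gr n (outer (min k 10))
  strict := strict
  vertexSet_finite _ := finite_vertexSet_gr
  edgeSet_finite _ := finite_edgeSet_gr
  simple _ := simple_gr (by omega) (proper_outer _)
  twoConnected _ := twoConnected_gr hn _
  hybrid := by
    intro k
    rcases Nat.lt_or_ge k 10 with hk | hk
    · have h := hybridSubgraph_small_large (n := n) hk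
      simp only [Fin.val_castSucc, Fin.val_succ, min_eq_left hk.le, min_eq_left (Nat.succ_le_of_lt hk)]
      cases hu : isUp k with
      | true =>
        rw [small, large, hu, cond_true, cond_true] at h
        exact .inl h
      | false =>
        rw [small, large, hu, cond_false, cond_false] at h
        exact .inr h
    · simp only [Fin.val_castSucc, Fin.val_succ, min_eq_right hk,
        min_eq_right (show 10 ≤ (k : ℕ) + 1 by omega)]
      exact .inl ⟨_, le_rfl, id, id, ⟨Set.bijOn_id _, Set.bijOn_id _, fun _ _ _ h => h⟩,
        fun _ _ _ => rfl⟩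

/-- The constructive half of the allocation set: the embeddings of `config` fit together for every
triple with a true entry. -/
theorem exists_simultaneousEmbedding (hn : 12 ≤ n) {a b c : Bool} (h : (a || b || c) = true) :
    ∃ σ : SimultaneousEmbedding (sequence hn), ∀ k, (σ.emb k).rot =
      gRot n (outer (min k 10)) (config (min k 10) a b c) := by
  have hpl : ∀ k < 11, planarB (outer k) (config k a b c) = true := fun k hk =>
    planarB_outer k hk a b c (by rw [h, Bool.true_or])
  have hr : ∀ k < 11, rotB (outer k) (config k a b c) = true := fun k hk => by
    have := hpl k hk
    simp only [planarB, Bool.and_eq_true] at this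
    exact this.1.1.1
  let emb : ∀ k : Fin 15, Embedding (gr n (outer (min k 10))) := fun k =>
    embedding hn (proper_outer _) (edges_ne _) (twoConnected_gr hn _).2.1
      (hpl (min k 10) (by omega))
  have hstep : ∀ k < 10, ∀ g h', g = large k → h' = small k → ∀ {φ : Embedding (gr n (outer g))}
      {ψ : Embedding (gr n (outer h'))}, φ.rot = gRot n (outer g) (config g a b c) →
      ψ.rot = gRot n (outer h') (config h' a b c) → WeaklyInduces strict φ ψ := by
    rintro k hk g h' rfl rfl φ ψ hφ hψ
    exact weaklyInduces_of_inducesB hn (proper_outer _) (proper_outer _)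
      (hr _ (by unfold large; cases isUp k <;> simp <;> omega)) (subgraphB_outer k hk a b c h)
      (inducesB_outer k hk a b c h) hφ hψ
  have hstep' : ∀ g h', g = h' → ∀ {φ : Embedding (gr n (outer g))}
      {ψ : Embedding (gr n (outer h'))}, φ.rot = gRot n (outer g) (config g a b c) →
      ψ.rot = gRot n (outer h') (config h' a b c) → WeaklyInduces strict φ ψ := by
    rintro g h' rfl φ ψ hφ hψ
    exact weaklyInduces_of_rot_eq (hφ.trans hψ.symm)
  have hmin : ∀ k < 10, min k 10 = k ∧ min (k + 1) 10 = k + 1 := fun k hk => by omega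
  refine ⟨⟨emb, fun k h1 => ?_, fun k h1 => ?_⟩, fun k => rfl⟩
  · rcases Nat.lt_or_ge k 10 with hk | hk
    · obtain ⟨h2, h3⟩ := hmin k hk
      cases hu : isUp k with
      | false =>
        have h4 : HybridSubgraph strict (gr n (outer (min k 10))) (gr n (outer (min (k + 1) 10))) :=
          h1
        rw [h2, h3] at h4
        exact absurd h4 (not_hybridSubgraph hk hu)
      | true =>
        exact hstep k hk (min (k + 1) 10) (min k 10) (by rw [h3, large, hu]; rfl)
          (by rw [h2, small, hu]; rfl) (φ := emb k.succ) (ψ := emb k.castSucc) rfl rfl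
    · exact hstep' (min (k + 1) 10) (min k 10) (by omega) (φ := emb k.succ) (ψ := emb k.castSucc)
        rfl rfl
  · have h4 : ¬ HybridSubgraph strict (gr n (outer (min k 10))) (gr n (outer (min (k + 1) 10))) :=
      h1
    rcases Nat.lt_or_ge k 10 with hk | hk
    · obtain ⟨h2, h3⟩ := hmin k hk
      cases hu : isUp k with
      | false =>
        exact hstep k hk (min k 10) (min (k + 1) 10) (by rw [h2, large, hu]; rfl)
          (by rw [h3, small, hu]; rfl) (φ := emb k.castSucc) (ψ := emb k.succ) rfl rfl
      | true =>
        have h5 := hybridSubgraph_small_large (n := n) hk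
        rw [small, large, hu, cond_true, cond_true] at h5
        rw [h2, h3] at h4
        exact absurd h5 h4
    · exact hstep' (min k 10) (min (k + 1) 10) (by omega) (φ := emb k.castSucc) (ψ := emb k.succ)
        rfl rfl

end Gadget
end Village

namespace Village

/-! ### What every induced embedding preserves -/

section Transport

variable {α β : Type*} {G H : Graph α β} {A : Set β}

/-- The maps `f` and `g` identify `H`, with its embedding `ψ`, with a subgraph of `G`, with the
embedding induced by `φ`, and fix the strict edges `A`. -/
structure IsTransport (A : Set β) (φ : Embedding G) (ψ : Embedding H) (f : α → α) (g : β → β) :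
    Prop where
  link : ∀ ⦃e x y⦄, H.IsLink e x y → G.IsLink (g e) (f x) (f y)
  injOn_vertexSet : Set.InjOn f H.vertexSet
  injOn_edgeSet : Set.InjOn g H.edgeSet
  fixes : ∀ e ∈ H.edgeSet, e ∈ A ∨ g e ∈ A → g e = e
  between : ∀ ⦃v a b c⦄, H.Inc a v → H.Inc b v → H.Inc c v →
    (Between (ψ.rot v) a b c ↔ Between (φ.rot (f v)) (g a) (g b) (g c))

theorem IsTransport.inc {φ : Embedding G} {ψ : Embedding H} {f : α → α} {g : β → β}
    (h : IsTransport A φ ψ f g) {e : β} {v : α} (he : H.Inc e v) : G.Inc (g e) (f v) := by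
  obtain ⟨u, hu⟩ := he
  exact (h.link hu).inc_left

/-- The maps invert the given isomorphism from a subgraph of `G`. Betweenness passes to the induced
rotation; it also passes back, because of the two cyclic orders of three distinct edges exactly one
holds. -/
theorem WeaklyInduces.exists_isTransport [Nonempty α] [Nonempty β] {φ : Embedding G} {ψ : Embedding H}
    (h : WeaklyInduces A φ ψ) (hG : G.edgeSet.Finite) :
    ∃ f g, IsTransport A φ ψ f g := by
  obtain ⟨G', hle, f, g, hfg, hrot⟩ := h
  have key : ∀ v a b c, G'.Inc a v → G'.Inc b v → G'.Inc c v →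
      (Between (φ.rot v) a b c ↔ Between (ψ.rot (f v)) (g a) (g b) (g c)) := by
    have h1 : ∀ v a b c, G'.Inc a v → G'.Inc b v → G'.Inc c v → Between (φ.rot v) a b c →
        Between (ψ.rot (f v)) (g a) (g b) (g c) := by
      intro v a b c ha hb hc h
      refine h.induced (S' := {e | G'.Inc e v}) (fun x hx y hy hxy =>
        hfg.bijOn_edgeSet.injOn hx.edge_mem hy.edge_mem hxy) (fun x hx y hy hxy => ?_) ha hb hc
      obtain ⟨k, hk, hky, hkj⟩ := hxy
      exact (hrot v x y hx hy).1 ⟨k, hk, hky, hy, hkj⟩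
    intro v a b c ha hb hc
    refine ⟨h1 v a b c ha hb hc, fun h => ?_⟩
    obtain ⟨hab, hac, hbc⟩ := h.ne
    by_contra hn
    rw [not_between_iff (φ.isCycleOn v (hle.vertexSet_mono ha.vertex_mem))
      (hG.subset (G.incidenceSet_subset_edgeSet _)) (ha.mono hle) (hb.mono hle) (hc.mono hle)
      (fun h => hab (by rw [h])) (fun h => hac (by rw [h])) (fun h => hbc (by rw [h]))] at hn
    exact h.asymm (h1 v a c b ha hc hb hn)
  have hf : ∀ y ∈ H.vertexSet, ∃ x ∈ G'.vertexSet, f x = y := fun y hy =>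
    hfg.bijOn_vertexSet.surjOn hy
  have hg : ∀ y ∈ H.edgeSet, ∃ x ∈ G'.edgeSet, g x = y := fun y hy => hfg.bijOn_edgeSet.surjOn hy
  choose! f' hfV hf' using hf
  choose! g' hgE hg' using hg
  have hlink : ∀ ⦃e x y⦄, H.IsLink e x y → G'.IsLink (g' e) (f' x) (f' y) := by
    intro e x y hl
    obtain ⟨u, w, huw⟩ := G'.exists_isLink_of_mem_edgeSet (hgE e hl.edge_mem)
    have h1 := hfg.isLink huw
    rw [hg' e hl.edge_mem] at h1
    have hinj : ∀ {u x}, u ∈ G'.vertexSet → x ∈ H.vertexSet → x = f u → f' x = u := by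
      rintro u x hu hx rfl
      exact hfg.bijOn_vertexSet.injOn (hfV _ hx) hu (hf' _ hx)
    rcases hl.eq_and_eq_or_eq_and_eq h1 with ⟨h2, h3⟩ | ⟨h2, h3⟩
    · rw [hinj huw.left_mem hl.left_mem h2, hinj huw.right_mem hl.right_mem h3]
      exact huw
    · rw [hinj huw.right_mem hl.left_mem h2, hinj huw.left_mem hl.right_mem h3]
      exact huw.symm
  have hinc : ∀ {e v}, H.Inc e v → G'.Inc (g' e) (f' v) := by
    rintro e v ⟨u, hu⟩
    exact (hlink hu).inc_left
  refine ⟨f', g', ⟨fun e x y hl => (hlink hl).mono hle, ?_, ?_, ?_, ?_⟩⟩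
  · intro x hx y hy hxy
    rw [← hf' x hx, ← hf' y hy, hxy]
  · intro x hx y hy hxy
    rw [← hg' x hx, ← hg' y hy, hxy]
  · intro e he hA
    have := hfg.fixes (g' e) (hgE e he) (by rw [hg' e he]; exact hA.symm)
    rw [hg' e he] at this
    exact this.symm
  · intro v a b c ha hb hc
    rw [key _ _ _ _ (hinc ha) (hinc hb) (hinc hc), hf' _ ha.vertex_mem, hg' _ ha.edge_mem,
      hg' _ hb.edge_mem, hg' _ hc.edge_mem]

/-- A vertex with two strict edges is fixed. -/
theorem IsTransport.vertex_eq [H.Simple] [G.Simple] {φ : Embedding G} {ψ : Embedding H} {f : α → α}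
    {g : β → β} (h : IsTransport A φ ψ f g) {v : α} {e e' : β} (hle : ∀ e x y, e ∈ A →
      H.IsLink e x y → G.IsLink e x y) (he : H.Inc e v) (he' : H.Inc e' v)
    (hA : e ∈ A) (hA' : e' ∈ A) (hne : e ≠ e') : f v = v := by
  have key : ∀ {e}, H.Inc e v → e ∈ A → G.Inc e v ∧ G.Inc e (f v) := by
    intro e he hA
    have h1 := h.inc he
    rw [h.fixes e he.edge_mem (.inl hA)] at h1
    obtain ⟨u, hu⟩ := he
    exact ⟨(hle e v u hA hu).inc_left, h1⟩
  obtain ⟨h1, h2⟩ := key he hA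
  obtain ⟨h3, h4⟩ := key he' hA'
  -- Otherwise both edges would join `v` to `f v`, against simplicity.
  by_contra hfv
  have hlink : ∀ {e}, G.Inc e v → G.Inc e (f v) → G.IsLink e v (f v) := by
    rintro e ⟨u, hu⟩ h2
    rcases h2.eq_or_eq_of_isLink hu with h | h
    · exact absurd h hfv
    · rwa [h]
  exact hne (Graph.Simple.eq_of_isLink (hlink h1 h2) (hlink h3 h4))

end Transport

namespace Gadget

variable {n : ℕ} {L : List ℕ}

/-! ### Cycles in the graphs -/

/-- The vertices `vs` and the edges `es` form a cycle of the graph with outer edges `L`. -/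
def CycleOK (L vs es : List ℕ) : Prop :=
  2 ≤ vs.length ∧ es.length = vs.length ∧ vs.Nodup ∧ es.Nodup ∧ ∀ i < vs.length,
    LitLink L (es.getD i 0) (vs.getD i 0) (vs.getD ((i + 1) % vs.length) 0)

instance {L vs es : List ℕ} : Decidable (CycleOK L vs es) := by unfold CycleOK; infer_instance

/-- The edges and vertices in a list form a walk from a vertex that avoids the cycle with vertices
`vs` and edges `es`, except in its ends. -/
def WalkOK (L vs es : List ℕ) : ℕ → List (ℕ × ℕ) → Prop
  | _, [] => True
  | x, (e, y) :: l => LitLink L e x y ∧ (l.isEmpty = true ∨ y ∉ vs) ∧ e ∉ es ∧ WalkOK L vs es y l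

instance decidableWalkOK (L vs es : List ℕ) : ∀ (x : ℕ) (l : List (ℕ × ℕ)), Decidable (WalkOK L vs es x l)
  | _, [] => isTrue trivial
  | x, (e, y) :: l => by
    have := decidableWalkOK L vs es y l
    unfold WalkOK
    infer_instance

/-- The periodic sequence given by a list. -/
def cyc (l : List ℕ) (i : ℕ) : ℕ := l.getD (i % l.length) 0

theorem cyc_mem {l : List ℕ} (h : 0 < l.length) (i : ℕ) : cyc l i ∈ l := by
  have := Nat.mod_lt i h
  rw [cyc, List.getD_eq_getElem _ _ this]
  exact List.getElem_mem _

theorem cyc_eq_iff {l : List ℕ} (h : 0 < l.length) (hl : l.Nodup) (i j : ℕ) :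
    cyc l i = cyc l j ↔ i % l.length = j % l.length := by
  rw [cyc, cyc, List.getD_eq_getElem _ _ (Nat.mod_lt i h), List.getD_eq_getElem _ _ (Nat.mod_lt j h)]
  exact hl.getElem_inj_iff

theorem CycleOK.isCycleWalk (hn : 12 ≤ n) (hL : Proper L) {vs es : List ℕ} (h : CycleOK L vs es) :
    IsCycleWalk (gr n L) (cyc vs) (cyc es) vs.length := by
  obtain ⟨h1, h2, h3, h4, h5⟩ := h
  refine ⟨h1, fun i => ?_, cyc_eq_iff (by omega) h3, fun i j => ?_⟩
  · have := (h5 (i % vs.length) (Nat.mod_lt i (by omega))).isLink hn hL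
    rw [Nat.mod_add_mod] at this
    rwa [cyc, cyc, cyc, h2]
  · rw [← h2]
    exact cyc_eq_iff (by omega) h4 i j

theorem WalkOK.avoidingWalk (hn : 12 ≤ n) (hL : Proper L) {vs es : List ℕ} (hvs : 0 < vs.length)
    {l : List (ℕ × ℕ)} : ∀ {x : ℕ}, WalkOK L vs es x l →
      AvoidingWalk (gr n L) (Set.range (cyc vs)) x l ∧ ∀ f ∈ l, f.1 ∉ es := by
  induction l with
  | nil => exact fun _ => ⟨trivial, by simp⟩
  | cons d l ih =>
    obtain ⟨e, y⟩ := d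
    rintro x ⟨h1, h2, h3, h4⟩
    obtain ⟨h5, h6⟩ := ih h4
    refine ⟨⟨h1.isLink hn hL, h2.imp List.isEmpty_iff.1 ?_, h5⟩, by simpa using ⟨h3, by simpa using h6⟩⟩
    rintro h ⟨i, rfl⟩
    exact h (cyc_mem hvs i)

/-- The cycle with vertices `vs` and edges `es` passes through `x` by `a` and `c` and through `y`
by `a'` and `c'`, and the walk `l` leads from `x` to `y`, with first edge `b` and last edge `b'`. -/
def SideOK (L vs es : List ℕ) (i j : ℕ) (l : List (ℕ × ℕ)) (x a b c y a' b' c' : ℕ) : Prop :=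
  CycleOK L vs es ∧ WalkOK L vs es x l ∧ l.head?.map Prod.fst = some b ∧ l.getLast? = some (b', y) ∧
    (cyc es i, cyc vs (i + 1), cyc es (i + 1)) = (a, x, c) ∧
    (cyc es j, cyc vs (j + 1), cyc es (j + 1)) = (a', y, c')

instance {L vs es : List ℕ} {i j : ℕ} {l : List (ℕ × ℕ)} {x a b c y a' b' c' : ℕ} :
    Decidable (SideOK L vs es i j l x a b c y a' b' c') := by unfold SideOK; infer_instance

/-- The Jordan curve argument in checkable form: the orientations of the pieces are all compared
through explicit cycles and walks by this lemma. -/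
theorem SideOK.between_iff (hn : 12 ≤ n) (hL : Proper L) (hG : Connected (gr n L))
    (φ : Embedding (gr n L)) {vs es : List ℕ} {i j : ℕ} {l : List (ℕ × ℕ)}
    {x a b c y a' b' c' : ℕ} (h : SideOK L vs es i j l x a b c y a' b' c') :
    Between (φ.rot x) a b c ↔ Between (φ.rot y) a' b' c' := by
  obtain ⟨h1, h2, h3, h4, h5, h6⟩ := h
  have := simple_gr (n := n) (by omega) hL
  simp only [Prod.mk.injEq] at h5 h6
  obtain ⟨rfl, rfl, rfl⟩ := h5
  obtain ⟨rfl, rfl, rfl⟩ := h6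
  obtain ⟨h7, h8⟩ := h2.avoidingWalk hn hL (by have := h1.1; omega)
  cases l with
  | nil => simp at h3
  | cons d l =>
    obtain ⟨e, z⟩ := d
    simp only [List.head?_cons, Option.map_some, Option.some_inj] at h3
    subst h3
    refine (h1.isCycleWalk hn hL).between_iff finite_vertexSet_gr finite_edgeSet_gr hG φ h7 ?_ ?_
    · intro f hf t ht
      refine h8 f hf (ht ▸ ?_)
      have := h1.1
      exact cyc_mem (by rw [h1.2.1]; omega) t
    · rw [List.getLast?_eq_some_getLast (by simp)] at h4
      exact Option.some_inj.1 h4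

end Gadget
end Village

namespace Village
namespace Gadget

variable {n : ℕ} {k l : ℕ}

/-! ### The village in the graphs of the sequence -/

theorem mem_outer_of_mem_outer_zero {e : ℕ} (k : ℕ) (h : e ∈ outer 0) : e ∈ outer k :=
  forall_outer (P := fun L => ∀ e ∈ outer 0, e ∈ L) (by decide +kernel) k e h

theorem mem_outer_zero_of_mem_outer {e : ℕ} (h : e ∈ outer k) (he : e < 40) : e ∈ outer 0 :=
  forall_outer (P := fun L => ∀ e ∈ L, e < 40 → e ∈ outer 0) (by decide +kernel) k e h he

theorem lt_of_mem_outer_zero {e : ℕ} (h : e ∈ outer 0) : e < 40 := by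
  revert e
  decide +kernel

theorem village_le (k : ℕ) : gr n (outer 0) ≤ gr n (outer k) :=
  gr_mono fun _ => mem_outer_of_mem_outer_zero k

theorem strict_of_mem {e : ℕ} (h : e ∈ (gr n (outer 0)).edgeSet) : e ∈ strict :=
  (mem_edgeSet_gr.1 h).imp lt_of_mem_outer_zero And.left

theorem isLink_of_strict (k l : ℕ) {e x y : ℕ} (he : e ∈ strict)
    (h : (gr n (outer k)).IsLink e x y) : (gr n (outer l)).IsLink e x y := by
  refine ⟨h.1.imp_left fun h => ?_, h.2⟩
  have := (proper_outer k).lt h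
  exact mem_outer_of_mem_outer_zero l (mem_outer_zero_of_mem_outer h
    (by rcases he with he | he <;> omega))

theorem exists_inc_village (hn : 12 ≤ n) {v : ℕ} (hv : v ∈ (gr n (outer 0)).vertexSet) :
    ∃ e e', (gr n (outer 0)).Inc e v ∧ (gr n (outer 0)).Inc e' v ∧ e ≠ e' := by
  have hrim : 100 ≤ v → v < 100 + n → ∃ e e', (gr n (outer 0)).Inc e v ∧
      (gr n (outer 0)).Inc e' v ∧ e ≠ e' := by
    intro h1 h2
    obtain ⟨j, rfl⟩ := Nat.exists_eq_add_of_le h1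
    exact ⟨_, _, (gr_spoke (k := j) (by omega)).inc_right, (gr_rim (k := j) (by omega)).inc_left,
      by omega⟩
  rcases hv with rfl | hv | ⟨e, he, hv⟩
  · exact ⟨_, _, (gr_spoke (k := 0) (by omega)).inc_left, (gr_spoke (k := 1) (by omega)).inc_left,
      by omega⟩
  · exact hrim hv.1 hv.2
  · rw [gEnds_of_lt ((proper_outer 0).lt he)] at hv
    have key : ∀ e ∈ outer 0, ∀ v ∈ [(outerEnds e).1, (outerEnds e).2],
        (100 ≤ v ∧ v < 112) ∨ ∃ f ∈ outer 0, f ≠ e ∧ (v = (outerEnds f).1 ∨ v = (outerEnds f).2) := by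
      decide +kernel
    have hinc : ∀ f ∈ outer 0, v = (outerEnds f).1 ∨ v = (outerEnds f).2 →
        (gr n (outer 0)).Inc f v := fun f hf h =>
      gr_inc.2 ⟨.inl hf, by rwa [gEnds_of_lt ((proper_outer 0).lt hf)]⟩
    rcases key e he v (by simpa using hv) with h | ⟨f, hf, hne, h⟩
    · exact hrim h.1 (by omega)
    · exact ⟨f, e, hinc f hf h, hinc e he hv, hne⟩

variable {φ : Embedding (gr n (outer k))} {ψ : Embedding (gr n (outer l))} {f g : ℕ → ℕ}

/-- Every vertex of the village has two strict edges, which keep their labels and are the same in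
all graphs of the sequence. -/
theorem transport_village_eq (hn : 12 ≤ n) (h : IsTransport strict φ ψ f g) {v : ℕ}
    (hv : v ∈ (gr n (outer 0)).vertexSet) : f v = v := by
  have := simple_gr (n := n) (by omega) (proper_outer k)
  have := simple_gr (n := n) (by omega) (proper_outer l)
  obtain ⟨e, e', h1, h2, h3⟩ := exists_inc_village hn hv
  exact h.vertex_eq (fun e x y he hl => isLink_of_strict l k he hl) (h1.mono (village_le l))
    (h2.mono (village_le l)) (strict_of_mem h1.edge_mem) (strict_of_mem h2.edge_mem) h3

theorem transport_between_village (hn : 12 ≤ n) (h : IsTransport strict φ ψ f g) {v a b c : ℕ}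
    (ha : (gr n (outer 0)).Inc a v) (hb : (gr n (outer 0)).Inc b v)
    (hc : (gr n (outer 0)).Inc c v) : Between (ψ.rot v) a b c ↔ Between (φ.rot v) a b c := by
  have hg : ∀ {a}, (gr n (outer 0)).Inc a v → g a = a := fun ha =>
    h.fixes _ (village_le l |>.edgeSet_mono ha.edge_mem) (.inl (strict_of_mem ha.edge_mem))
  rw [h.between (ha.mono (village_le l)) (hb.mono (village_le l)) (hc.mono (village_le l)),
    transport_village_eq hn h ha.vertex_mem, hg ha, hg hb, hg hc]

/-! ### The images of the pieces -/

/-- Whether `v` is an end of `e`. -/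
def hasEnd (e v : ℕ) : Bool := Nat.beq (litEnds e).1 v || Nat.beq (litEnds e).2 v

/-- Whether `P` holds for all edges in `N` that start at `x`, and their other ends. -/
def forallStep (N : List ℕ) (x : ℕ) (P : ℕ → ℕ → Bool) : Bool :=
  N.all fun e => !hasEnd e x || P e (otherEnd e x)

theorem forallStep_spec {N : List ℕ} {x y e : ℕ} {P : ℕ → ℕ → Bool} (h : forallStep N x P = true)
    (he : e ∈ N) (hxy : litEnds e = (x, y) ∨ litEnds e = (y, x)) : P e y = true := by
  rw [forallStep, List.all_eq_true] at h
  have h1 := h e he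
  have h2 : hasEnd e x = true := by
    rw [hasEnd, Bool.or_eq_true, Nat.beq_eq, Nat.beq_eq]
    rcases hxy with h | h <;> rw [h]
    · exact .inl rfl
    · exact .inr rfl
  have h3 : otherEnd e x = y := by
    rw [otherEnd]
    rcases hxy with h | h <;> rw [h]
    · rw [show Nat.beq (x, y).1 x = true from Nat.beq_refl x, cond_true]
    · cases h4 : Nat.beq (y, x).1 x with
      | true => exact (Nat.eq_of_beq_eq_true h4).symm
      | false => rfl
  rwa [h2, h3, Bool.not_true, Bool.false_or] at h1

/-- The vertices of the pieces. -/
def off (v : ℕ) : Bool := Nat.ble 40 v && Nat.blt v 99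

/-- Whether all copies of a piece in the graph with edges `N` that are attached at the vertices
`x` and `y` satisfy `P`. -/
def forallPiece (N : List ℕ) (x y : ℕ) (P : ℕ → ℕ → ℕ → ℕ → Bool) : Bool :=
  forallStep N x fun e₅ p => !off p || forallStep N p fun e₀ c => !off c || Nat.beq e₀ e₅ ||
  forallStep N c fun e₁ q => !off q || Nat.beq e₁ e₀ || forallStep N q fun _ y' => !Nat.beq y' y ||
  forallStep N p fun e₂ d => !off d || Nat.beq e₂ e₀ || forallStep N d fun e₃ e => !off e ||
  Nat.beq e₃ e₂ || forallStep N e fun e₄ q' => !Nat.beq q' q || Nat.beq e₄ e₃ || Nat.beq e₄ e₁ ||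
  P p e₅ e₀ e₂

/-- The expected image of a piece attached at one of the positions `1`, `2` and `3`. -/
def isSlot (a : ℕ) (S : List ℕ) (p e₅ e₀ e₂ : ℕ) : Bool := S.any fun s => Nat.beq p (40 + 10 * s) &&
  Nat.beq e₅ (43 + 20 * s + 2 * a) && Nat.beq e₀ (40 + 20 * s) && Nat.beq e₂ (42 + 20 * s)

/-- The graph contains the `t`-th piece, attached at the position `a`. -/
def hasPiece (L : List ℕ) (t a : ℕ) : Bool :=
  [43 + 20 * t + 2 * a, 40 + 20 * t, 41 + 20 * t, 44 + 20 * t + 2 * a, 42 + 20 * t, 43 + 20 * t,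
    44 + 20 * t].all fun e => memB e L

/-- Whether the copies of the `t`-th piece at the position `a` that are contained in the `k`-th
graph are the pieces with numbers in `S`. -/
def matchB (k t a : ℕ) (S : List ℕ) : Bool :=
  forallPiece ((outer k).filter fun e => Nat.ble 40 e) (outerEnds (43 + 20 * t + 2 * a)).2
    (outerEnds (44 + 20 * t + 2 * a)).2 (isSlot a S)

/-- An exhaustive search for paths of lengths two and three between the given attachments. The lists
are the candidates among which a step may choose; short paths match short paths only. -/
theorem matchB_outer : matchB 1 0 1 [0, 1] = true ∧ matchB 3 0 1 [0] = true ∧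
    matchB 3 0 2 [0, 1, 2] = true ∧ matchB 5 0 2 [0] = true ∧ matchB 5 1 3 [1, 2] = true ∧
    matchB 7 0 2 [0, 1] = true ∧ matchB 7 1 3 [1] = true ∧ matchB 9 0 2 [0] = true := by
  decide +kernel

end Gadget
end Village

namespace Village
namespace Gadget

variable {n : ℕ} {k l : ℕ} {φ : Embedding (gr n (outer k))} {ψ : Embedding (gr n (outer l))}
  {f g : ℕ → ℕ}

/-- The orientation of the `s`-th piece in an embedding in which it is attached at the
position `a`. -/
def sgn {G : Graph ℕ ℕ} (φ : Embedding G) (s a : ℕ) : Prop :=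
  Between (φ.rot (40 + 10 * s)) (43 + 20 * s + 2 * a) (40 + 20 * s) (42 + 20 * s)

theorem transport_link (h : IsTransport strict φ ψ f g) {e : ℕ} (he : e ∈ outer l) (h40 : 40 ≤ e) :
    g e ∈ (outer k).filter (fun e => Nat.ble 40 e) ∧
      (litEnds (g e) = (f (outerEnds e).1, f (outerEnds e).2) ∨
        litEnds (g e) = (f (outerEnds e).2, f (outerEnds e).1)) := by
  have hlt := (proper_outer l).lt he
  have h1 := gr_link (n := n) (L := outer l) (e := e) (.inl he)
  rw [gEnds_of_lt hlt] at h1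
  obtain ⟨h2, h3⟩ := h.link h1
  have hs : g e ∉ strict := fun hs => by
    have := h.fixes e h1.edge_mem (.inr hs)
    rw [this] at hs
    rcases hs with hs | hs <;> omega
  simp only [strict, Set.mem_ofPred_eq] at hs
  have h4 : g e ∈ outer k := h2.resolve_right fun h => hs (.inr h.1)
  refine ⟨List.mem_filter.2 ⟨h4, by rw [Nat.ble_eq]; omega⟩, ?_⟩
  have hlt' := (proper_outer k).lt h4
  rw [gEnds_of_lt hlt', Sym2.eq_iff] at h3
  rw [litEnds, if_pos hlt']
  rcases h3 with h3 | h3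
  · exact .inl (Prod.ext h3.1.symm h3.2.symm)
  · exact .inr (Prod.ext h3.2.symm h3.1.symm)

/-- The village is fixed vertex by vertex and the map is injective, so a vertex of a piece cannot
land in the village; what remains are vertices of pieces. -/
theorem off_transport (hn : 12 ≤ n) (h : IsTransport strict φ ψ f g) {v : ℕ}
    (hv : v ∈ (gr n (outer l)).vertexSet) (h40 : 40 ≤ v) (h99 : v < 99) : off (f v) = true := by
  obtain ⟨e, he, hve⟩ : ∃ e ∈ outer l, v = (gEnds n e).1 ∨ v = (gEnds n e).2 := by
    rcases hv with hv | hv | hv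
    · omega
    · omega
    · exact hv
  have hl := gr_link (n := n) (L := outer l) (.inl he)
  have hfv : f v ∈ (gr n (outer k)).vertexSet := by
    rcases hve with rfl | rfl
    · exact (h.link hl).left_mem
    · exact (h.link hl).right_mem
  have hout : f v ∉ (gr n (outer 0)).vertexSet := fun hmem => by
    have h1 := transport_village_eq hn h hmem
    have h2 := h.injOn_vertexSet ((village_le l).vertexSet_mono hmem) hv h1
    have h3 : v ∉ (gr n (outer 0)).vertexSet := by
      rintro (h | h | ⟨e, he, h⟩)
      · omega
      · omega
      · have h4 : ∀ e ∈ outer 0, (outerEnds e).1 < 40 ∨ 100 ≤ (outerEnds e).1 := by decide +kernel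
        have h5 : ∀ e ∈ outer 0, (outerEnds e).2 < 40 ∨ 100 ≤ (outerEnds e).2 := by decide +kernel
        have := h4 e he
        have := h5 e he
        rw [gEnds_of_lt ((proper_outer 0).lt he)] at h
        omega
    exact h3 (h2 ▸ hmem)
  have h1 : f v ≠ 99 := fun h => hout (.inl h)
  have h2 : ¬ (100 ≤ f v ∧ f v < 100 + n) := fun h => hout (.inr (.inl h))
  obtain ⟨e', he', hfv⟩ := hfv.resolve_left h1 |>.resolve_left h2
  have hlt := (proper_outer k).lt he'
  rw [gEnds_of_lt hlt] at hfv
  have h3 : f v < 112 := by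
    rcases (proper_outer k).1 e' he' with h | h <;> omega
  have h4 : ¬ f v < 40 := fun h4 => by
    have key : ∀ k < 11, ∀ e ∈ outer k, ∀ v ∈ [(outerEnds e).1, (outerEnds e).2], v < 40 →
        ∃ e' ∈ outer 0, v = (outerEnds e').1 ∨ v = (outerEnds e').2 := by decide +kernel
    obtain ⟨e, he, h5⟩ := forall_outer (P := fun L => ∀ e ∈ L,
      ∀ v ∈ [(outerEnds e).1, (outerEnds e).2], v < 40 →
        ∃ e' ∈ outer 0, v = (outerEnds e').1 ∨ v = (outerEnds e').2) key k e' he' (f v)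
      (by simpa using hfv) h4
    exact hout (.inr (.inr ⟨e, he, by rwa [gEnds_of_lt ((proper_outer 0).lt he)]⟩))
  rw [off, Bool.and_eq_true, Nat.ble_eq, Nat.blt_eq]
  omega

/-- The seven edges of the piece are followed from one fixed attachment on the rim to the other and
around the long path; their images run through the search in `matchB`. The orientation is a
betweenness at an attachment vertex and is therefore transported. -/
theorem exists_slot (hn : 12 ≤ n) (h : IsTransport strict φ ψ f g) {t a : ℕ} (ht : t < 3)
    (ha : 1 ≤ a) (ha' : a ≤ 3) (hL : hasPiece (outer l) t a = true) {S : List ℕ}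
    (hm : matchB k t a S = true) :
    ∃ s ∈ S, f (40 + 10 * t) = 40 + 10 * s ∧ (sgn ψ t a ↔ sgn φ s a) := by
  simp only [hasPiece, List.all_eq_true, memB_iff, List.forall_mem_cons] at hL
  obtain ⟨m5, m0, m1, m6, m2, m3, m4, -⟩ := hL
  have hends : outerEnds (43 + 20 * t + 2 * a) = (40 + 10 * t, (outerEnds (43 + 20 * t + 2 * a)).2) ∧
      outerEnds (40 + 20 * t) = (40 + 10 * t, 41 + 10 * t) ∧
      outerEnds (41 + 20 * t) = (41 + 10 * t, 42 + 10 * t) ∧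
      outerEnds (44 + 20 * t + 2 * a) = (42 + 10 * t, (outerEnds (44 + 20 * t + 2 * a)).2) ∧
      outerEnds (42 + 20 * t) = (40 + 10 * t, 43 + 10 * t) ∧
      outerEnds (43 + 20 * t) = (43 + 10 * t, 44 + 10 * t) ∧
      outerEnds (44 + 20 * t) = (44 + 10 * t, 42 + 10 * t) ∧
      100 ≤ (outerEnds (43 + 20 * t + 2 * a)).2 ∧ 100 ≤ (outerEnds (44 + 20 * t + 2 * a)).2 ∧
      (outerEnds (43 + 20 * t + 2 * a)).2 < 112 ∧ (outerEnds (44 + 20 * t + 2 * a)).2 < 112 := by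
    interval_cases t <;> interval_cases a <;> decide
  obtain ⟨d5, d0, d1, d6, d2, d3, d4, hx, hy, hx', hy'⟩ := hends
  have l5 := transport_link h m5 (by omega)
  have l0 := transport_link h m0 (by omega)
  have l1 := transport_link h m1 (by omega)
  have l6 := transport_link h m6 (by omega)
  have l2 := transport_link h m2 (by omega)
  have l3 := transport_link h m3 (by omega)
  have l4 := transport_link h m4 (by omega)
  have hfix : ∀ v, 100 ≤ v → v < 112 → f v = v := fun v h1 h2 =>
    transport_village_eq hn h (.inr (.inl ⟨h1, by omega⟩))
  rw [d5] at l5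
  rw [d6] at l6
  simp only [hfix _ hx hx', hfix _ hy hy'] at l5 l6
  rw [d0] at l0
  rw [d1] at l1
  rw [d2] at l2
  rw [d3] at l3
  rw [d4] at l4
  have hinc : ∀ {e}, e ∈ outer l → (gr n (outer l)).Inc e (outerEnds e).1 := fun he =>
    gr_inc.2 ⟨.inl he, .inl (by rw [gEnds_of_lt ((proper_outer l).lt he)])⟩
  have i5 := hinc m5
  have i0 := hinc m0
  have i1 := hinc m1
  have i6 := hinc m6
  have i2 := hinc m2
  have i3 := hinc m3
  have i4 := hinc m4
  rw [d5] at i5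
  rw [d0] at i0
  rw [d1] at i1
  rw [d6] at i6
  rw [d2] at i2
  rw [d3] at i3
  rw [d4] at i4
  have o0 := off_transport hn h i0.vertex_mem (by simp only; omega) (by simp only; omega)
  have o1 := off_transport hn h i1.vertex_mem (by simp only; omega) (by simp only; omega)
  have o6 := off_transport hn h i6.vertex_mem (by simp only; omega) (by simp only; omega)
  have o3 := off_transport hn h i3.vertex_mem (by simp only; omega) (by simp only; omega)
  have o4 := off_transport hn h i4.vertex_mem (by simp only; omega) (by simp only; omega)
  simp only at o0 o1 o6 o3 o4 l0 l1 l2 l3 l4 l5 l6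
  have hne : ∀ {e e'}, e ∈ outer l → e' ∈ outer l → e ≠ e' → Nat.beq (g e) (g e') = false := by
    intro e e' he he' hne
    rw [← Bool.not_eq_true, Nat.beq_eq]
    exact fun h1 => hne (h.injOn_edgeSet (.inl he) (.inl he') h1)
  unfold matchB forallPiece at hm
  have h1 := forallStep_spec hm l5.1 l5.2.symm
  simp only [o0, Bool.not_true, Bool.false_or] at h1
  have h2 := forallStep_spec h1 l0.1 l0.2
  simp only [o1, Bool.not_true, Bool.false_or, hne m0 m5 (by omega)] at h2
  have h3 := forallStep_spec h2 l1.1 l1.2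
  simp only [o6, Bool.not_true, Bool.false_or, hne m1 m0 (by omega)] at h3
  have h4 := forallStep_spec h3 l6.1 l6.2
  simp only [Nat.beq_refl, Bool.not_true, Bool.false_or] at h4
  have h5 := forallStep_spec h4 l2.1 l2.2
  simp only [o3, Bool.not_true, Bool.false_or, hne m2 m0 (by omega)] at h5
  have h6 := forallStep_spec h5 l3.1 l3.2
  simp only [o4, Bool.not_true, Bool.false_or, hne m3 m2 (by omega)] at h6
  have h7 := forallStep_spec h6 l4.1 l4.2
  simp only [Nat.beq_refl, Bool.not_true, Bool.false_or, hne m4 m3 (by omega),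
    hne m4 m1 (by omega)] at h7
  simp only [isSlot, List.any_eq_true, Bool.and_eq_true, Nat.beq_eq] at h7
  obtain ⟨s, hs, ⟨⟨h8, h9⟩, h10⟩, h11⟩ := h7
  refine ⟨s, hs, h8, ?_⟩
  rw [sgn, sgn, h.between i5 i0 i2, h8, h9, h10, h11]

end Gadget
end Village

namespace Village
namespace Gadget

variable {n : ℕ}

/-! ### The obstruction -/

/-- All rim vertices have the same orientation. -/
theorem between_rim {L : List ℕ} (hn : 12 ≤ n) (hL : Proper L) (hG : Connected (gr n L))
    (φ : Embedding (gr n L)) {i j : ℕ} (hi : i + 1 < n) (hj : j + 1 < n) :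
    Between (φ.rot (101 + i)) (100 + 2 * i) (103 + 2 * i) (102 + 2 * i) ↔
      Between (φ.rot (101 + j)) (100 + 2 * j) (103 + 2 * j) (102 + 2 * j) := by
  have := simple_gr (n := n) (by omega) hL
  -- The rim is a cycle, and any two spokes form a walk through the centre that avoids it.
  have hC : IsCycleWalk (gr n L) (fun i => 100 + i % n) (fun i => 100 + 2 * (i % n)) n := by
    refine ⟨by omega, fun i => ?_, fun i j => by omega, fun i j => by omega⟩
    have := gr_rim (n := n) (L := L) (Nat.mod_lt i (by omega))
    rwa [Nat.mod_add_mod] at this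
  have hs : ∀ i, i + 1 < n → (gr n L).IsLink (103 + 2 * i) 99 (101 + i) := fun i hi => by
    have := gr_spoke (n := n) (L := L) hi
    rwa [show 101 + 2 * (i + 1) = 103 + 2 * i by omega,
      show 100 + (i + 1) = 101 + i by omega] at this
  have h := hC.between_iff (i := i) (j := j) finite_vertexSet_gr finite_edgeSet_gr hG φ
    (e := 103 + 2 * i) (y := 99) (l := [(103 + 2 * j, 101 + j)]) (e' := 103 + 2 * j) ?_ ?_ ?_
  · simp only [Nat.mod_eq_of_lt hi, Nat.mod_eq_of_lt hj, Nat.mod_eq_of_lt (Nat.lt_of_succ_lt hi),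
      Nat.mod_eq_of_lt (Nat.lt_of_succ_lt hj)] at h
    rwa [show 100 + (i + 1) = 101 + i by omega, show 100 + (j + 1) = 101 + j by omega,
      show 100 + 2 * (i + 1) = 102 + 2 * i by omega,
      show 100 + 2 * (j + 1) = 102 + 2 * j by omega] at h
  · refine ⟨?_, .inr ?_, hs j hj, .inl rfl, trivial⟩
    · simp only [Nat.mod_eq_of_lt hi]
      rw [show 100 + (i + 1) = 101 + i by omega]
      exact (hs i hi).symm
    · rintro ⟨x, hx⟩
      simp only at hx
      omega
  · intro f hf t ht
    have := Nat.mod_lt t (show n > 0 by omega)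
    simp only [List.mem_cons, List.not_mem_nil, or_false] at hf
    rcases hf with rfl | rfl <;> simp only at ht <;> omega
  · simp only [List.getLast_cons_cons, List.getLast_singleton, Nat.mod_eq_of_lt hj]
    rw [show 100 + (j + 1) = 101 + j by omega]

/-- Three distinct edges at the vertex `v`. -/
def TripleOK (L : List ℕ) (v a b c : ℕ) : Prop :=
  (∀ e ∈ [a, b, c], e ∈ L ∧ (v = (outerEnds e).1 ∨ v = (outerEnds e).2)) ∧ [a, b, c].Nodup

instance {L : List ℕ} {v a b c : ℕ} : Decidable (TripleOK L v a b c) := by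
  unfold TripleOK; infer_instance

theorem TripleOK.between_perm {k : ℕ} {v a b c : ℕ} (h : TripleOK (outer k) v a b c)
    (φ : Embedding (gr n (outer k))) :
    (Between (φ.rot v) b c a ↔ Between (φ.rot v) a b c) ∧
    (Between (φ.rot v) a c b ↔ ¬ Between (φ.rot v) a b c) ∧
    (Between (φ.rot v) b a c ↔ ¬ Between (φ.rot v) a b c) := by
  obtain ⟨h1, h2⟩ := h
  have hinc : ∀ e ∈ [a, b, c], (gr n (outer k)).Inc e v := fun e he =>
    gr_inc.2 ⟨.inl (h1 e he).1, by rw [gEnds_of_lt ((proper_outer k).lt (h1 e he).1)]; exact (h1 e he).2⟩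
  have ha := hinc a (by simp)
  have hb := hinc b (by simp)
  have hc := hinc c (by simp)
  simp only [List.nodup_cons, List.mem_cons, List.not_mem_nil, or_false, not_or, not_false_eq_true,
    List.nodup_nil, and_true] at h2
  obtain ⟨⟨hab, hac⟩, hbc⟩ := h2
  have hcyc := φ.isCycleOn v ha.vertex_mem
  have hfin : ((gr n (outer k)).incidenceSet v).Finite :=
    finite_edgeSet_gr.subset ((gr n (outer k)).incidenceSet_subset_edgeSet _)
  have e1 := between_rotate_iff hcyc hfin ha hb hc
  have e2 := not_between_iff hcyc hfin ha hb hc hab hac hbc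
  exact ⟨e1.symm, e2.symm, by rw [between_rotate_iff hcyc hfin hb ha hc, e2]⟩

/-- The orientation of the planet. -/
def eps {G : Graph ℕ ℕ} (φ : Embedding G) : Prop := Between (φ.rot 101) 100 103 102

/-- The orientation of the `t`-th house. -/
def houseSgn {G : Graph ℕ ℕ} (φ : Embedding G) (t : ℕ) : Prop :=
  Between (φ.rot (10 * t + 2)) (10 * t + 1) (10 * t + 7) (10 * t + 2)

/-- All houses have the truth value zero. -/
def AllZero {G : Graph ℕ ℕ} (φ : Embedding G) : Prop := ∀ t < 3, (houseSgn φ t ↔ ¬ eps φ)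

/-- For each piece, a cycle runs from the rim through its tied path to the house and back. The other
path continues over the far end of the house to the vertex 2 without meeting this cycle, so the
order at the piece is the order of the house at that vertex. -/
theorem sgn_outer_one (hn : 12 ≤ n) (φ : Embedding (gr n (outer 1))) (h : AllZero φ) :
    (sgn φ 0 1 ↔ eps φ) ∧ (sgn φ 1 1 ↔ eps φ) := by
  have h0 : Between (φ.rot 2) 1 7 2 ↔ ¬ eps φ := h 0 (by omega)
  have s1 : SideOK (outer 1) [100, 40, 43, 3, 2] [45, 42, 51, 2, 1] 0 3
      [(40, 41), (41, 42), (46, 102), (6, 6), (9, 7), (7, 2)] 40 45 40 42 2 2 7 1 := by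
    decide +kernel
  have s2 : SideOK (outer 1) [100, 50, 51, 7, 2] [65, 60, 72, 7, 1] 0 3
      [(62, 53), (63, 54), (64, 52), (66, 102), (6, 6), (5, 5), (4, 4), (3, 3), (2, 2)]
      50 65 62 60 2 7 2 1 := by
    decide +kernel
  have h1 := s1.between_iff hn (proper_outer 1) (twoConnected_gr hn 1).2.1 φ
  have h2 := s2.between_iff hn (proper_outer 1) (twoConnected_gr hn 1).2.1 φ
  have e1 := (show TripleOK (outer 1) 50 65 62 60 by decide +kernel).between_perm φ
  have e2 := (show TripleOK (outer 1) 2 1 7 2 by decide +kernel).between_perm φ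
  have e3 := (show TripleOK (outer 1) 2 7 2 1 by decide +kernel).between_perm φ
  constructor
  · rw [show sgn φ 0 1 ↔ Between (φ.rot 40) 45 40 42 from Iff.rfl, h1, e3.2.2, e2.1, h0, not_not]
  · rw [show sgn φ 1 1 ↔ Between (φ.rot 50) 65 60 62 from Iff.rfl, e1.2.1, h2, e2.1, h0, not_not]

/-- The two attachments of piece 0 at its vertex 40 are joined through the centre, hence lie on one
side of the piece, and its orientation does not depend on which is used. Pieces 1 and 2 are compared
with house 1 at its vertex 16, and the bounding cycle carries the orientation of the house from 12
to 16. -/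
theorem sgn_outer_three (hn : 12 ≤ n) (φ : Embedding (gr n (outer 3))) (h : AllZero φ) :
    (sgn φ 0 2 ↔ sgn φ 0 1) ∧ (sgn φ 1 2 ↔ eps φ) ∧ (sgn φ 2 2 ↔ eps φ) := by
  have h0 : Between (φ.rot 12) 11 17 12 ↔ ¬ eps φ := h 1 (by omega)
  have s1 : SideOK (outer 3) [40, 41, 42, 44, 43] [40, 41, 44, 43, 42] 4 4
      [(45, 100), (101, 99), (113, 106), (47, 40)] 40 42 45 40 40 42 47 40 := by
    decide +kernel
  have s2 : SideOK (outer 3) [106, 50, 51, 15, 16] [67, 60, 73, 15, 16] 0 3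
      [(62, 53), (63, 54), (64, 52), (68, 104), (11, 12), (17, 17), (19, 16)]
      50 67 62 60 16 15 19 16 := by
    decide +kernel
  have s3 : SideOK (outer 3) [106, 60, 63, 17, 16] [87, 82, 94, 19, 16] 0 3
      [(80, 61), (81, 62), (88, 104), (11, 12), (12, 13), (13, 14), (14, 15), (15, 16)]
      60 87 80 82 16 19 15 16 := by
    decide +kernel
  have s4 : SideOK (outer 3) [104, 12, 13, 14, 15, 16, 106, 105] [11, 12, 13, 14, 15, 16, 110, 108]
      0 4 [(17, 17), (19, 16)] 12 11 17 12 16 15 19 16 := by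
    decide +kernel
  have h1 := s1.between_iff hn (proper_outer 3) (twoConnected_gr hn 3).2.1 φ
  have h2 := s2.between_iff hn (proper_outer 3) (twoConnected_gr hn 3).2.1 φ
  have h3 := s3.between_iff hn (proper_outer 3) (twoConnected_gr hn 3).2.1 φ
  have h4 := s4.between_iff hn (proper_outer 3) (twoConnected_gr hn 3).2.1 φ
  have e1 := (show TripleOK (outer 3) 40 42 45 40 by decide +kernel).between_perm φ
  have e2 := (show TripleOK (outer 3) 40 42 47 40 by decide +kernel).between_perm φ
  have e3 := (show TripleOK (outer 3) 50 67 62 60 by decide +kernel).between_perm φ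
  have e4 := (show TripleOK (outer 3) 16 15 19 16 by decide +kernel).between_perm φ
  refine ⟨?_, ?_, ?_⟩
  · rw [show sgn φ 0 2 ↔ Between (φ.rot 40) 47 40 42 from Iff.rfl, e2.1, ← h1, ← e1.1]
    rfl
  · rw [show sgn φ 1 2 ↔ Between (φ.rot 50) 67 60 62 from Iff.rfl, e3.2.1, h2, ← h4, h0, not_not]
  · rw [show sgn φ 2 2 ↔ Between (φ.rot 60) 87 80 82 from Iff.rfl, h3, e4.2.2, ← h4, h0, not_not]

theorem sgn_outer_five (hn : 12 ≤ n) (φ : Embedding (gr n (outer 5))) (h : AllZero φ) :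
    (sgn φ 1 3 ↔ eps φ) ∧ (sgn φ 2 3 ↔ eps φ) := by
  have h0 : Between (φ.rot 22) 21 27 22 ↔ ¬ eps φ := h 2 (by omega)
  have s1 : SideOK (outer 5) [108, 50, 53, 23, 22] [69, 62, 75, 22, 21] 0 3
      [(60, 51), (61, 52), (70, 110), (26, 26), (29, 27), (27, 22)] 50 69 60 62 22 22 27 21 := by
    decide +kernel
  have s2 : SideOK (outer 5) [108, 60, 61, 27, 22] [89, 80, 96, 27, 21] 0 3
      [(82, 63), (83, 64), (84, 62), (90, 110), (26, 26), (25, 25), (24, 24), (23, 23), (22, 22)]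
      60 89 82 80 22 27 22 21 := by
    decide +kernel
  have h1 := s1.between_iff hn (proper_outer 5) (twoConnected_gr hn 5).2.1 φ
  have h2 := s2.between_iff hn (proper_outer 5) (twoConnected_gr hn 5).2.1 φ
  have e1 := (show TripleOK (outer 5) 60 89 82 80 by decide +kernel).between_perm φ
  have e2 := (show TripleOK (outer 5) 22 21 27 22 by decide +kernel).between_perm φ
  have e3 := (show TripleOK (outer 5) 22 27 22 21 by decide +kernel).between_perm φ
  constructor
  · rw [show sgn φ 1 3 ↔ Between (φ.rot 50) 69 60 62 from Iff.rfl, h1, e3.2.2, e2.1, h0, not_not]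
  · rw [show sgn φ 2 3 ↔ Between (φ.rot 60) 89 80 82 from Iff.rfl, e1.2.1, h2, e2.1, h0, not_not]

/-- Both attachments at the vertex 50 lie on the same side of the piece, as they are joined through
the centre. -/
theorem sgn_outer_seven (hn : 12 ≤ n) (φ : Embedding (gr n (outer 7))) :
    sgn φ 1 2 ↔ sgn φ 1 3 := by
  have s1 : SideOK (outer 7) [50, 51, 52, 54, 53] [60, 61, 64, 63, 62] 4 4
      [(69, 108), (117, 99), (113, 106), (67, 50)] 50 62 69 60 50 62 67 60 := by
    decide +kernel
  have h1 := s1.between_iff hn (proper_outer 7) (twoConnected_gr hn 7).2.1 φ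
  have e1 := (show TripleOK (outer 7) 50 62 69 60 by decide +kernel).between_perm φ
  have e2 := (show TripleOK (outer 7) 50 62 67 60 by decide +kernel).between_perm φ
  rw [show sgn φ 1 2 ↔ Between (φ.rot 50) 67 60 62 from Iff.rfl, e2.1, ← h1, ← e1.1]
  rfl

/-- The short path closes a cycle with the rim from 104 to 106. The edge to 107 joins the long path
to the centre off this cycle, so the piece is oriented by the spoke at 105, whatever the houses do.
-/
theorem sgn_outer_nine (hn : 12 ≤ n) (φ : Embedding (gr n (outer 9))) : sgn φ 0 2 ↔ ¬ eps φ := by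
  have s1 : SideOK (outer 9) [104, 105, 106, 40, 41, 42] [108, 110, 47, 40, 41, 48] 2 0
      [(42, 43), (57, 107), (115, 99), (111, 105)] 40 47 42 40 105 108 111 110 := by
    decide +kernel
  have h1 := s1.between_iff hn (proper_outer 9) (twoConnected_gr hn 9).2.1 φ
  have h2 := between_rim hn (proper_outer 9) (twoConnected_gr hn 9).2.1 φ (i := 4) (j := 0)
    (by omega) (by omega)
  have e1 := (show TripleOK (outer 9) 40 47 42 40 by decide +kernel).between_perm φ
  rw [show sgn φ 0 2 ↔ Between (φ.rot 40) 47 40 42 from Iff.rfl, e1.2.1, h1]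
  exact not_congr h2

variable {k l : ℕ} {φ : Embedding (gr n (outer k))} {ψ : Embedding (gr n (outer l))} {f g : ℕ → ℕ}

theorem inc_village {e v : ℕ} (he : e ∈ outer 0) (hv : v = (outerEnds e).1 ∨ v = (outerEnds e).2) :
    (gr n (outer 0)).Inc e v :=
  gr_inc.2 ⟨.inl he, by rwa [gEnds_of_lt ((proper_outer 0).lt he)]⟩

theorem transport_eps (hn : 12 ≤ n) (h : IsTransport strict φ ψ f g) : eps ψ ↔ eps φ :=
  transport_between_village hn h
    (by simpa [Nat.mod_eq_of_lt (show 1 < n by omega)] using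
      (gr_rim (L := outer 0) (show 0 < n by omega)).inc_right)
    (gr_spoke (show 1 < n by omega)).inc_right (gr_rim (show 1 < n by omega)).inc_left

theorem transport_houseSgn (hn : 12 ≤ n) (h : IsTransport strict φ ψ f g) {t : ℕ} (ht : t < 3) :
    houseSgn ψ t ↔ houseSgn φ t := by
  refine transport_between_village hn h (inc_village ?_ ?_) (inc_village ?_ ?_)
    (inc_village ?_ ?_) <;> interval_cases t <;> decide +kernel

theorem transport_allZero (hn : 12 ≤ n) (h : IsTransport strict φ ψ f g) :
    AllZero ψ ↔ AllZero φ := by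
  have h1 := transport_eps hn h
  refine forall₂_congr fun t ht => ?_
  rw [transport_houseSgn hn h ht, h1]

end Gadget
end Village

namespace Village
namespace Gadget

variable {n : ℕ}

theorem exists_isTransport_up {hn : 12 ≤ n} (σ : SimultaneousEmbedding (sequence hn)) (k : Fin 14)
    (hk : isUp k = true) :
    ∃ f g, IsTransport strict (G := gr n (outer (min (k + 1) 10))) (H := gr n (outer (min k 10)))
      (σ.emb k.succ) (σ.emb k.castSucc) f g := by
  have h : HybridSubgraph strict (gr n (outer (min k 10))) (gr n (outer (min (k + 1) 10))) := by
    rcases Nat.lt_or_ge k 10 with h | h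
    · have h1 := hybridSubgraph_small_large (n := n) h
      rw [small, large, hk, cond_true, cond_true] at h1
      rwa [min_eq_left h.le, min_eq_left (Nat.succ_le_of_lt h)]
    · rw [min_eq_right h, min_eq_right (by omega)]
      exact ⟨_, le_rfl, id, id, ⟨Set.bijOn_id _, Set.bijOn_id _, fun _ _ _ h => h⟩,
        fun _ _ _ => rfl⟩
  exact (σ.up k h).exists_isTransport finite_edgeSet_gr

theorem exists_isTransport_down {hn : 12 ≤ n} (σ : SimultaneousEmbedding (sequence hn))
    (k : Fin 14) (hk : isUp k = false) :
    ∃ f g, IsTransport strict (G := gr n (outer (min k 10))) (H := gr n (outer (min (k + 1) 10)))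
      (σ.emb k.castSucc) (σ.emb k.succ) f g := by
  have h10 : (k : ℕ) < 10 := by
    by_contra h
    have : ∀ k : Fin 14, ¬ (k : ℕ) < 10 → isUp k = true := by decide
    rw [this k h] at hk
    exact Bool.noConfusion hk
  have h : ¬ HybridSubgraph strict (gr n (outer (min k 10))) (gr n (outer (min (k + 1) 10))) := by
    rw [min_eq_left h10.le, min_eq_left (Nat.succ_le_of_lt h10)]
    exact not_hybridSubgraph h10 hk
  exact (σ.down k h).exists_isTransport finite_edgeSet_gr

/-- The rotations at the vertices of the village are the same in all graphs. -/
theorem between_emb_iff {hn : 12 ≤ n} (σ : SimultaneousEmbedding (sequence hn)) {v a b c : ℕ}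
    (ha : (gr n (outer 0)).Inc a v) (hb : (gr n (outer 0)).Inc b v)
    (hc : (gr n (outer 0)).Inc c v) (k : Fin 15) :
    Between ((σ.emb k).rot v) a b c ↔ Between ((σ.emb 0).rot v) a b c := by
  induction k using Fin.induction with
  | zero => rfl
  | succ k ih =>
    rw [← ih]
    cases hk : isUp k with
    | true =>
      obtain ⟨f, g, h⟩ := exists_isTransport_up σ k hk
      exact (transport_between_village hn h ha hb hc).symm
    | false =>
      obtain ⟨f, g, h⟩ := exists_isTransport_down σ k hk
      exact transport_between_village hn h ha hb hc

/-- Not all houses have the truth value zero. -/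
theorem not_allZero {hn : 12 ≤ n} (σ : SimultaneousEmbedding (sequence hn)) :
    ¬ AllZero (σ.emb 0) := by
  intro h0
  obtain ⟨m1, m2, m3, m4, m5, m6, m7, m8⟩ := matchB_outer
  let φ₁ : Embedding (gr n (outer 1)) := σ.emb 1
  let φ₂ : Embedding (gr n (outer 2)) := σ.emb 2
  let φ₃ : Embedding (gr n (outer 3)) := σ.emb 3
  let φ₄ : Embedding (gr n (outer 4)) := σ.emb 4
  let φ₅ : Embedding (gr n (outer 5)) := σ.emb 5
  let φ₆ : Embedding (gr n (outer 6)) := σ.emb 6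
  let φ₇ : Embedding (gr n (outer 7)) := σ.emb 7
  let φ₈ : Embedding (gr n (outer 8)) := σ.emb 8
  let φ₉ : Embedding (gr n (outer 9)) := σ.emb 9
  obtain ⟨f₀, g₀, t₀⟩ : ∃ f g, IsTransport strict φ₁ (H := gr n (outer 0)) (σ.emb 0) f g :=
    exists_isTransport_up σ 0 rfl
  obtain ⟨f₁, g₁, t₁⟩ : ∃ f g, IsTransport strict φ₁ φ₂ f g := exists_isTransport_down σ 1 rfl
  obtain ⟨f₂, g₂, t₂⟩ : ∃ f g, IsTransport strict φ₃ φ₂ f g := exists_isTransport_up σ 2 rfl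
  obtain ⟨f₃, g₃, t₃⟩ : ∃ f g, IsTransport strict φ₃ φ₄ f g := exists_isTransport_down σ 3 rfl
  obtain ⟨f₄, g₄, t₄⟩ : ∃ f g, IsTransport strict φ₅ φ₄ f g := exists_isTransport_up σ 4 rfl
  obtain ⟨f₅, g₅, t₅⟩ : ∃ f g, IsTransport strict φ₅ φ₆ f g := exists_isTransport_down σ 5 rfl
  obtain ⟨f₆, g₆, t₆⟩ : ∃ f g, IsTransport strict φ₇ φ₆ f g := exists_isTransport_up σ 6 rfl
  obtain ⟨f₇, g₇, t₇⟩ : ∃ f g, IsTransport strict φ₇ φ₈ f g := exists_isTransport_down σ 7 rfl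
  obtain ⟨f₈, g₈, t₈⟩ : ∃ f g, IsTransport strict φ₉ φ₈ f g := exists_isTransport_up σ 8 rfl
  have z₁ : AllZero φ₁ := (transport_allZero hn t₀).1 h0
  have z₃ : AllZero φ₃ := (transport_allZero hn t₂).1 ((transport_allZero hn t₁).2 z₁)
  have z₅ : AllZero φ₅ := (transport_allZero hn t₄).1 ((transport_allZero hn t₃).2 z₃)
  have e₁ := transport_eps hn t₁
  have e₂ := transport_eps hn t₂
  have e₃ := transport_eps hn t₃
  have e₄ := transport_eps hn t₄
  have e₅ := transport_eps hn t₅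
  have e₆ := transport_eps hn t₆
  have e₇ := transport_eps hn t₇
  have e₈ := transport_eps hn t₈
  -- Either of the two pieces may have been kept; both have the orientation for false.
  have s₂ : sgn φ₂ 0 1 ↔ eps φ₂ := by
    obtain ⟨s, hs, -, h⟩ := exists_slot hn t₁ (t := 0) (a := 1) (by decide) (by decide) (by decide)
      (by decide +kernel) m1
    obtain ⟨h1, h2⟩ := sgn_outer_one hn φ₁ z₁
    rw [h, e₁]
    fin_cases hs
    exacts [h1, h2]
  -- Three candidates: piece 0, which inherits the previous orientation, and the two pieces that
  -- read house 1.
  have s₄ : sgn φ₄ 0 2 ↔ eps φ₄ := by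
    obtain ⟨s, hs, -, h⟩ := exists_slot hn t₂ (t := 0) (a := 1) (by decide) (by decide) (by decide)
      (by decide +kernel) m2
    rw [List.mem_singleton] at hs
    subst hs
    obtain ⟨s, hs, -, h'⟩ := exists_slot hn t₃ (t := 0) (a := 2) (by decide) (by decide)
      (by decide) (by decide +kernel) m3
    obtain ⟨h1, h2, h3⟩ := sgn_outer_three hn φ₃ z₃
    rw [h', e₃]
    fin_cases hs
    · exact h1.trans (h.symm.trans (s₂.trans e₂))
    · exact h2
    · exact h3
  obtain ⟨s, hs, -, h5⟩ := exists_slot hn t₄ (t := 0) (a := 2) (by decide) (by decide) (by decide)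
    (by decide +kernel) m4
  rw [List.mem_singleton] at hs
  subst hs
  have s₆ : (sgn φ₆ 0 2 ↔ eps φ₆) ∧ (sgn φ₆ 1 3 ↔ eps φ₆) := by
    obtain ⟨s, hs, -, h⟩ := exists_slot hn t₅ (t := 0) (a := 2) (by decide) (by decide) (by decide)
      (by decide +kernel) m4
    rw [List.mem_singleton] at hs
    subst hs
    obtain ⟨s, hs, -, h'⟩ := exists_slot hn t₅ (t := 1) (a := 3) (by decide) (by decide)
      (by decide) (by decide +kernel) m5
    obtain ⟨h1, h2⟩ := sgn_outer_five hn φ₅ z₅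
    rw [h, h', e₅, ← h5, s₄, e₄]
    refine ⟨Iff.rfl, ?_⟩
    fin_cases hs
    exacts [h1, h2]
  have s₈ : sgn φ₈ 0 2 ↔ eps φ₈ := by
    obtain ⟨s, hs, hf, h⟩ := exists_slot hn t₆ (t := 1) (a := 3) (by decide) (by decide)
      (by decide) (by decide +kernel) m7
    rw [List.mem_singleton] at hs
    subst hs
    obtain ⟨s, hs, hf', h'⟩ := exists_slot hn t₆ (t := 0) (a := 2) (by decide) (by decide)
      (by decide) (by decide +kernel) m6
    -- The only image of piece 1 at its position is piece 1, so by injectivity piece 0 is left with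
    -- piece 0.
    have hs0 : s = 0 := by
      have hV : ∀ v ∈ [40, 50], v ∈ (gr n (outer 6)).vertexSet := by
        have : ∀ v ∈ [40, 50], ∃ e ∈ outer 6, v = (outerEnds e).1 ∨ v = (outerEnds e).2 := by
          decide +kernel
        intro v hv
        obtain ⟨e, he, h⟩ := this v hv
        exact .inr (.inr ⟨e, he, by rwa [gEnds_of_lt ((proper_outer 6).lt he)]⟩)
      fin_cases hs
      · rfl
      · have := t₆.injOn_vertexSet (hV 40 (by simp)) (hV 50 (by simp)) (hf'.trans hf.symm)
        omega
    subst hs0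
    obtain ⟨s, hs, -, h''⟩ := exists_slot hn t₇ (t := 0) (a := 2) (by decide) (by decide)
      (by decide) (by decide +kernel) m6
    rw [h'', e₇]
    fin_cases hs
    · exact h'.symm.trans (s₆.1.trans e₆)
    · exact (sgn_outer_seven hn φ₇).trans (h.symm.trans (s₆.2.trans e₆))
  obtain ⟨s, hs, -, h9⟩ := exists_slot hn t₈ (t := 0) (a := 2) (by decide) (by decide) (by decide)
    (by decide +kernel) m8
  rw [List.mem_singleton] at hs
  subst hs
  -- The final test demands the opposite of the orientation that has been passed on.
  have h10 := sgn_outer_nine hn φ₉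
  rw [← h9, s₈, e₈] at h10
  exact iff_not_self h10

end Gadget
end Village

namespace Village

/-! ### Recovering a rotation from betweenness -/

section CyclicOrder

variable {β : Type*} {r r' : Equiv.Perm β} {S : Set β} {a b : β}

theorem not_between_apply : ¬ Between r a b (r a) := by
  rintro ⟨j, k, hj, hjk, -, hk, h⟩
  have := pow_apply_inj_of_ne (i := k) (j := 1) h le_rfl (by omega) (by simpa using hk)
  omega

/-- A cyclic order is determined by its betweenness relation. -/
theorem apply_eq_of_between (hr : r.IsCycleOn S) (hr' : r'.IsCycleOn S) (hS : S.Finite)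
    (h : ∀ a ∈ S, ∀ b ∈ S, ∀ c ∈ S, Between r a b c → Between r' a b c) (ha : a ∈ S) :
    r a = r' a := by
  by_contra hne
  have h1 : r a ∈ S := hr.1.mapsTo ha
  have h2 : r' a ∈ S := hr'.1.mapsTo ha
  have hnt : S.Nontrivial := ⟨_, h1, _, h2, hne⟩
  -- If the successors differed, one would lie between `a` and the other, but nothing lies between
  -- `a` and its successor.
  rcases between_or_between hr hS ha h1 h2 (hr.apply_ne hnt ha).symm (hr'.apply_ne hnt ha).symm hne
    with h3 | h3
  · exact not_between_apply (h _ ha _ h1 _ h2 h3)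
  · exact not_between_apply h3

end CyclicOrder

namespace Gadget

variable {m i : ℕ}

/-! ### The village -/

/-- The index on the rim of the surface vertex `s_j`. -/
def index (m i j : ℕ) : ℕ := (j + (4 * m + 11 - 12 * i)) % (4 * m)

/-- The rim is renumbered so that `s_{12i-11}`, the vertex `v_1` of the first of the three houses,
gets the index 0; the two cases tell whether the count has wrapped around. -/
theorem index_spec (hi : 1 ≤ i) (him : 3 * i ≤ m) {j : ℕ} (h1 : 1 ≤ j) (h2 : j ≤ 4 * m) :
    (12 * i ≤ j + 11 ∧ index m i j + 12 * i = j + 11 ∨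
      j + 11 < 12 * i ∧ index m i j + 12 * i = j + 11 + 4 * m) ∧ index m i j < 4 * m := by
  have h3 : index m i j < 4 * m := Nat.mod_lt _ (by omega)
  refine ⟨?_, h3⟩
  rw [index]
  rcases Nat.lt_or_ge (j + 11) (12 * i) with h | h
  · rw [Nat.mod_eq_of_lt (by omega)]
    omega
  · rw [Nat.mod_eq_sub_mod (by omega), Nat.mod_eq_of_lt (by omega)]
    omega

/-- The vertices of the village as numbers. -/
def toV (m i : ℕ) : VVertex → ℕ
  | .centre => 99
  | .surface j => 100 + index m i j
  | .house h k => 10 * (h + 2 - 3 * i) + k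
  | .inhabitant h => 10 * (h + 2 - 3 * i) + 7

/-- The edges of the village as numbers. -/
def toE (m i : ℕ) : VEdge → ℕ
  | .spoke j => 101 + 2 * index m i j
  | .rim j => 100 + 2 * index m i j
  | .wall h k => 10 * (h + 2 - 3 * i) + k
  | .claw h k => 10 * (h + 2 - 3 * i) + (6 + k / 2)

theorem mem_triple (hi : 1 ≤ i) {h : ℕ} :
    h ∈ ({3 * i - 2, 3 * i - 1, 3 * i} : Set ℕ) ↔ ∃ t < 3, h + 2 = 3 * i + t := by
  simp only [Set.mem_insert_iff, Set.mem_singleton_iff]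
  constructor
  · rintro (rfl | rfl | rfl)
    exacts [⟨0, by omega, by omega⟩, ⟨1, by omega, by omega⟩, ⟨2, by omega, by omega⟩]
  · rintro ⟨t, ht, h⟩
    omega

theorem triple_subset (hi : 1 ≤ i) (him : 3 * i ≤ m) :
    ({3 * i - 2, 3 * i - 1, 3 * i} : Set ℕ) ⊆ Set.Icc 1 m := by
  rintro h (rfl | rfl | rfl) <;> simp only [Set.mem_Icc] <;> omega

theorem mem_outer_zero {e : ℕ} : e ∈ outer 0 ↔ e < 30 ∧ 1 ≤ e % 10 := by
  have h1 : ∀ e < 30, 1 ≤ e % 10 → e ∈ outer 0 := by decide +kernel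
  have h2 : ∀ e ∈ outer 0, e < 30 ∧ 1 ≤ e % 10 := by decide +kernel
  exact ⟨h2 e, fun h => h1 e h.1 h.2⟩

theorem gEnds_toE (hi : 1 ≤ i) (him : 3 * i ≤ m) {e : VEdge}
    (he : IsEdge m {3 * i - 2, 3 * i - 1, 3 * i} e) :
    gEnds (4 * m) (toE m i e) = (toV m i (ends m e).1, toV m i (ends m e).2) := by
  have hv1 : ∀ {h t : ℕ}, t < 3 → h + 2 = 3 * i + t → index m i (4 * h - 3) = 4 * t ∧
      index m i (4 * h - 1) = 4 * t + 2 := by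
    intro h t ht hh
    have h1 := index_spec hi him (j := 4 * h - 3) (by omega) (by omega)
    have h2 := index_spec hi him (j := 4 * h - 1) (by omega) (by omega)
    omega
  cases e with
  | spoke j =>
    rw [toE, gEnds, if_neg (by omega), if_neg (by omega)]
    refine Prod.ext rfl ?_
    change 100 + (101 + 2 * index m i j - 100) / 2 = 100 + index m i j
    omega
  | rim j =>
    obtain ⟨h1, h2⟩ := he
    have h3 := index_spec hi him h1 h2
    rw [toE, gEnds, if_neg (by omega), if_pos (by omega),
      show (100 + 2 * index m i j - 100) / 2 = index m i j by omega]
    refine Prod.ext rfl ?_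
    change 100 + (index m i j + 1) % (4 * m) = 100 + index m i (if j = 4 * m then 1 else j + 1)
    congr 1
    have h4 := index_spec hi him (j := if j = 4 * m then 1 else j + 1)
      (by split_ifs <;> omega) (by split_ifs <;> omega)
    rcases Nat.lt_or_ge (index m i j + 1) (4 * m) with h | h
    · rw [Nat.mod_eq_of_lt h]
      split_ifs at h4 ⊢ <;> omega
    · rw [show index m i j + 1 = 4 * m by omega, Nat.mod_self]
      split_ifs at h4 ⊢ <;> omega
  | wall h k =>
    obtain ⟨hI, h1, h6⟩ := he
    obtain ⟨t, ht, hh⟩ := (mem_triple hi).1 hI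
    obtain ⟨e1, e2⟩ := hv1 ht hh
    have e3 : h + 2 - 3 * i = t := by omega
    simp only [toE, ends, houseVertex, e3]
    rw [gEnds_of_lt (by omega)]
    interval_cases k <;> simp [toV, e1, e2, e3] <;> interval_cases t <;> decide
  | claw h k =>
    obtain ⟨hI, hk⟩ := he
    obtain ⟨t, ht, hh⟩ := (mem_triple hi).1 hI
    have e3 : h + 2 - 3 * i = t := by omega
    simp only [toE, ends, houseVertex, e3]
    rw [gEnds_of_lt (by omega)]
    rcases hk with rfl | rfl | rfl <;> simp [toV, e3] <;> interval_cases t <;> decide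

theorem isIso_village (hi : 1 ≤ i) (him : 3 * i ≤ m) :
    IsIso (toV m i) (toE m i) (village m {3 * i - 2, 3 * i - 1, 3 * i} (triple_subset hi him))
      (gr (4 * m) (outer 0)) := by
  have hlink : ∀ ⦃e x y⦄, (village m {3 * i - 2, 3 * i - 1, 3 * i} (triple_subset hi him)).IsLink
      e x y → (gr (4 * m) (outer 0)).IsLink (toE m i e) (toV m i x) (toV m i y) := by
    rintro e x y ⟨he, hxy⟩
    refine ⟨?_, ?_⟩
    · cases e with
      | spoke j =>
        have := index_spec hi him he.1 he.2
        right
        simp only [toE]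
        omega
      | rim j =>
        have := index_spec hi him he.1 he.2
        right
        simp only [toE]
        omega
      | wall h k =>
        obtain ⟨t, ht, hh⟩ := (mem_triple hi).1 he.1
        have := he.2
        left
        simp only [mem_outer_zero, toE]
        omega
      | claw h k =>
        obtain ⟨t, ht, hh⟩ := (mem_triple hi).1 he.1
        have := he.2
        left
        simp only [mem_outer_zero, toE]
        omega
    · rw [gEnds_toE hi him he]
      rw [Sym2.eq_iff] at hxy ⊢
      rcases hxy with ⟨rfl, rfl⟩ | ⟨rfl, rfl⟩
      · exact .inl ⟨rfl, rfl⟩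
      · exact .inr ⟨rfl, rfl⟩
  have hv : ∀ e ∈ outer 0, ∀ v ∈ [(outerEnds e).1, (outerEnds e).2], 100 ≤ v ∧ v < 112 ∨
      v < 30 ∧ 2 ≤ v % 10 ∧ v % 10 ≤ 7 := by decide +kernel
  have hv' : ∀ v < 30, 2 ≤ v % 10 → v % 10 ≤ 7 → ∃ e ∈ outer 0,
      v = (outerEnds e).1 ∨ v = (outerEnds e).2 := by decide +kernel
  have hsurj : ∀ x < 4 * m, ∃ j, 1 ≤ j ∧ j ≤ 4 * m ∧ index m i j = x := by
    intro x hx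
    rcases Nat.lt_or_ge (x + 12 * i) (12 + 4 * m) with h | h
    · have h1 := index_spec hi him (j := x + 12 * i - 11) (by omega) (by omega)
      exact ⟨x + 12 * i - 11, by omega, by omega, by omega⟩
    · have h1 := index_spec hi him (j := x + 12 * i - 11 - 4 * m) (by omega) (by omega)
      exact ⟨x + 12 * i - 11 - 4 * m, by omega, by omega, by omega⟩
  refine ⟨⟨?_, ?_, ?_⟩, ⟨?_, ?_, ?_⟩, hlink⟩
  · rintro (_ | j | ⟨h, k⟩ | h) hx
    · exact .inl rfl
    · have := index_spec hi him hx.1 hx.2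
      refine .inr (.inl ?_)
      simp only [toV]
      omega
    · obtain ⟨t, ht, hh⟩ := (mem_triple hi).1 hx.1
      have := hx.2
      refine .inr (.inr ?_)
      simp only [toV]
      obtain ⟨e, he, h⟩ := hv' (10 * (h + 2 - 3 * i) + k) (by omega) (by omega) (by omega)
      exact ⟨e, he, by rwa [gEnds_of_lt ((proper_outer 0).lt he)]⟩
    · obtain ⟨t, ht, hh⟩ := (mem_triple hi).1 hx
      refine .inr (.inr ?_)
      simp only [toV]
      obtain ⟨e, he, h⟩ := hv' (10 * (h + 2 - 3 * i) + 7) (by omega) (by omega) (by omega)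
      exact ⟨e, he, by rwa [gEnds_of_lt ((proper_outer 0).lt he)]⟩
  -- The codes of each kind of vertex are put in linear form, which reduces injectivity to
  -- arithmetic.
  · have hcode : ∀ x, IsVertex m {3 * i - 2, 3 * i - 1, 3 * i} x → match x with
        | .centre => toV m i x = 99
        | .surface j => 100 ≤ toV m i x ∧ (12 * i ≤ j + 11 ∧ toV m i x + 12 * i = j + 111 ∨
            j + 11 < 12 * i ∧ toV m i x + 12 * i = j + 111 + 4 * m) ∧ 1 ≤ j ∧ j ≤ 4 * m
        | .house h k => 2 ≤ k ∧ k ≤ 6 ∧ 3 * i ≤ h + 2 ∧ h ≤ 3 * i ∧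
            toV m i x = 10 * (h + 2 - 3 * i) + k
        | .inhabitant h => 3 * i ≤ h + 2 ∧ h ≤ 3 * i ∧ toV m i x = 10 * (h + 2 - 3 * i) + 7 := by
      rintro (_ | j | ⟨h, k⟩ | h) hx
      · rfl
      · have := index_spec hi him hx.1 hx.2
        simp only [toV]
        have := hx.1
        have := hx.2
        omega
      · obtain ⟨t, ht, hh⟩ := (mem_triple hi).1 hx.1
        exact ⟨hx.2.1, hx.2.2, by omega, by omega, rfl⟩
      · obtain ⟨t, ht, hh⟩ := (mem_triple hi).1 hx
        exact ⟨by omega, by omega, rfl⟩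
    intro x hx y hy hxy
    have h1 := hcode x hx
    have h2 := hcode y hy
    rw [← hxy] at h2
    cases x <;> cases y <;> simp only at h1 h2 <;>
      first
        | rfl
        | (exfalso; omega)
        | (congr 1 <;> omega)
  · rintro v (rfl | hv1 | ⟨e, he, hve⟩)
    · exact ⟨.centre, trivial, rfl⟩
    · obtain ⟨j, h1, h2, h3⟩ := hsurj (v - 100) (by omega)
      exact ⟨.surface j, ⟨h1, h2⟩, by simp only [toV]; omega⟩
    · rw [gEnds_of_lt ((proper_outer 0).lt he)] at hve
      rcases hv e he v (by simpa using hve) with h | h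
      · obtain ⟨j, h1, h2, h3⟩ := hsurj (v - 100) (by omega)
        exact ⟨.surface j, ⟨h1, h2⟩, by simp only [toV]; omega⟩
      · have hI := (mem_triple hi (h := 3 * i + v / 10 - 2)).2 ⟨v / 10, by omega, by omega⟩
        rcases h.2.2.eq_or_lt with h7 | h7
        · exact ⟨.inhabitant _, hI, by simp only [toV]; omega⟩
        · exact ⟨.house _ (v % 10), ⟨hI, h.2.1, by omega⟩, by simp only [toV]; omega⟩
  · intro e he
    have he' : (village m {3 * i - 2, 3 * i - 1, 3 * i} (triple_subset hi him)).IsLink e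
      (ends m e).1 (ends m e).2 := ⟨he, rfl⟩
    exact (hlink he').edge_mem
  · have hcode : ∀ x, IsEdge m {3 * i - 2, 3 * i - 1, 3 * i} x → match x with
        | .spoke j => ((12 * i ≤ j + 11 ∧ toE m i x + 24 * i = 2 * j + 123 ∨
            j + 11 < 12 * i ∧ toE m i x + 24 * i = 2 * j + 123 + 8 * m) ∧ 1 ≤ j ∧ j ≤ 4 * m) ∧
            100 ≤ toE m i x
        | .rim j => ((12 * i ≤ j + 11 ∧ toE m i x + 24 * i = 2 * j + 122 ∨
            j + 11 < 12 * i ∧ toE m i x + 24 * i = 2 * j + 122 + 8 * m) ∧ 1 ≤ j ∧ j ≤ 4 * m) ∧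
            100 ≤ toE m i x
        | .wall h k => 1 ≤ k ∧ k ≤ 6 ∧ 3 * i ≤ h + 2 ∧ h ≤ 3 * i ∧
            toE m i x = 10 * (h + 2 - 3 * i) + k
        | .claw h k => (k = 2 ∨ k = 4 ∨ k = 6) ∧ 3 * i ≤ h + 2 ∧ h ≤ 3 * i ∧
            toE m i x = 10 * (h + 2 - 3 * i) + (6 + k / 2) := by
      rintro (j | j | ⟨h, k⟩ | ⟨h, k⟩) hx
      · have := index_spec hi him hx.1 hx.2
        have := hx.1
        have := hx.2
        simp only [toE]
        omega
      · have := index_spec hi him hx.1 hx.2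
        have := hx.1
        have := hx.2
        simp only [toE]
        omega
      · obtain ⟨t, ht, hh⟩ := (mem_triple hi).1 hx.1
        exact ⟨hx.2.1, hx.2.2, by omega, by omega, rfl⟩
      · obtain ⟨t, ht, hh⟩ := (mem_triple hi).1 hx.1
        exact ⟨hx.2, by omega, by omega, rfl⟩
    intro x hx y hy hxy
    have h1 := hcode x hx
    have h2 := hcode y hy
    rw [← hxy] at h2
    cases x <;> cases y <;> simp only at h1 h2 <;>
      first
        | rfl
        | (exfalso; omega)
        | (congr 1 <;> omega)
  · rintro e (he | he)
    · rw [mem_outer_zero] at he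
      have hI := (mem_triple hi (h := 3 * i + e / 10 - 2)).2 ⟨e / 10, by omega, by omega⟩
      rcases Nat.lt_or_ge (e % 10) 7 with h7 | h7
      · exact ⟨.wall _ (e % 10), ⟨hI, by omega, by omega⟩, by simp only [toE]; omega⟩
      · exact ⟨.claw _ (2 * (e % 10 - 6)), ⟨hI, by omega⟩, by simp only [toE]; omega⟩
    · obtain ⟨j, h1, h2, h3⟩ := hsurj ((e - 100) / 2) (by omega)
      rcases Nat.mod_two_eq_zero_or_one e with h | h
      · exact ⟨.rim j, ⟨h1, h2⟩, by simp only [toE]; omega⟩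
      · exact ⟨.spoke j, ⟨h1, h2⟩, by simp only [toE]; omega⟩

end Gadget
end Village

namespace Village
namespace Gadget

variable {n m i : ℕ}

/-! ### The housing sequence -/

/-- All edges of the village are strict, so every step preserves betweenness at its vertices, and
betweenness determines the rotation. -/
theorem rot_emb_last {hn : 12 ≤ n} (σ : SimultaneousEmbedding (sequence hn)) {v e : ℕ}
    (he : (gr n (outer 0)).Inc e v) : (σ.emb 0).rot v e = (σ.emb (Fin.last 14)).rot v e := by
  let ψ : Embedding (gr n (outer 10)) := σ.emb (Fin.last 14)
  have h1 : ((σ.emb 0).rot v).IsCycleOn ((gr n (outer 0)).incidenceSet v) :=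
    (σ.emb 0).isCycleOn v he.vertex_mem
  have h2 : (ψ.rot v).IsCycleOn ((gr n (outer 10)).incidenceSet v) :=
    ψ.isCycleOn v (by rw [outer_eq le_rfl]; exact he.vertex_mem)
  have h3 : (gr n (outer 10)).incidenceSet v = (gr n (outer 0)).incidenceSet v := by
    rw [outer_eq le_rfl]
  rw [h3] at h2
  exact apply_eq_of_between h1 h2
    (finite_edgeSet_gr.subset ((gr n (outer 0)).incidenceSet_subset_edgeSet _))
    (fun a ha b hb c hc h => (between_emb_iff σ ha hb hc (Fin.last 14)).2 h) he

theorem rotB_outer {k : ℕ} (hk : k < 11) {a b c : Bool} (h : (a || b || c) = true) :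
    rotB (outer k) (config k a b c) = true := by
  have := planarB_outer k hk a b c (by rw [h, Bool.true_or])
  simp only [planarB, Bool.and_eq_true] at this
  exact this.1.1.1

theorem degree_eq_length (hn : 12 ≤ n) {L : List ℕ} (hL : Proper L) {c : Config}
    (h : rotB L c = true) {v : ℕ} (hv : v ∈ (gr n L).vertexSet) :
    degree (gr n L) v = (rotList n L c v).length := by
  have h1 : (gr n L).incidenceSet v = ((rotList n L c v).toFinset : Set ℕ) := by
    ext e
    rw [List.coe_toFinset]
    exact (mem_rotList hL h hv).symm
  rw [degree, h1, Set.ncard_coe_finset, List.toFinset_card_of_nodup (nodup_rotList hn hL h v)]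

/-- At most eight outer edges and three edges of the planet meet at `v`, while the centre has degree
`n ≥ 12`. -/
theorem degree_lt_centre (hn : 12 ≤ n) {k : ℕ} (hk : k < 11) {v : ℕ}
    (hv : v ∈ (gr n (outer k)).vertexSet) (h99 : v ≠ 99) :
    degree (gr n (outer k)) v < degree (gr n (outer k)) 99 := by
  have h := rotB_outer hk (a := true) (b := true) (c := true) rfl
  have h1 : ∀ k < 11, ∀ v < 112, (outerRot (config k true true true) v).length ≤ 8 := by
    decide +kernel
  have h2 : (rotAt (outer k) (config k true true true) v).length ≤ 8 := by
    refine (List.length_filter_le _ _).trans ?_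
    rcases Nat.lt_or_ge v 112 with hv | hv
    · exact h1 k hk v hv
    · rw [outerRot_eq_nil hv]
      exact Nat.zero_le _
  rw [degree_eq_length hn (proper_outer k) h hv,
    degree_eq_length hn (proper_outer k) h (.inl rfl), rotList, rotList, if_pos rfl, if_neg h99,
    List.length_map, List.length_range]
  split_ifs
  · simp only [List.length_cons]
    omega
  · omega

theorem isLink_village_of_planet {I : Set ℕ} (hI : I ⊆ Set.Icc 1 m) {e : VEdge} {x y : VVertex}
    (h : (planet m).IsLink e x y) : (village m I hI).IsLink e x y := by
  refine ⟨?_, h.2⟩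
  have h1 : IsEdge m ∅ e := h.1
  cases e with
  | spoke j => exact h1
  | rim j => exact h1
  | wall j k => exact absurd h1.1 (Set.notMem_empty _)
  | claw j k => exact absurd h1.1 (Set.notMem_empty _)

/-- The housing sequence of three consecutive houses. -/
def housing (hi : 1 ≤ i) (him : 3 * i ≤ m) :
    HousingSequence m {3 * i - 2, 3 * i - 1, 3 * i} ℕ ℕ where
  toHybridDeletionSequence := sequence (n := 4 * m) (by omega)
  index_subset := triple_subset hi him
  startV := toV m i
  startE := toE m i
  start_isIso := isIso_village hi him
  endV := toV m i
  endE := toE m i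
  end_isIso := by
    change IsIso _ _ _ (gr (4 * m) (outer 10))
    rw [outer_eq le_rfl]
    exact isIso_village hi him
  endV_planet _ _ := rfl
  endE_planet _ _ := rfl
  planet_le k e x y h := ((isIso_village hi him).isLink
    (isLink_village_of_planet (triple_subset hi him) h)).mono (village_le _)
  degree_lt k v hv h := degree_lt_centre (by omega) (k := min k 10) (by omega) hv h
  same_embedding := by
    intro σ v e e' ⟨u, he⟩ _
    rw [rot_emb_last σ ((isIso_village hi him).isLink he).inc_left]
    rfl

theorem size_housing (hi : 1 ≤ i) (him : 3 * i ≤ m) : (housing hi him).size ≤ 300 * m := by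
  have h1 : (housing hi him).size = ∑ k : Fin 15, (2 * (4 * m) + (outer (min k 10)).length) :=
    Finset.sum_congr rfl fun k _ => ncard_edgeSet_gr (proper_outer _) (nodup_outer _)
  -- Fifteen planets have `120 * m` edges, and `528 ≤ 180 * m` because `m ≥ 3`.
  have h2 : ∑ k : Fin 15, (outer (min k 10)).length = 528 := by decide +kernel
  rw [h1, Finset.sum_add_distrib, h2, Finset.sum_const, Finset.card_univ, Fintype.card_fin,
    smul_eq_mul]
  omega

end Gadget
end Village

namespace Village

theorem between_of_apply {β : Type*} {r : Equiv.Perm β} {a b c : β} (h1 : r a = b) (h2 : r b = c)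
    (hb : b ≠ a) (hc : c ≠ a) : Between r a b c := by
  have h3 : (r ^ 2) a = c := by rw [pow_two, Equiv.Perm.mul_apply, h1, h2]
  refine ⟨1, 2, by omega, by omega, by rwa [pow_one], h3, fun i h4 h5 => ?_⟩
  obtain rfl | rfl : i = 1 ∨ i = 2 := by omega
  · rwa [pow_one, h1]
  · rwa [h3]

namespace Gadget

variable {n m i t : ℕ}

/-! ### The allocation set -/

/-- The vertices of the bounding cycle of the `t`-th house. -/
def wallVertices (t : ℕ) : List ℕ := [100 + 4 * t, 10 * t + 2, 10 * t + 3, 10 * t + 4, 10 * t + 5,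
  10 * t + 6, 102 + 4 * t, 101 + 4 * t]

/-- The edges of the bounding cycle of the `t`-th house. -/
def wallEdges (t : ℕ) : List ℕ := [10 * t + 1, 10 * t + 2, 10 * t + 3, 10 * t + 4, 10 * t + 5,
  10 * t + 6, 102 + 8 * t, 100 + 8 * t]

theorem isCycleWalk_wall (hn : 12 ≤ n) (ht : t < 3) :
    IsCycleWalk (gr n (outer 0)) (cyc (wallVertices t)) (cyc (wallEdges t)) 8 := by
  have h : ∀ t < 3, CycleOK (outer 0) (wallVertices t) (wallEdges t) := by decide +kernel
  exact (h t ht).isCycleWalk hn (proper_outer 0)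

theorem isLink_inhabitant (ht : t < 3) :
    (gr n (outer 0)).IsLink (10 * t + 7) (10 * t + 2) (10 * t + 7) := by
  have h : ∀ t < 3, 10 * t + 7 ∈ outer 0 ∧ outerEnds (10 * t + 7) = (10 * t + 7, 10 * t + 2) := by
    decide +kernel
  refine ⟨.inl (h t ht).1, ?_⟩
  rw [gEnds_of_lt (by omega), (h t ht).2]
  exact Sym2.eq_swap

/-- The position 8, one period after 0, makes this place of the cycle come after the position 6 of
the middle rim vertex, as the ordering in `IsCycleWalk.sameSide_of_between` requires. -/
theorem cyc_wall : cyc (wallVertices t) (8 + 1) = 10 * t + 2 ∧ cyc (wallEdges t) 8 = 10 * t + 1 ∧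
    cyc (wallEdges t) (8 + 1) = 10 * t + 2 := by
  simp [cyc, wallVertices, wallEdges]

theorem isLink_wall (ht : t < 3) : (gr n (outer 0)).IsLink (10 * t + 7)
    (cyc (wallVertices t) (8 + 1)) (10 * t + 7) := by
  rw [cyc_wall.1]
  exact isLink_inhabitant ht

theorem between_wall_iff {G : Graph ℕ ℕ} (φ : Embedding G) :
    Between (φ.rot (cyc (wallVertices t) (8 + 1))) (cyc (wallEdges t) 8) (10 * t + 7)
      (cyc (wallEdges t) (8 + 1)) ↔ houseSgn φ t := by
  rw [cyc_wall.1, cyc_wall.2.1, cyc_wall.2.2, houseSgn]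

theorem isLink_middle (hn : 12 ≤ n) (ht : t < 3) :
    (gr n (outer 0)).IsLink (103 + 8 * t) (101 + 4 * t) 99 := by
  have h := (gr_spoke (n := n) (L := outer 0) (k := 4 * t + 1) (by omega)).symm
  rwa [show 101 + 2 * (4 * t + 1) = 103 + 8 * t by omega,
    show 100 + (4 * t + 1) = 101 + 4 * t by omega] at h

/-- The bounding cycle traverses the rim backwards, which negates the orientation of the planet. -/
theorem between_middle (hn : 12 ≤ n) (ht : t < 3) (φ : Embedding (gr n (outer 0))) :
    Between (φ.rot (101 + 4 * t)) (102 + 8 * t) (103 + 8 * t) (100 + 8 * t) ↔ ¬ eps φ := by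
  have h1 := between_rim hn (proper_outer 0) (twoConnected_gr hn 0).2.1 φ (i := 4 * t) (j := 0)
    (by omega) (by omega)
  simp only [← mul_assoc, Nat.reduceMul] at h1
  have h2 := (isLink_middle hn ht).inc_left
  have ha : (gr n (outer 0)).Inc (100 + 8 * t) (101 + 4 * t) := by
    have := (gr_rim (n := n) (L := outer 0) (k := 4 * t) (by omega)).inc_right
    rwa [Nat.mod_eq_of_lt (by omega), show 100 + 2 * (4 * t) = 100 + 8 * t by omega,
      show 100 + (4 * t + 1) = 101 + 4 * t by omega] at this
  have hc : (gr n (outer 0)).Inc (102 + 8 * t) (101 + 4 * t) := by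
    have := (gr_rim (n := n) (L := outer 0) (k := 4 * t + 1) (by omega)).inc_left
    rwa [show 100 + 2 * (4 * t + 1) = 102 + 8 * t by omega,
      show 100 + (4 * t + 1) = 101 + 4 * t by omega] at this
  have hcyc := φ.isCycleOn _ h2.vertex_mem
  have hfin : ((gr n (outer 0)).incidenceSet (101 + 4 * t)).Finite :=
    finite_edgeSet_gr.subset ((gr n (outer 0)).incidenceSet_subset_edgeSet _)
  rw [eps, ← show _ ↔ Between (φ.rot 101) 100 103 102 from h1,
    not_between_iff hcyc hfin ha h2 hc (by omega) (by omega) (by omega),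
    between_rotate_iff hcyc hfin ha hc h2]

/-- Truth value zero in terms of orientations: the spoke at the middle rim vertex and the edge to
the inhabitant leave the bounding cycle on the same side. -/
theorem houseSgn_iff_of_sameSide (hn : 12 ≤ n) (ht : t < 3) {φ : Embedding (gr n (outer 0))}
    (h : SameSide φ (Set.range (cyc (wallEdges t))) 99 (10 * t + 7)) :
    houseSgn φ t ↔ ¬ eps φ := by
  have := simple_gr (n := n) (by omega) (proper_outer 0)
  have h1 : ∀ t < 3, ∀ v ∈ wallVertices t, v ≠ 99 ∧ v ≠ 10 * t + 7 := by decide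
  have h2 := (isCycleWalk_wall hn ht).between_iff_of_sameSide finite_vertexSet_gr finite_edgeSet_gr
    (twoConnected_gr hn 0).2.1 φ (i := 6) (j := 8) (isLink_middle hn ht) (isLink_wall ht)
    (fun j => (h1 t ht _ (cyc_mem (by simp [wallVertices]) j)).1)
    (fun j => (h1 t ht _ (cyc_mem (by simp [wallVertices]) j)).2) h
  exact (between_wall_iff φ).symm.trans (h2.symm.trans (between_middle hn ht φ))

/-- The converse is needed for the constructed embeddings only, whose planets all have this
orientation. -/
theorem sameSide_of_houseSgn (hn : 12 ≤ n) (ht : t < 3) {φ : Embedding (gr n (outer 0))}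
    (h1 : houseSgn φ t) (h2 : ¬ eps φ) :
    SameSide φ (Set.range (cyc (wallEdges t))) 99 (10 * t + 7) :=
  (isCycleWalk_wall hn ht).sameSide_of_between finite_edgeSet_gr φ (i := 6) (j := 8)
    (isLink_middle hn ht) (isLink_wall ht) ((between_middle hn ht φ).2 h2)
    ((between_wall_iff φ).2 h1) (by omega)

theorem exists_orientation (hn : 12 ≤ n) {a b c : Bool} (h : (a || b || c) = true) :
    ∃ σ : SimultaneousEmbedding (sequence hn), ¬ eps (σ.emb 0) ∧
      ∀ t < 3, (houseSgn (σ.emb 0) t ↔ tri a b c t = false) := by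
  obtain ⟨σ, hσ⟩ := exists_simultaneousEmbedding hn h
  have hrot : (σ.emb 0).rot = gRot n (outer 0) (config 0 a b c) := hσ 0
  have hB : rotB (outer 0) (config 0 a b c) = true := rotB_outer (by omega) h
  refine ⟨σ, ?_, fun t ht => ?_⟩
  · have h1 := gRot_rim hn (proper_outer 0) hB (k := 1) (by omega)
    rw [Nat.add_sub_cancel_left, Nat.mod_self, ← hrot] at h1
    have h2 : Between ((σ.emb 0).rot 101) 102 103 100 :=
      between_of_apply h1.1 h1.2 (by omega) (by omega)
    have h3 : (gr n (outer 0)).Inc 102 101 := (gr_rim (k := 1) (by omega)).inc_left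
    have h4 := h2.rotate ((σ.emb 0).isCycleOn 101 h3.vertex_mem)
      (finite_edgeSet_gr.subset ((gr n (outer 0)).incidenceSet_subset_edgeSet _)) h3
    have h5 : (gr n (outer 0)).Inc 103 101 := (gr_spoke (k := 1) (by omega)).inc_right
    exact (h4.rotate ((σ.emb 0).isCycleOn 101 h3.vertex_mem)
      (finite_edgeSet_gr.subset ((gr n (outer 0)).incidenceSet_subset_edgeSet _)) h5).asymm
  · have h1 : ∀ a b c, ∀ t < 3, rotAt (outer 0) (config 0 a b c) (10 * t + 2) =
        flipList (tri a b c t) [10 * t + 1, 10 * t + 7, 10 * t + 2] := by decide +kernel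
    have h2 := nodup_rotList hn (proper_outer 0) hB (10 * t + 2)
    have h3 : (σ.emb 0).rot (10 * t + 2) = (rotList n (outer 0) (config 0 a b c)
      (10 * t + 2)).formPerm := by rw [hrot]; rfl
    rw [rotList, if_neg (by omega), if_neg (by omega), h1 a b c t ht] at h2 h3
    rw [houseSgn, h3]
    cases hb : tri a b c t with
    | false =>
      simp only [hb, flipList, cond_false] at h2 ⊢
      refine iff_of_true (between_of_apply (formPerm_of_append h2 (l₁ := [])
        (l₂ := [10 * t + 2, 10 * t + 1]) rfl) (formPerm_of_append h2 (l₁ := [10 * t + 1])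
        (l₂ := [10 * t + 1]) rfl) (by omega) (by omega)) trivial
    | true =>
      simp only [hb, flipList, cond_true] at h2 ⊢
      refine iff_of_false (Between.asymm (between_of_apply (formPerm_of_append h2
        (l₁ := [10 * t + 2, 10 * t + 7]) (l₂ := []) rfl) (formPerm_of_append h2 (l₁ := [])
        (l₂ := [10 * t + 1, 10 * t + 2]) rfl) (by omega) (by omega))) (by simp)

theorem index_base (hi : 1 ≤ i) (him : 3 * i ≤ m) (ht : t < 3) {h k : ℕ} (hh : h + 2 = 3 * i + t)
    (hk : k < 4) : index m i (4 * h - 3 + k) = 4 * t + k := by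
  have := index_spec hi him (j := 4 * h - 3 + k) (by omega) (by omega)
  omega

theorem image_boundingCycle (hi : 1 ≤ i) (him : 3 * i ≤ m) (ht : t < 3) {h : ℕ}
    (hh : h + 2 = 3 * i + t) :
    toE m i '' boundingCycle h = Set.range (cyc (wallEdges t)) := by
  have h0 : h + 2 - 3 * i = t := by omega
  have h1 := index_base hi him ht hh (k := 0) (by omega)
  have h2 := index_base hi him ht hh (k := 1) (by omega)
  rw [add_zero] at h1
  rw [show 4 * h - 3 + 1 = 4 * h - 2 by omega] at h2
  ext e
  have h3 : e ∈ Set.range (cyc (wallEdges t)) ↔ e ∈ wallEdges t := by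
    constructor
    · rintro ⟨j, rfl⟩
      exact cyc_mem (by simp [wallEdges]) j
    · intro he
      obtain ⟨j, hj, rfl⟩ := List.getElem_of_mem he
      exact ⟨j, by rw [cyc, Nat.mod_eq_of_lt hj, List.getD_eq_getElem _ _ hj]⟩
  rw [h3]
  simp only [wallEdges, List.mem_cons, List.not_mem_nil, or_false, Set.mem_image, boundingCycle,
    Set.mem_ofPred_eq]
  constructor
  · rintro ⟨_, ⟨k, h4, h5, rfl⟩ | rfl | rfl, rfl⟩ <;> simp only [toE, h0, h1, h2] <;> omega
  · intro he
    rcases show (1 ≤ e - 10 * t ∧ e - 10 * t ≤ 6 ∧ 10 * t ≤ e) ∨ e = 102 + 8 * t ∨ e = 100 + 8 * t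
      by omega with h4 | h4 | h4
    · exact ⟨.wall h (e - 10 * t), .inl ⟨_, h4.1, h4.2.1, rfl⟩, by simp only [toE, h0]; omega⟩
    · exact ⟨_, .inr (.inr rfl), by simp only [toE, h2]; omega⟩
    · exact ⟨_, .inr (.inl rfl), by simp only [toE, h1]; omega⟩

theorem inside_housing_iff (hi : 1 ≤ i) (him : 3 * i ≤ m) (ht : t < 3) {h : ℕ}
    (hh : h + 2 = 3 * i + t) (σ : SimultaneousEmbedding (housing hi him).toHybridDeletionSequence) :
    (housing hi him).Inside σ h ↔ ¬ SameSide (G := gr (4 * m) (outer 0)) (σ.emb 0)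
      (Set.range (cyc (wallEdges t))) 99 (10 * t + 7) := by
  have h0 : h + 2 - 3 * i = t := by omega
  rw [← image_boundingCycle hi him ht hh, ← h0]
  rfl

theorem allocationSet_housing (hi : 1 ≤ i) (him : 3 * i ≤ m) :
    (housing hi him).allocationSet = OR {3 * i - 2, 3 * i - 1, 3 * i}
      {(⟨3 * i - 2, by simp⟩, ⟨3 * i - 1, by simp⟩, ⟨3 * i, by simp⟩)} := by
  have hn : 12 ≤ 4 * m := by omega
  ext f
  simp only [OR, Set.mem_singleton_iff, forall_eq, Set.mem_ofPred_eq]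
  constructor
  · rintro ⟨σ, rfl⟩
    by_contra h
    simp only [Bool.not_eq_true, Bool.or_eq_false_iff, HousingSequence.allocation,
      decide_eq_false_iff_not] at h
    refine not_allZero (hn := hn) σ fun t ht => houseSgn_iff_of_sameSide hn ht ?_
    have key : ∀ {h}, h + 2 = 3 * i + t → ¬ (housing hi him).Inside σ h →
        SameSide (G := gr (4 * m) (outer 0)) (σ.emb 0) (Set.range (cyc (wallEdges t))) 99
          (10 * t + 7) := fun hh h => by
      rwa [inside_housing_iff hi him ht hh, not_not] at h
    obtain rfl | rfl | rfl : t = 0 ∨ t = 1 ∨ t = 2 := by omega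
    · exact key (by omega) h.1.1
    · exact key (by omega) h.1.2
    · exact key (by omega) h.2
  · intro h
    obtain ⟨σ, h1, h2⟩ := exists_orientation hn h
    refine ⟨σ, funext fun ⟨x, hx⟩ => ?_⟩
    have key : ∀ t < 3, ∀ b, x + 2 = 3 * i + t → tri (f ⟨3 * i - 2, by simp⟩)
        (f ⟨3 * i - 1, by simp⟩) (f ⟨3 * i, by simp⟩) t = b →
        (housing hi him).allocation σ ⟨x, hx⟩ = b := by
      intro t ht b hh hb
      have hd : (housing hi him).allocation σ ⟨x, hx⟩ = true ↔ (housing hi him).Inside σ x := by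
        simp only [HousingSequence.allocation, decide_eq_true_eq]
      have h3 := h2 t ht
      rw [hb] at h3
      have h4 := inside_housing_iff hi him ht hh σ
      cases b with
      | false =>
        rw [← Bool.not_eq_true, hd, h4, not_not]
        exact sameSide_of_houseSgn hn ht (h3.2 rfl) h1
      | true =>
        rw [hd, h4]
        intro h5
        exact Bool.noConfusion (h3.1 ((houseSgn_iff_of_sameSide hn ht h5).2 h1))
    rcases hx with rfl | rfl | rfl
    · exact key 0 (by omega) _ (by omega) rfl
    · exact key 1 (by omega) _ (by omega) rfl
    · exact key 2 (by omega) _ (by omega) rfl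

end Gadget
end Village

namespace Village
namespace Gadget

variable {n m i t : ℕ}

/-! ### The arches -/

theorem mem_image_planet_vertexSet (hi : 1 ≤ i) (him : 3 * i ≤ m) {v : ℕ} :
    v ∈ toV m i '' (planet m).vertexSet ↔ v = 99 ∨ 100 ≤ v ∧ v < 100 + 4 * m := by
  constructor
  · rintro ⟨x, hx, rfl⟩
    have hx : IsVertex m ∅ x := hx
    cases x with
    | centre => exact .inl rfl
    | surface j =>
      have := index_spec hi him hx.1 hx.2
      right
      simp only [toV]
      omega
    | house h k => exact absurd hx.1 (Set.notMem_empty _)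
    | inhabitant h => exact absurd hx (Set.notMem_empty _)
  · intro hv
    obtain ⟨x, hx, rfl⟩ := (isIso_village hi him).bijOn_vertexSet.surjOn
      (show v ∈ (gr (4 * m) (outer 0)).vertexSet from hv.imp_right .inl)
    have hx : IsVertex m _ x := hx
    cases x with
    | centre => exact ⟨.centre, trivial, rfl⟩
    | surface j => exact ⟨.surface j, hx, rfl⟩
    | house h k =>
      obtain ⟨t, ht, hh⟩ := (mem_triple hi).1 hx.1
      have := hx.2
      simp only [toV] at hv
      omega
    | inhabitant h =>
      obtain ⟨t, ht, hh⟩ := (mem_triple hi).1 hx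
      simp only [toV] at hv
      omega

theorem mem_image_planet_edgeSet (hi : 1 ≤ i) (him : 3 * i ≤ m) {e : ℕ} :
    e ∈ toE m i '' (planet m).edgeSet ↔ 100 ≤ e ∧ e < 100 + 2 * (4 * m) := by
  constructor
  · rintro ⟨x, hx, rfl⟩
    have hx : IsEdge m ∅ x := hx
    cases x with
    | spoke j =>
      have := index_spec hi him hx.1 hx.2
      simp only [toE]
      omega
    | rim j =>
      have := index_spec hi him hx.1 hx.2
      simp only [toE]
      omega
    | wall h k => exact absurd hx.1 (Set.notMem_empty _)
    | claw h k => exact absurd hx.1 (Set.notMem_empty _)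
  · intro he
    obtain ⟨x, hx, rfl⟩ := (isIso_village hi him).bijOn_edgeSet.surjOn
      (show e ∈ (gr (4 * m) (outer 0)).edgeSet from .inr he)
    have hx : IsEdge m _ x := hx
    cases x with
    | spoke j => exact ⟨.spoke j, hx, rfl⟩
    | rim j => exact ⟨.rim j, hx, rfl⟩
    | wall h k =>
      obtain ⟨t, ht, hh⟩ := (mem_triple hi).1 hx.1
      have := hx.2
      simp only [toE] at he
      omega
    | claw h k =>
      obtain ⟨t, ht, hh⟩ := (mem_triple hi).1 hx.1
      have := hx.2
      simp only [toE] at he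
      omega

theorem mem_image_foundation (hi : 1 ≤ i) (him : 3 * i ≤ m) (ht : t < 3) {h : ℕ}
    (hh : h + 2 = 3 * i + t) {v : ℕ} :
    v ∈ toV m i '' foundation h ↔ 100 + 4 * t ≤ v ∧ v < 104 + 4 * t := by
  constructor
  · rintro ⟨x, ⟨j, h1, h2, rfl⟩, rfl⟩
    have := index_base hi him ht hh (k := j - (4 * h - 3)) (by omega)
    rw [show 4 * h - 3 + (j - (4 * h - 3)) = j by omega] at this
    simp only [toV]
    omega
  · intro hv
    have := index_base hi him ht hh (k := v - (100 + 4 * t)) (by omega)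
    exact ⟨_, ⟨4 * h - 3 + (v - (100 + 4 * t)), by omega, by omega, rfl⟩, by
      simp only [toV]; omega⟩

/-- The vertices outside the planet that can be reached from the foundation of the first house. -/
def Reach (k v : ℕ) : Prop :=
  v < 8 ∨ 40 ≤ v ∧ v < if k ≤ 2 then 99 else if k = 3 then 50 else 40

instance {k v : ℕ} : Decidable (Reach k v) := by unfold Reach; infer_instance

/-- No piece is ever attached to the houses 0 and 2 in the same graph. The two bounds differ since a
path starts in the first foundation and ends as soon as it meets the rim again, by then in the first
or second one. -/
theorem reach_step {k : ℕ} (hk : k < 11) {e x y : ℕ} (he : e ∈ outer k)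
    (h : (gr n (outer k)).IsLink e x y) (hx : Reach k x ∨ 100 ≤ x ∧ x < 104) :
    Reach k y ∨ 100 ≤ y ∧ y < 108 := by
  have key : ∀ k < 11, ∀ e ∈ outer k,
      (Reach k (outerEnds e).1 ∨ 100 ≤ (outerEnds e).1 ∧ (outerEnds e).1 < 104 →
        Reach k (outerEnds e).2 ∨ 100 ≤ (outerEnds e).2 ∧ (outerEnds e).2 < 108) ∧
      (Reach k (outerEnds e).2 ∨ 100 ≤ (outerEnds e).2 ∧ (outerEnds e).2 < 104 →
        Reach k (outerEnds e).1 ∨ 100 ≤ (outerEnds e).1 ∧ (outerEnds e).1 < 108) := by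
    decide +kernel
  have h1 := h.2
  rw [gEnds_of_lt ((proper_outer k).lt he), Sym2.eq_iff] at h1
  rcases h1 with ⟨rfl, rfl⟩ | ⟨rfl, rfl⟩
  · exact (key k hk e he).1 hx
  · exact (key k hk e he).2 hx

/-- A property that spreads along the edges outside the planet holds at the end of a path. -/
theorem path_induction {L : List ℕ} {P Q : ℕ → Prop} {p : ℕ → ℕ} {N : ℕ} (hN : 0 < N)
    (h0 : P (p 0)) (hstep : ∀ e ∈ L, ∀ x y, (gr n L).IsLink e x y → P x → Q y)
    (hQ : ∀ x, x < 99 → Q x → P x)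
    (hp : ∀ s < N, ∃ e ∈ L, (gr n L).IsLink e (p s) (p (s + 1)))
    (hin : ∀ s, 0 < s → s < N → p s < 99) : Q (p N) := by
  have key : ∀ s < N, Q (p (s + 1)) := by
    intro s
    induction s with
    | zero =>
      intro hs
      obtain ⟨e, he, hl⟩ := hp 0 hs
      exact hstep e he _ _ hl h0
    | succ s ih =>
      intro hs
      obtain ⟨e, he, hl⟩ := hp (s + 1) hs
      exact hstep e he _ _ hl (hQ _ (hin _ (by omega) hs) (ih (by omega)))
  have := key (N - 1) (by omega)
  rwa [Nat.sub_add_cancel hN] at this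

theorem vertex_lt {k v : ℕ} (hn : 12 ≤ n) (h : v ∈ (gr n (outer k)).vertexSet) :
    v < 99 ∨ v = 99 ∨ 100 ≤ v ∧ v < 100 + n := by
  have h1 : ∀ e ∈ outer k, ∀ v ∈ [(outerEnds e).1, (outerEnds e).2], v < 99 ∨ 100 ≤ v ∧ v < 112 :=
    forall_outer (P := fun L => ∀ e ∈ L, ∀ v ∈ [(outerEnds e).1, (outerEnds e).2],
      v < 99 ∨ 100 ≤ v ∧ v < 112) (by decide +kernel) k
  rcases h with h | h | ⟨e, he, h⟩
  · exact .inr (.inl h)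
  · exact .inr (.inr h)
  · rw [gEnds_of_lt ((proper_outer k).lt he)] at h
    have := h1 e he v (by simpa using h)
    omega

theorem not_isArch (hi : 1 ≤ i) (him : 3 * i ≤ m) :
    ¬ (housing hi him).IsArch (3 * i - 2) (3 * i) ∧ ¬ (housing hi him).IsArch (3 * i) (3 * i - 2) := by
  have hlink : ∀ {k : Fin 15} {N : ℕ} {p : ℕ → ℕ},
      (∀ s < N, ∃ e, e ∉ toE m i '' (planet m).edgeSet ∧
        (gr (4 * m) (outer (min k 10))).IsLink e (p s) (p (s + 1))) →
      ∀ s < N, ∃ e ∈ outer (min k 10),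
        (gr (4 * m) (outer (min k 10))).IsLink e (p s) (p (s + 1)) := by
    intro k N p h s hs
    obtain ⟨e, he, hl⟩ := h s hs
    rw [mem_image_planet_edgeSet hi him] at he
    exact ⟨e, hl.1.resolve_right he, hl⟩
  have hlt : ∀ {k : Fin 15} {N : ℕ} {p : ℕ → ℕ},
      (∀ s < N, ∃ e ∈ outer (min k 10),
        (gr (4 * m) (outer (min k 10))).IsLink e (p s) (p (s + 1))) →
      (∀ s, 0 < s → s < N → p s ∉ toV m i '' (planet m).vertexSet) →
      ∀ s, 0 < s → s < N → p s < 99 := by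
    intro k N p h h' s hs hsN
    obtain ⟨e, -, hl⟩ := h s hsN
    have h1 := h' s hs hsN
    rw [mem_image_planet_vertexSet hi him] at h1
    exact (vertex_lt (by omega) hl.left_mem).resolve_right h1
  have hf := @mem_image_foundation m i
  constructor
  · rintro ⟨k, N, p, h0, hN, -, h1, h2⟩
    have h0 := (hf hi him (t := 0) (by omega) (by omega)).1 h0
    have hN := (hf hi him (t := 2) (by omega) (by omega)).1 hN
    have h3 := hlink h1
    rcases Nat.eq_zero_or_pos N with rfl | hpos
    · omega
    · have := path_induction (P := fun x => Reach (min k 10) x ∨ 100 ≤ x ∧ x < 104)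
        (Q := fun x => Reach (min k 10) x ∨ 100 ≤ x ∧ x < 108) hpos (.inr h0)
        (fun e he x y => reach_step (by omega) he)
        (fun x hx => Or.imp_right fun h => by omega) h3 (hlt h3 h2)
      unfold Reach at this
      split_ifs at this <;> omega
  · rintro ⟨k, N, p, h0, hN, -, h1, h2⟩
    have h0 := (hf hi him (t := 2) (by omega) (by omega)).1 h0
    have hN := (hf hi him (t := 0) (by omega) (by omega)).1 hN
    have h3 := hlink h1
    rcases Nat.eq_zero_or_pos N with rfl | hpos
    · omega
    -- For a path in the other direction the complement of the reachable set spreads instead.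
    · refine path_induction (P := fun x => ¬ (Reach (min k 10) x ∨ 100 ≤ x ∧ x < 108))
        (Q := fun x => ¬ (Reach (min k 10) x ∨ 100 ≤ x ∧ x < 104)) hpos ?_
        (fun e he x y hl => mt (reach_step (by omega) he hl.symm))
        (fun x hx => mt (Or.imp_right fun h => by omega)) h3 (hlt h3 h2) (.inr hN)
      unfold Reach
      split_ifs <;> omega

theorem isArch_housing (hi : 1 ≤ i) (him : 3 * i ≤ m) {k : Fin 15} {h h' t t' a v b e e' : ℕ}
    (ht : t < 3) (ht' : t' < 3) (hh : h + 2 = 3 * i + t) (hh' : h' + 2 = 3 * i + t')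
    (ha : 100 + 4 * t ≤ a ∧ a < 104 + 4 * t) (hb : 100 + 4 * t' ≤ b ∧ b < 104 + 4 * t')
    (hv : v < 99) (hab : a ≠ b) (he : LitLink (outer (min k 10)) e a v)
    (he' : LitLink (outer (min k 10)) e' v b) (hlt : e < 100) (hlt' : e' < 100) :
    (housing hi him).IsArch h h' := by
  refine ⟨k, 2, fun s => if s = 0 then a else if s = 1 then v else b,
    (mem_image_foundation hi him ht hh).2 ha, (mem_image_foundation hi him ht' hh').2 hb, ?_, ?_, ?_⟩
  · intro s hs s' hs' hss
    simp only [Set.mem_Icc] at hs hs'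
    simp only at hss
    split_ifs at hss <;> omega
  · intro s hs
    obtain rfl | rfl : s = 0 ∨ s = 1 := by omega
    · refine ⟨e, fun h => ?_, he.isLink (by omega) (proper_outer _)⟩
      have := (mem_image_planet_edgeSet hi him).1 h
      omega
    · refine ⟨e', fun h => ?_, he'.isLink (by omega) (proper_outer _)⟩
      have := (mem_image_planet_edgeSet hi him).1 h
      omega
  · intro s hs hs2 h
    obtain rfl : s = 1 := by omega
    have : v = 99 ∨ 100 ≤ v ∧ v < 100 + 4 * m := (mem_image_planet_vertexSet hi him).1 h
    omega

theorem arches_housing (hi : 1 ≤ i) (him : 3 * i ≤ m) :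
    (housing hi him).arches = {s(3 * i - 2, 3 * i - 1), s(3 * i - 1, 3 * i)} := by
  ext z
  simp only [HousingSequence.arches, Set.mem_ofPred_eq, Set.mem_insert_iff, Set.mem_singleton_iff]
  constructor
  · rintro ⟨h, hh, h', hh', hne, harch, rfl⟩
    obtain ⟨h1, h2⟩ := not_isArch hi him
    rcases hh with rfl | rfl | rfl <;> rcases hh' with rfl | rfl | rfl
    · exact absurd rfl hne
    · exact .inl rfl
    · exact absurd harch h1
    · exact .inl Sym2.eq_swap
    · exact absurd rfl hne
    · exact .inr rfl
    · exact absurd harch h2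
    · exact .inr Sym2.eq_swap
    · exact absurd rfl hne
  · rintro (rfl | rfl)
    · refine ⟨_, .inl rfl, _, .inr (.inl rfl), by omega, ?_, rfl⟩
      -- In graph 3 piece 0 is attached to the houses 0 and 1 at once.
      exact isArch_housing hi him (k := 3) (t := 0) (t' := 1) (a := 100) (v := 40) (b := 106)
        (e := 45) (e' := 47) (by omega) (by omega) (by omega) (by omega) (by omega) (by omega)
        (by omega) (by omega) (by decide +kernel) (by decide +kernel) (by omega) (by omega)
    · refine ⟨_, .inr (.inl rfl), _, .inr (.inr rfl), by omega, ?_, rfl⟩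
      -- In graph 7 piece 1 is attached to the houses 1 and 2 at once.
      exact isArch_housing hi him (k := 7) (t := 1) (t' := 2) (a := 106) (v := 50) (b := 108)
        (e := 67) (e' := 69) (by omega) (by omega) (by omega) (by omega) (by omega) (by omega)
        (by omega) (by omega) (by decide +kernel) (by decide +kernel) (by omega) (by omega)

end Gadget
end Village

theorem mainTheorem10 (m i : ℕ) (hm : 3 ∣ m) (hi : i ∈ Finset.Icc 1 (m / 3)) :
    ∃ (α β : Type)
      (S : Village.HousingSequence m {3 * i - 2, 3 * i - 1, 3 * i} α β),
      S.length = 15 ∧ S.size ≤ 300 * m ∧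
      S.allocationSet = Village.OR {3 * i - 2, 3 * i - 1, 3 * i}
        {(⟨3 * i - 2, by simp⟩, ⟨3 * i - 1, by simp⟩, ⟨3 * i, by simp⟩)} ∧
      S.arches = {s(3 * i - 2, 3 * i - 1), s(3 * i - 1, 3 * i)} := by
  rw [Finset.mem_Icc] at hi
  have him : 3 * i ≤ m := by omega
  exact ⟨ℕ, ℕ, Village.Gadget.housing hi.1 him, rfl, Village.Gadget.size_housing hi.1 him,
    Village.Gadget.allocationSet_housing hi.1 him, Village.Gadget.arches_housing hi.1 him⟩
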